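/- **Proposition 3.1.** Let $0<\sigma<2$ and $2\le p<\infty$, let $p'=p/(p-1)$ be the Hölder conjugate of $p$, and let $e^{itp(|\nabla|)}$ be the Fourier multiplier operator on $L^2(\mathbb R^3)$ with symbol $e^{itp(|\xi|)}$, where the dispersion relation is $p(r)=(r^2+r^{2-\sigma})^{1/2}$ for $r\ge 0$. Put $$\beta_\sigma=\begin{cases}3\left(\frac12-\frac1p\right) & \text{if } 0<\sigma\le 1,\\[1mm] \frac83\left(\frac12-\frac1p\right) & \text{if } 1<\sigma<2.\end{cases}$$ For real $s\ge 0$ and $1<q<\infty$, let $W^{s,q}(\mathbb R^3)$ be the Sobolev space of all complex-valued $f\in L^q(\mathbb R^3)$ with $\|f\|_{W^{s,q}}:=\|(1-\Delta)^{s/2}f\|_{L^q}<\infty$. Then there is a constant $C>0$, depending only on $\sigma$ and $p$, such that every $f\in W^{6(\frac12-\frac1p),p'}(\mathbb R^3)$ belongs to $L^2(\mathbb R^3)$ and satisfies, for every $t\ge 0$, $$\|e^{itp(|\nabla|)}f\|_{L^p}\le C\,(1+t)^{-\beta_\sigma}\,\|f\|_{W^{6(\frac12-\frac1p),\,p'}}.$$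 -/

import Mathlib

open MeasureTheory FourierTransform TemperedDistribution
open scoped SchwartzMap ENNReal

noncomputable section

namespace RieszDispersive

/-- Three-dimensional Euclidean space. -/
abbrev R3 : Type := EuclideanSpace ℝ (Fin 3)

/-- The dispersion relation `p(r) = (r² + r^(2-σ))^(1/2)`, for `r ≥ 0`. -/
def dispersion (σ r : ℝ) : ℝ := Real.sqrt (r ^ 2 + r ^ (2 - σ))

/-- The symbol of `e^{itp(|∇|)}`. Mathlib's Fourier transform has the kernel `e^{-2πi⟨x,ξ⟩}`, so
`|∇|` is the multiplier `2π‖ξ‖`. -/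
def symbol (σ t : ℝ) (ξ : R3) : ℂ :=
  Complex.exp (Complex.I * ((t * dispersion σ (2 * Real.pi * ‖ξ‖) : ℝ) : ℂ))

theorem symbol_memLp (σ t : ℝ) : MemLp (symbol σ t) ∞ (volume : Measure R3) := by
  have hm : Measurable (symbol σ t) := by
    unfold symbol dispersion
    fun_prop
  refine memLp_top_of_bound hm.aestronglyMeasurable 1 (Filter.Eventually.of_forall fun ξ => ?_)
  rw [symbol, mul_comm, Complex.norm_exp_ofReal_mul_I]

/-- The linear propagator `e^{itp(|∇|)}` on `L²(ℝ³)`: the Fourier multiplier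
`u ↦ 𝓕⁻¹ (e^{itp(|·|)} 𝓕 u)`, with the Fourier transform of `L²`. -/
def propagator (σ t : ℝ) (u : Lp (α := R3) ℂ 2) : Lp (α := R3) ℂ 2 :=
  𝓕⁻ (((symbol_memLp σ t).toLp (symbol σ t) • 𝓕 u : Lp (α := R3) ℂ 2))

/-- The operator `⟨∇⟩^s = (1 - Δ)^(s/2)` on tempered distributions, that is the Fourier multiplier
`(1 + |2πξ|²)^(s/2)`. -/
def japaneseBracket (s : ℝ) : 𝓢'(R3, ℂ) →L[ℂ] 𝓢'(R3, ℂ) :=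
  fourierMultiplierCLM ℂ (fun ξ : R3 => (((1 + (2 * Real.pi * ‖ξ‖) ^ 2) ^ (s / 2) : ℝ) : ℂ))

/-- The `W^{s,q}` norm `‖⟨∇⟩^s f‖_{L^q}` of `f ∈ L^q(ℝ³)`, for real `s`. It is `∞` if the tempered
distribution `⟨∇⟩^s f` is not an `L^q` function (and then `f ∉ W^{s,q}`); otherwise there is
exactly one `g` in the infimum. -/
def sobolevENorm (s : ℝ) {q : ℝ≥0∞} [Fact (1 ≤ q)] (f : Lp (α := R3) ℂ q) : ℝ≥0∞ :=
  ⨅ (g : Lp (α := R3) ℂ q) (_ : japaneseBracket s (f : 𝓢'(R3, ℂ)) = (g : 𝓢'(R3, ℂ))),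
    eLpNorm g q volume

/-- The exponent of decay: `3(1/2 - 1/p)` if `σ ≤ 1`, and `(8/3)(1/2 - 1/p)` if `σ > 1`. -/
def decayRate (σ p : ℝ) : ℝ :=
  if σ ≤ 1 then 3 * (1 / 2 - 1 / p) else 8 / 3 * (1 / 2 - 1 / p)

/-- The Hölder conjugate `p' = 1 + (p - 1)⁻¹` is at least `1`. -/
instance fact_one_le_conjExponent (p : ℝ≥0∞) : Fact (1 ≤ p.conjExponent) :=
  ⟨by simp [ENNReal.conjExponent]⟩

end RieszDispersive

end

open RieszDispersive

/-! The estimate is Stein interpolation for the analytic family of multipliers `radialSymbol σ t z`,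
that is e^{itp(|∇|)}⟨∇⟩^{-3z}. On Re z = 0 the symbol has modulus one and Plancherel bounds the
operator on L². On Re z = 1 the kernel is bounded by C|z|²t^{-3/2} if σ ≤ 1 and by C|z|²t^{-4/3} if
σ > 1, so the operator maps L¹ to L^∞. At z = θ = 1 - 2/p the order 3θ is 6(1/2 - 1/p), the pair of
exponents is (p', p), and the kernel rate times θ is the claimed rate.

The kernel is radial, and after integration over spheres it becomes an oscillatory integral in r =
2π|ξ| with phase t p(r) + v r, where |v| ≤ |x|. Since p' ≥ 1 - σ/2, there is no stationary point if
|x| is below a small multiple of t, and two integrations by parts give t^{-2}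
(`norm_integral_cexp_mul_le_of_nonstationary`). For larger |x| the spherical average supplies a
factor 1/|x|, hence 1/t, and the second derivative test with weights (`norm_integral_cexp_mul_le`)
supplies t^{-1/2}. The weight (1 + r²)^{-3/2} is both the size of the Sobolev amplitude and a lower
bound, up to a constant, for |p''|. For σ > 1, however, p'' has a simple zero; a window of width
t^{-1/3} has to be removed around it, and t^{-1/2} drops to t^{-1/3}. The result is
`exists_norm_fourier_radialSymbol_le`, for symbols cut off to a ball of radius R, uniformly in large
R; the interpolation is `norm_setIntegral_radialSymbol_le`.

For t ≤ 1 no decay is needed: half of the derivatives take L^{p'} to L² and the other half take L²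
to L^p, by Sobolev embedding and its dual (`exists_norm_besselL2_le`). All this is proved for simple
functions u = ⟨∇⟩^s f; `exists_seq_besselL2_tendsto` and lower semicontinuity of the L^p norm carry
it to all f. -/

open RieszDispersive

/-! ### Van der Corput estimates for oscillatory integrals. -/

section VanDerCorput

open Set Complex

lemma hasDerivAt_cexp_mul_I {φ : ℝ → ℝ} {φ' x : ℝ} (h : HasDerivAt φ φ' x) :
    HasDerivAt (fun r => cexp (I * (φ r : ℂ))) (cexp (I * (φ x : ℂ)) * (I * (φ' : ℂ))) x :=
  (h.ofReal_comp.const_mul I).cexp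

lemma norm_cexp_I_mul_ofReal (x : ℝ) : ‖cexp (I * (x : ℂ))‖ = 1 := by
  rw [mul_comm, norm_exp_ofReal_mul_I]

/-- The first derivative test of van der Corput, for an increasing phase with increasing
derivative. -/
lemma norm_integral_cexp_le_of_le_deriv {φ φ₁ φ₂ : ℝ → ℝ} {a b μ : ℝ} (hab : a ≤ b) (hμ : 0 < μ)
    (h1 : ∀ x ∈ Icc a b, HasDerivAt φ (φ₁ x) x) (h2 : ∀ x ∈ Icc a b, HasDerivAt φ₁ (φ₂ x) x)
    (hc : ContinuousOn φ₂ (Icc a b)) (hl : ∀ x ∈ Icc a b, μ ≤ φ₁ x)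
    (hpos : ∀ x ∈ Icc a b, 0 ≤ φ₂ x) :
    ‖∫ x in a..b, cexp (I * (φ x : ℂ))‖ ≤ 3 / μ := by
  have hI : uIcc a b = Icc a b := uIcc_of_le hab
  have c0 : ContinuousOn φ (Icc a b) := fun x hx => (h1 x hx).continuousAt.continuousWithinAt
  have c1 : ContinuousOn φ₁ (Icc a b) := fun x hx => (h2 x hx).continuousAt.continuousWithinAt
  have hne : ∀ x ∈ Icc a b, φ₁ x ≠ 0 := fun x hx => (hμ.trans_le (hl x hx)).ne'
  have hneC : ∀ x ∈ Icc a b, (φ₁ x : ℂ) ≠ 0 := fun x hx => by exact_mod_cast hne x hx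
  have ce : ContinuousOn (fun x => cexp (I * (φ x : ℂ))) (Icc a b) :=
    (continuousOn_const.mul (continuous_ofReal.comp_continuousOn c0)).cexp
  have cq : ContinuousOn (fun x => φ₂ x / φ₁ x ^ 2) (Icc a b) :=
    hc.div (c1.pow 2) fun x hx => pow_ne_zero 2 (hne x hx)
  have cs : ContinuousOn (fun x => cexp (I * (φ x : ℂ)) * I * ((φ₂ x / φ₁ x ^ 2 : ℝ) : ℂ))
      (Icc a b) := (ce.mul continuousOn_const).mul (continuous_ofReal.comp_continuousOn cq)
  -- Integration by parts as an explicit primitive: e^{iφ} is the derivative of e^{iφ}/(iφ') up to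
  -- the error i e^{iφ} φ''/φ'².
  have hG : ∀ x ∈ uIcc a b, HasDerivAt (fun x => cexp (I * (φ x : ℂ)) * (-I) * ((φ₁ x)⁻¹ : ℝ))
      (cexp (I * (φ x : ℂ)) + cexp (I * (φ x : ℂ)) * I * ((φ₂ x / φ₁ x ^ 2 : ℝ) : ℂ)) x := by
    intro x hx
    rw [hI] at hx
    have := ((hasDerivAt_cexp_mul_I (h1 x hx)).mul_const (-I)).mul
      ((h2 x hx).inv (hne x hx)).ofReal_comp
    refine this.congr_deriv ?_
    have := hneC x hx
    simp only [Pi.inv_apply]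
    push_cast
    field_simp
    ring_nf
    simp only [I_sq]
    ring
  have e1 := intervalIntegral.integral_eq_sub_of_hasDerivAt hG
    ((ce.add cs).intervalIntegrable_of_Icc hab)
  rw [intervalIntegral.integral_add (ce.intervalIntegrable_of_Icc hab)
    (cs.intervalIntegrable_of_Icc hab)] at e1
  -- As φ'' ≥ 0, the modulus of the error is the exact derivative of -1/φ', so its integral
  -- telescopes. It costs 1/μ, and the two endpoints cost 1/μ each.
  have hR : ∀ x ∈ uIcc a b, HasDerivAt (fun x => -(φ₁ x)⁻¹) (φ₂ x / φ₁ x ^ 2) x := by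
    intro x hx
    rw [hI] at hx
    refine ((h2 x hx).inv (hne x hx)).neg.congr_deriv (by ring)
  have e2 := intervalIntegral.integral_eq_sub_of_hasDerivAt hR (cq.intervalIntegrable_of_Icc hab)
  have hb : ‖∫ x in a..b, cexp (I * (φ x : ℂ)) * I * ((φ₂ x / φ₁ x ^ 2 : ℝ) : ℂ)‖ ≤ 1 / μ := by
    refine (intervalIntegral.norm_integral_le_integral_norm hab).trans ?_
    have : ∫ x in a..b, ‖cexp (I * (φ x : ℂ)) * I * ((φ₂ x / φ₁ x ^ 2 : ℝ) : ℂ)‖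
        = ∫ x in a..b, φ₂ x / φ₁ x ^ 2 := by
      refine intervalIntegral.integral_congr fun x hx => ?_
      rw [hI] at hx
      have : 0 ≤ φ₂ x / φ₁ x ^ 2 := div_nonneg (hpos x hx) (sq_nonneg _)
      simp only [norm_mul, norm_cexp_I_mul_ofReal, norm_I, one_mul, norm_real, Real.norm_eq_abs,
        abs_of_nonneg this]
    rw [this, e2]
    have hA := hl a (left_mem_Icc.2 hab)
    have hB := hl b (right_mem_Icc.2 hab)
    have : 0 ≤ (φ₁ b)⁻¹ := inv_nonneg.2 (hμ.le.trans hB)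
    have : (φ₁ a)⁻¹ ≤ 1 / μ := by rw [one_div]; exact inv_anti₀ hμ hA
    linarith
  have hend : ∀ x ∈ Icc a b, ‖cexp (I * (φ x : ℂ)) * (-I) * ((φ₁ x)⁻¹ : ℝ)‖ ≤ 1 / μ := by
    intro x hx
    have := hl x hx
    rw [norm_mul, norm_mul, norm_cexp_I_mul_ofReal, norm_neg, norm_I, one_mul, one_mul, norm_real,
      Real.norm_eq_abs, abs_of_nonneg (inv_nonneg.2 (hμ.le.trans this)), one_div]
    exact inv_anti₀ hμ this
  rw [eq_sub_of_add_eq e1]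
  refine (norm_sub_le _ _).trans ?_
  refine (add_le_add ((norm_sub_le _ _).trans
    (add_le_add (hend b (right_mem_Icc.2 hab)) (hend a (left_mem_Icc.2 hab)))) hb).trans ?_
  apply le_of_eq; ring

lemma norm_integral_cexp_le_sub {φ : ℝ → ℝ} {a b : ℝ} (hab : a ≤ b) :
    ‖∫ x in a..b, cexp (I * (φ x : ℂ))‖ ≤ b - a := by
  have := intervalIntegral.norm_integral_le_of_norm_le_const (a := a) (b := b) (C := 1)
    (f := fun x => cexp (I * (φ x : ℂ))) (fun x _ => (norm_cexp_I_mul_ofReal _).le)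
  rwa [one_mul, abs_of_nonneg (sub_nonneg.2 hab)] at this

/-- The derivative starts nonnegative and grows at rate at least l, so it exceeds √l beyond distance
1/√l from a. The initial piece costs its length 1/√l and the first derivative test on the rest costs
3/√l. -/
lemma norm_integral_cexp_le_of_deriv_nonneg {φ φ₁ φ₂ : ℝ → ℝ} {a b l : ℝ} (hab : a ≤ b)
    (hl : 0 < l) (h1 : ∀ x ∈ Icc a b, HasDerivAt φ (φ₁ x) x)
    (h2 : ∀ x ∈ Icc a b, HasDerivAt φ₁ (φ₂ x) x) (hc : ContinuousOn φ₂ (Icc a b))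
    (hφ : ∀ x ∈ Icc a b, l ≤ φ₂ x) (h0 : 0 ≤ φ₁ a) :
    ‖∫ x in a..b, cexp (I * (φ x : ℂ))‖ ≤ 4 / √l := by
  have hs : 0 < √l := Real.sqrt_pos.2 hl
  rcases le_or_gt (b - a) (1 / √l) with h | h
  · refine (norm_integral_cexp_le_sub hab).trans (h.trans ?_)
    gcongr; norm_num
  set c := a + 1 / √l with hcdef
  have hac : a ≤ c := by rw [hcdef]; linarith [one_div_pos.2 hs]
  have hcb : c ≤ b := by rw [hcdef]; linarith
  have hsub : Icc c b ⊆ Icc a b := Icc_subset_Icc_left hac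
  have hgrow : ∀ x ∈ Icc c b, √l ≤ φ₁ x := by
    intro x hx
    have hmono : MonotoneOn (fun x => φ₁ x - l * x) (Icc a b) := by
      refine monotoneOn_of_hasDerivWithinAt_nonneg (f' := fun x => φ₂ x - l) (convex_Icc a b) ?_ ?_ ?_
      · exact fun x hx => ((h2 x hx).sub ((hasDerivAt_id x).const_mul l)).continuousAt.continuousWithinAt
      · intro x hx
        have := ((h2 x (interior_subset hx)).sub ((hasDerivAt_id x).const_mul l))
        exact (this.congr_deriv (by simp)).hasDerivWithinAt
      · exact fun x hx => sub_nonneg.2 (hφ x (interior_subset hx))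
    have := hmono (left_mem_Icc.2 hab) (hsub hx) (hac.trans hx.1)
    have h3 : l * (1 / √l) ≤ l * (x - a) := by
      gcongr; have := hx.1; rw [hcdef] at this; linarith
    have h4 : l * (1 / √l) = √l := by rw [mul_one_div, Real.div_sqrt]
    simp only at this
    linarith
  have hi : ∀ u v, u ∈ Icc a b → v ∈ Icc a b →
      IntervalIntegrable (fun x => cexp (I * (φ x : ℂ))) volume u v := by
    intro u v hu hv
    refine ContinuousOn.intervalIntegrable fun x hx => ?_
    exact (hasDerivAt_cexp_mul_I (h1 x (uIcc_subset_Icc hu hv hx))).continuousAt.continuousWithinAt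
  rw [← intervalIntegral.integral_add_adjacent_intervals
    (hi a c (left_mem_Icc.2 hab) ⟨hac, hcb⟩) (hi c b ⟨hac, hcb⟩ (right_mem_Icc.2 hab))]
  refine (norm_add_le _ _).trans ((add_le_add (norm_integral_cexp_le_sub hac)
    (norm_integral_cexp_le_of_le_deriv hcb hs (fun x hx => h1 x (hsub hx))
      (fun x hx => h2 x (hsub hx)) (hc.mono hsub) hgrow
      fun x hx => hl.le.trans (hφ x (hsub hx)))).trans ?_)
  rw [hcdef]; apply le_of_eq; ring

/-- Mirror image of the previous case under x ↦ -x, which keeps the sign of φ'' and flips that of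
φ'. -/
lemma norm_integral_cexp_le_of_deriv_nonpos {φ φ₁ φ₂ : ℝ → ℝ} {a b l : ℝ} (hab : a ≤ b)
    (hl : 0 < l) (h1 : ∀ x ∈ Icc a b, HasDerivAt φ (φ₁ x) x)
    (h2 : ∀ x ∈ Icc a b, HasDerivAt φ₁ (φ₂ x) x) (hc : ContinuousOn φ₂ (Icc a b))
    (hφ : ∀ x ∈ Icc a b, l ≤ φ₂ x) (h0 : φ₁ b ≤ 0) :
    ‖∫ x in a..b, cexp (I * (φ x : ℂ))‖ ≤ 4 / √l := by
  have key : ∀ x ∈ Icc (-b) (-a), -x ∈ Icc a b := fun x hx =>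
    ⟨by linarith [hx.2], by linarith [hx.1]⟩
  have := norm_integral_cexp_le_of_deriv_nonneg (φ := fun x => φ (-x)) (φ₁ := fun x => -φ₁ (-x))
    (φ₂ := fun x => φ₂ (-x)) (a := -b) (b := -a) (l := l) (by linarith) hl
    (fun x hx => ((h1 (-x) (key x hx)).comp x (hasDerivAt_neg x)).congr_deriv (by simp))
    (fun x hx => ((h2 (-x) (key x hx)).comp x (hasDerivAt_neg x)).neg.congr_deriv (by simp))
    (hc.comp continuousOn_neg key) (fun x hx => hφ _ (key x hx)) (by simpa using h0)
  rwa [intervalIntegral.integral_comp_neg (fun x => cexp (I * (φ x : ℂ))), neg_neg, neg_neg] at this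

/-- The second derivative test of van der Corput. -/
lemma norm_integral_cexp_le_of_le_deriv_two {φ φ₁ φ₂ : ℝ → ℝ} {a b l : ℝ} (hab : a ≤ b)
    (hl : 0 < l) (h1 : ∀ x ∈ Icc a b, HasDerivAt φ (φ₁ x) x)
    (h2 : ∀ x ∈ Icc a b, HasDerivAt φ₁ (φ₂ x) x) (hc : ContinuousOn φ₂ (Icc a b))
    (hφ : ∀ x ∈ Icc a b, l ≤ φ₂ x) :
    ‖∫ x in a..b, cexp (I * (φ x : ℂ))‖ ≤ 8 / √l := by
  have hs : 0 < √l := Real.sqrt_pos.2 hl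
  have h48 : 4 / √l ≤ 8 / √l := by gcongr; norm_num
  rcases le_or_gt 0 (φ₁ a) with h0 | h0
  · exact (norm_integral_cexp_le_of_deriv_nonneg hab hl h1 h2 hc hφ h0).trans h48
  rcases le_or_gt (φ₁ b) 0 with h0' | h0'
  · exact (norm_integral_cexp_le_of_deriv_nonpos hab hl h1 h2 hc hφ h0').trans h48
  -- The only stationary point; the two one-sided bounds meet there and add up to 8/√l.
  obtain ⟨c, hcm, hc0⟩ : (0 : ℝ) ∈ φ₁ '' Icc a b :=
    intermediate_value_Icc hab (fun x hx => (h2 x hx).continuousAt.continuousWithinAt)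
      ⟨h0.le, h0'.le⟩
  have hi : ∀ u v, u ∈ Icc a b → v ∈ Icc a b →
      IntervalIntegrable (fun x => cexp (I * (φ x : ℂ))) volume u v := by
    intro u v hu hv
    refine ContinuousOn.intervalIntegrable fun x hx => ?_
    exact (hasDerivAt_cexp_mul_I (h1 x (uIcc_subset_Icc hu hv hx))).continuousAt.continuousWithinAt
  rw [← intervalIntegral.integral_add_adjacent_intervals
    (hi a c (left_mem_Icc.2 hab) hcm) (hi c b hcm (right_mem_Icc.2 hab))]
  have s1 : Icc a c ⊆ Icc a b := Icc_subset_Icc_right hcm.2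
  have s2 : Icc c b ⊆ Icc a b := Icc_subset_Icc_left hcm.1
  refine (norm_add_le _ _).trans ((add_le_add
    (norm_integral_cexp_le_of_deriv_nonpos hcm.1 hl (fun x hx => h1 x (s1 hx))
      (fun x hx => h2 x (s1 hx)) (hc.mono s1) (fun x hx => hφ x (s1 hx)) hc0.le)
    (norm_integral_cexp_le_of_deriv_nonneg hcm.2 hl (fun x hx => h1 x (s2 hx))
      (fun x hx => h2 x (s2 hx)) (hc.mono s2) (fun x hx => hφ x (s2 hx)) hc0.ge)).trans ?_)
  apply le_of_eq; ring

/-- The second derivative test, for a phase whose second derivative has either sign. -/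
lemma norm_integral_cexp_le_of_le_abs_deriv_two {φ φ₁ φ₂ : ℝ → ℝ} {a b l : ℝ} (hab : a ≤ b)
    (hl : 0 < l) (h1 : ∀ x ∈ Icc a b, HasDerivAt φ (φ₁ x) x)
    (h2 : ∀ x ∈ Icc a b, HasDerivAt φ₁ (φ₂ x) x) (hc : ContinuousOn φ₂ (Icc a b))
    (hφ : (∀ x ∈ Icc a b, l ≤ φ₂ x) ∨ ∀ x ∈ Icc a b, l ≤ -φ₂ x) :
    ‖∫ x in a..b, cexp (I * (φ x : ℂ))‖ ≤ 8 / √l := by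
  rcases hφ with hφ | hφ
  · exact norm_integral_cexp_le_of_le_deriv_two hab hl h1 h2 hc hφ
  have := norm_integral_cexp_le_of_le_deriv_two (φ := fun x => -φ x) hab hl
    (fun x hx => (h1 x hx).neg) (fun x hx => (h2 x hx).neg) hc.neg hφ
  -- Conjugation turns the phase φ into -φ and preserves the modulus.
  rw [← Complex.norm_conj, intervalIntegral.integral_of_le hab, ← integral_conj]
  rw [intervalIntegral.integral_of_le hab] at this
  have hconj : ∀ x, (starRingEnd ℂ) (cexp (I * (φ x : ℂ))) = cexp (I * ((-φ x : ℝ) : ℂ)) := by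
    intro x
    rw [← exp_conj]
    simp
  simp_rw [hconj]
  exact this

/-- The second derivative test with an amplitude and with a lower bound `l * k x` on the second
derivative, where the weight `k` is decreasing. -/
lemma norm_integral_cexp_mul_le {φ φ₁ φ₂ k : ℝ → ℝ} {A A₁ : ℝ → ℂ} {a b l : ℝ}
    (hab : a ≤ b) (hl : 0 < l) (h1 : ∀ x ∈ Icc a b, HasDerivAt φ (φ₁ x) x)
    (h2 : ∀ x ∈ Icc a b, HasDerivAt φ₁ (φ₂ x) x) (hc : ContinuousOn φ₂ (Icc a b))
    (hk : AntitoneOn k (Icc a b)) (hkc : ContinuousOn k (Icc a b)) (hk0 : ∀ x ∈ Icc a b, 0 < k x)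
    (hφ : (∀ x ∈ Icc a b, l * k x ≤ φ₂ x) ∨ ∀ x ∈ Icc a b, l * k x ≤ -φ₂ x)
    (hA : ∀ x ∈ Icc a b, HasDerivAt A (A₁ x) x) (hA1 : ContinuousOn A₁ (Icc a b)) :
    ‖∫ x in a..b, cexp (I * (φ x : ℂ)) * A x‖ ≤
      8 / √l * (‖A b‖ / √(k b) + ∫ x in a..b, ‖A₁ x‖ / √(k x)) := by
  have hI : uIcc a b = Icc a b := uIcc_of_le hab
  have hs : 0 < √l := Real.sqrt_pos.2 hl
  have ce : ContinuousOn (fun x => cexp (I * (φ x : ℂ))) (Icc a b) := fun x hx =>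
    (hasDerivAt_cexp_mul_I (h1 x hx)).continuousAt.continuousWithinAt
  -- The amplitude is integrated by parts against this primitive of e^{iφ}, which is small at every
  -- v by the test on [a, v].
  set E : ℝ → ℂ := fun v => ∫ x in a..v, cexp (I * (φ x : ℂ)) with hE
  have hEb : ∀ v ∈ Icc a b, ‖E v‖ ≤ 8 / √l / √(k v) := by
    intro v hv
    have hsub : Icc a v ⊆ Icc a b := Icc_subset_Icc_right hv.2
    have hkv := hk0 v hv
    rw [div_div, ← Real.sqrt_mul hl.le]
    refine norm_integral_cexp_le_of_le_abs_deriv_two hv.1 (mul_pos hl hkv)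
      (fun x hx => h1 x (hsub hx)) (fun x hx => h2 x (hsub hx)) (hc.mono hsub) ?_
    -- A decreasing weight attains its minimum over [a, v] at v, so the test on [a, v] sees exactly
    -- l * k v.
    have hkm : ∀ x ∈ Icc a v, l * k v ≤ l * k x := fun x hx =>
      mul_le_mul_of_nonneg_left (hk (hsub hx) hv hx.2) hl.le
    exact hφ.imp (fun h x hx => (hkm x hx).trans (h x (hsub hx)))
      (fun h x hx => (hkm x hx).trans (h x (hsub hx)))
  have hEc : ContinuousOn E (Icc a b) := by
    have := intervalIntegral.continuousOn_primitive_interval (μ := volume) (a := a) (b := b)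
      (f := fun x => cexp (I * (φ x : ℂ))) (by rw [hI]; exact ce.integrableOn_Icc)
    rwa [hI] at this
  have hEd : ∀ x ∈ Ioo (min a b) (max a b), HasDerivAt E (cexp (I * (φ x : ℂ))) x := by
    intro x hx
    rw [min_eq_left hab, max_eq_right hab] at hx
    have hx' := Ioo_subset_Icc_self hx
    exact intervalIntegral.integral_hasDerivAt_right
      ((ce.mono (Icc_subset_Icc_right hx'.2)).intervalIntegrable_of_Icc hx'.1)
      ((ce.mono Ioo_subset_Icc_self).stronglyMeasurableAtFilter isOpen_Ioo x hx)
      (hasDerivAt_cexp_mul_I (h1 x hx')).continuousAt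
  have hAc : ContinuousOn A (Icc a b) := fun x hx => (hA x hx).continuousAt.continuousWithinAt
  have ibp := intervalIntegral.integral_mul_deriv_eq_deriv_mul_of_hasDerivAt
    (u := A) (v := E) (u' := A₁) (v' := fun x => cexp (I * (φ x : ℂ))) (a := a) (b := b)
    (by rwa [hI]) (by rwa [hI])
    (fun x hx => hA x (by
      rw [min_eq_left hab, max_eq_right hab] at hx; exact Ioo_subset_Icc_self hx)) hEd
    (hA1.intervalIntegrable_of_Icc hab) (ce.intervalIntegrable_of_Icc hab)
  have hEa : E a = 0 := by simp [hE]
  simp_rw [mul_comm (cexp _)]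
  rw [ibp, hEa, mul_zero, sub_zero]
  refine (norm_sub_le _ _).trans ?_
  rw [mul_add]
  refine add_le_add ?_ ?_
  · rw [norm_mul]
    refine (mul_le_mul_of_nonneg_left (hEb b (right_mem_Icc.2 hab)) (norm_nonneg _)).trans ?_
    apply le_of_eq; ring
  · refine (intervalIntegral.norm_integral_le_integral_norm hab).trans ?_
    rw [← intervalIntegral.integral_const_mul]
    refine intervalIntegral.integral_mono_on hab ?_ ?_ fun x hx => ?_
    · exact (hA1.mul hEc).norm.intervalIntegrable_of_Icc hab
    · exact (continuousOn_const.mul (hA1.norm.div hkc.sqrt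
        fun x hx => (Real.sqrt_pos.2 (hk0 x hx)).ne')).intervalIntegrable_of_Icc hab
    · rw [norm_mul]
      refine (mul_le_mul_of_nonneg_left (hEb x hx) (norm_nonneg _)).trans ?_
      apply le_of_eq; ring

end VanDerCorput

/-! ### Integration by parts away from stationary points. -/

section IntegrationByParts

open Set Complex

/-- One integration by parts with e^{iφ} = (e^{iφ})'/(iφ'). The new amplitude is (A/φ')', and the
estimate has a form that can be iterated. -/
lemma integral_cexp_mul_eq {φ φ₁ φ₂ : ℝ → ℝ} {A A₁ : ℝ → ℂ} {a b : ℝ} (hab : a ≤ b)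
    (h1 : ∀ x ∈ Icc a b, HasDerivAt φ (φ₁ x) x) (h2 : ∀ x ∈ Icc a b, HasDerivAt φ₁ (φ₂ x) x)
    (hc : ContinuousOn φ₂ (Icc a b)) (hpos : ∀ x ∈ Icc a b, 0 < φ₁ x)
    (hA : ∀ x ∈ Icc a b, HasDerivAt A (A₁ x) x) (hA1 : ContinuousOn A₁ (Icc a b)) :
    ‖∫ x in a..b, cexp (I * (φ x : ℂ)) * A x‖ ≤ ‖A b‖ / φ₁ b + ‖A a‖ / φ₁ a +
      ‖∫ x in a..b, cexp (I * (φ x : ℂ)) * (A₁ x / φ₁ x - A x * φ₂ x / (φ₁ x) ^ 2)‖ := by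
  have hI : uIcc a b = Icc a b := uIcc_of_le hab
  have c1 : ContinuousOn φ₁ (Icc a b) := fun x hx => (h2 x hx).continuousAt.continuousWithinAt
  have cA : ContinuousOn A (Icc a b) := fun x hx => (hA x hx).continuousAt.continuousWithinAt
  have hne : ∀ x ∈ Icc a b, φ₁ x ≠ 0 := fun x hx => (hpos x hx).ne'
  have hneC : ∀ x ∈ Icc a b, (φ₁ x : ℂ) ≠ 0 := fun x hx => by exact_mod_cast hne x hx
  have ce : ContinuousOn (fun x => cexp (I * (φ x : ℂ))) (Icc a b) := fun x hx =>
    (hasDerivAt_cexp_mul_I (h1 x hx)).continuousAt.continuousWithinAt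
  have c1' : ContinuousOn (fun x => (φ₁ x : ℂ)) (Icc a b) := continuous_ofReal.comp_continuousOn c1
  have c2' : ContinuousOn (fun x => (φ₂ x : ℂ)) (Icc a b) := continuous_ofReal.comp_continuousOn hc
  have cB : ContinuousOn (fun x => A₁ x / φ₁ x - A x * φ₂ x / (φ₁ x : ℂ) ^ 2) (Icc a b) :=
    (hA1.div c1' hneC).sub ((cA.mul c2').div (c1'.pow 2) fun x hx => pow_ne_zero 2 (hneC x hx))
  have i1 : IntervalIntegrable (fun x => cexp (I * (φ x : ℂ)) * A x) volume a b := (ce.mul cA).intervalIntegrable_of_Icc hab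
  have i2 : IntervalIntegrable (fun x => I * (cexp (I * (φ x : ℂ)) *
      (A₁ x / φ₁ x - A x * φ₂ x / (φ₁ x : ℂ) ^ 2))) volume a b := ((continuousOn_const (c := I)).mul (ce.mul cB)).intervalIntegrable_of_Icc hab
  have hG : ∀ x ∈ uIcc a b, HasDerivAt (fun x => cexp (I * (φ x : ℂ)) * (-I * (A x / φ₁ x)))
      (cexp (I * (φ x : ℂ)) * A x -
        I * (cexp (I * (φ x : ℂ)) * (A₁ x / φ₁ x - A x * φ₂ x / (φ₁ x : ℂ) ^ 2))) x := by
    intro x hx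
    rw [hI] at hx
    have := hneC x hx
    refine ((hasDerivAt_cexp_mul_I (h1 x hx)).mul
      (((hA x hx).div (h2 x hx).ofReal_comp this).const_mul (-I))).congr_deriv ?_
    simp only [Pi.div_apply]
    field_simp
    ring_nf
    simp only [I_sq]
    ring
  have e1 := intervalIntegral.integral_eq_sub_of_hasDerivAt hG (i1.sub i2)
  rw [intervalIntegral.integral_sub i1 i2, intervalIntegral.integral_const_mul] at e1
  have hend : ∀ x ∈ Icc a b, ‖cexp (I * (φ x : ℂ)) * (-I * (A x / φ₁ x))‖ = ‖A x‖ / φ₁ x := by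
    intro x hx
    rw [norm_mul, norm_mul, norm_div, norm_cexp_I_mul_ofReal, norm_neg, norm_I, one_mul, one_mul,
      norm_real, Real.norm_eq_abs, abs_of_pos (hpos x hx)]
  rw [sub_eq_iff_eq_add.1 e1, ← hend b (right_mem_Icc.2 hab), ← hend a (left_mem_Icc.2 hab)]
  refine (norm_add_le _ _).trans (add_le_add (norm_sub_le _ _) (le_of_eq ?_))
  rw [norm_mul, norm_I, one_mul]

/-- Nonstationary phase: two integrations by parts, for a symbol-like amplitude of weight
`x ^ 2 * k x` and a phase with symbol-like derivative. -/
lemma norm_integral_cexp_mul_le_of_nonstationary {φ φ₁ φ₂ φ₃ k : ℝ → ℝ} {A A₁ A₂ : ℝ → ℂ}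
    {a b M μ : ℝ} (ha : 0 < a) (hab : a ≤ b) (hM : 0 ≤ M) (hμ : 0 < μ)
    (h1 : ∀ x ∈ Icc a b, HasDerivAt φ (φ₁ x) x) (h2 : ∀ x ∈ Icc a b, HasDerivAt φ₁ (φ₂ x) x)
    (h3 : ∀ x ∈ Icc a b, HasDerivAt φ₂ (φ₃ x) x) (hc : ContinuousOn φ₃ (Icc a b))
    (hφ1 : ∀ x ∈ Icc a b, μ ≤ φ₁ x) (hφ2 : ∀ x ∈ Icc a b, |φ₂ x| ≤ M * φ₁ x / x)
    (hφ3 : ∀ x ∈ Icc a b, |φ₃ x| ≤ M * φ₁ x / x ^ 2)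
    (hA : ∀ x ∈ Icc a b, HasDerivAt A (A₁ x) x) (hA' : ∀ x ∈ Icc a b, HasDerivAt A₁ (A₂ x) x)
    (hA2 : ContinuousOn A₂ (Icc a b)) (hk : ContinuousOn k (Icc a b))
    (bA : ∀ x ∈ Icc a b, ‖A x‖ ≤ x ^ 2 * k x) (bA1 : ∀ x ∈ Icc a b, ‖A₁ x‖ ≤ x * k x)
    (bA2 : ∀ x ∈ Icc a b, ‖A₂ x‖ ≤ k x) :
    ‖∫ x in a..b, cexp (I * (φ x : ℂ)) * A x‖ ≤ (b ^ 2 * k b + a ^ 2 * k a) / μ +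
      (1 + M) * (b * k b + a * k a) / μ ^ 2 +
      (1 + 4 * M + 3 * M ^ 2) / μ ^ 2 * ∫ x in a..b, k x := by
  have c1 : ContinuousOn φ₁ (Icc a b) := fun x hx => (h2 x hx).continuousAt.continuousWithinAt
  have c2 : ContinuousOn φ₂ (Icc a b) := fun x hx => (h3 x hx).continuousAt.continuousWithinAt
  have cA : ContinuousOn A (Icc a b) := fun x hx => (hA x hx).continuousAt.continuousWithinAt
  have cA1 : ContinuousOn A₁ (Icc a b) := fun x hx => (hA' x hx).continuousAt.continuousWithinAt
  have hx0 : ∀ x ∈ Icc a b, 0 < x := fun x hx => ha.trans_le hx.1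
  have hpos : ∀ x ∈ Icc a b, 0 < φ₁ x := fun x hx => hμ.trans_le (hφ1 x hx)
  have hneC : ∀ x ∈ Icc a b, (φ₁ x : ℂ) ≠ 0 := fun x hx => by exact_mod_cast (hpos x hx).ne'
  have c1' : ContinuousOn (fun x => (φ₁ x : ℂ)) (Icc a b) := continuous_ofReal.comp_continuousOn c1
  have c2' : ContinuousOn (fun x => (φ₂ x : ℂ)) (Icc a b) := continuous_ofReal.comp_continuousOn c2
  have c3' : ContinuousOn (fun x => (φ₃ x : ℂ)) (Icc a b) := continuous_ofReal.comp_continuousOn hc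
  have hk0 : ∀ x ∈ Icc a b, 0 ≤ k x := fun x hx => (norm_nonneg _).trans (bA2 x hx)
  -- `B` is the amplitude after one integration by parts, and `B₁` is its derivative.
  set B : ℝ → ℂ := fun x => A₁ x / φ₁ x - A x * φ₂ x / (φ₁ x) ^ 2 with hB
  set B₁ : ℝ → ℂ := fun x => A₂ x / φ₁ x - 2 * (A₁ x * φ₂ x) / (φ₁ x) ^ 2
    - A x * φ₃ x / (φ₁ x) ^ 2 + 2 * (A x * φ₂ x ^ 2) / (φ₁ x) ^ 3 with hB1
  have dB : ∀ x ∈ Icc a b, HasDerivAt B (B₁ x) x := by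
    intro x hx
    have := hneC x hx
    have d1 := (h2 x hx).ofReal_comp
    have d2 := (h3 x hx).ofReal_comp
    refine (((hA' x hx).div d1 this).sub
      (((hA x hx).mul d2).div (d1.pow 2) (pow_ne_zero 2 this))).congr_deriv ?_
    simp only [hB1, Pi.mul_apply, Pi.pow_apply]
    field_simp
    push_cast
    ring
  have cB1 : ContinuousOn B₁ (Icc a b) :=
    (((hA2.div c1' hneC).sub ((continuousOn_const.mul (cA1.mul c2')).div (c1'.pow 2)
      fun x hx => pow_ne_zero 2 (hneC x hx))).sub ((cA.mul c3').div (c1'.pow 2)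
      fun x hx => pow_ne_zero 2 (hneC x hx))).add
      ((continuousOn_const.mul (cA.mul (c2'.pow 2))).div (c1'.pow 3)
      fun x hx => pow_ne_zero 3 (hneC x hx))
  have bB : ∀ x ∈ Icc a b, ‖B x‖ / φ₁ x ≤ (1 + M) * (x * k x) / μ ^ 2 := by
    intro x hx
    have hp := hpos x hx
    have hx' := hx0 x hx
    have hkx := hk0 x hx
    have hn : ‖(φ₁ x : ℂ)‖ = φ₁ x := by rw [norm_real, Real.norm_eq_abs, abs_of_pos hp]
    have : ‖B x‖ ≤ (1 + M) * (x * k x) / φ₁ x := by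
      refine (norm_sub_le _ _).trans ?_
      rw [norm_div, norm_div, norm_mul, norm_pow, hn, norm_real, Real.norm_eq_abs]
      calc ‖A₁ x‖ / φ₁ x + ‖A x‖ * |φ₂ x| / φ₁ x ^ 2
          ≤ x * k x / φ₁ x + (x ^ 2 * k x) * (M * φ₁ x / x) / φ₁ x ^ 2 := by
            gcongr
            exacts [bA1 x hx, bA x hx, hφ2 x hx]
        _ = _ := by field_simp
    calc ‖B x‖ / φ₁ x ≤ (1 + M) * (x * k x) / φ₁ x / φ₁ x := by gcongr
      _ = (1 + M) * (x * k x) / φ₁ x ^ 2 := by rw [div_div, sq]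
      _ ≤ _ := by gcongr; exact hφ1 x hx
  have bC : ∀ x ∈ Icc a b, ‖B₁ x / φ₁ x - B x * φ₂ x / (φ₁ x) ^ 2‖ ≤
      (1 + 4 * M + 3 * M ^ 2) / μ ^ 2 * k x := by
    intro x hx
    have hp := hpos x hx
    have hx' := hx0 x hx
    have hkx := hk0 x hx
    have hn : ‖(φ₁ x : ℂ)‖ = φ₁ x := by rw [norm_real, Real.norm_eq_abs, abs_of_pos hp]
    have hne := hneC x hx
    -- The amplitude after two integrations by parts. Its four terms contribute 1, 3M, M and 3M² to
    -- the constant 1 + 4M + 3M².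
    have e : B₁ x / φ₁ x - B x * φ₂ x / (φ₁ x) ^ 2 = A₂ x / φ₁ x ^ 2
        - 3 * (A₁ x * φ₂ x) / φ₁ x ^ 3 - A x * φ₃ x / φ₁ x ^ 3
        + 3 * (A x * φ₂ x ^ 2) / φ₁ x ^ 4 := by
      simp only [hB, hB1]
      field_simp
      ring
    rw [e]
    calc _ ≤ ‖A₂ x‖ / φ₁ x ^ 2 + 3 * (‖A₁ x‖ * |φ₂ x|) / φ₁ x ^ 3 + ‖A x‖ * |φ₃ x| / φ₁ x ^ 3
        + 3 * (‖A x‖ * |φ₂ x| ^ 2) / φ₁ x ^ 4 := by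
          refine (norm_add_le _ _).trans (add_le_add ((norm_sub_le _ _).trans (add_le_add
            ((norm_sub_le _ _).trans (add_le_add ?_ ?_)) ?_)) ?_) <;>
          simp [abs_of_pos hp]
      _ ≤ k x / φ₁ x ^ 2 + 3 * (x * k x * (M * φ₁ x / x)) / φ₁ x ^ 3
        + (x ^ 2 * k x) * (M * φ₁ x / x ^ 2) / φ₁ x ^ 3
        + 3 * ((x ^ 2 * k x) * (M * φ₁ x / x) ^ 2) / φ₁ x ^ 4 := by
          gcongr
          exacts [bA2 x hx, bA1 x hx, hφ2 x hx, bA x hx, hφ3 x hx, bA x hx, hφ2 x hx]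
      _ = (1 + 4 * M + 3 * M ^ 2) / φ₁ x ^ 2 * k x := by field_simp; ring
      _ ≤ _ := by gcongr; exact hφ1 x hx
  have bA0 : ∀ x ∈ Icc a b, ‖A x‖ / φ₁ x ≤ x ^ 2 * k x / μ := fun x hx =>
    div_le_div₀ (mul_nonneg (sq_nonneg _) (hk0 x hx)) (bA x hx) hμ (hφ1 x hx)
  have ea := left_mem_Icc.2 hab
  have eb := right_mem_Icc.2 hab
  have s1 := integral_cexp_mul_eq hab h1 h2 c2 hpos hA cA1
  have s2 := integral_cexp_mul_eq hab h1 h2 c2 hpos dB cB1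
  have s3 : ‖∫ x in a..b, cexp (I * (φ x : ℂ)) * (B₁ x / φ₁ x - B x * φ₂ x / (φ₁ x) ^ 2)‖ ≤
      (1 + 4 * M + 3 * M ^ 2) / μ ^ 2 * ∫ x in a..b, k x := by
    rw [← intervalIntegral.integral_const_mul]
    refine intervalIntegral.norm_integral_le_of_norm_le hab ?_
      ((continuousOn_const.mul hk).intervalIntegrable_of_Icc hab)
    refine Filter.Eventually.of_forall fun x hx => ?_
    rw [norm_mul, norm_cexp_I_mul_ofReal, one_mul]
    exact bC x (Ioc_subset_Icc_self hx)
  have := bA0 a ea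
  have := bA0 b eb
  have := bB a ea
  have := bB b eb
  rw [add_div, mul_add, add_div]
  linarith

end IntegrationByParts

/-! ### Derivatives of the dispersion relation, and the weight (1 + r²)^{-3/2}. -/

noncomputable section DispersionDerivatives

open Set

/-- The factor `(1 + r^(-σ))^(1/2)`, so that the dispersion relation is `r * dispFactor σ r`. -/
def dispFactor (σ r : ℝ) : ℝ := √(1 + r ^ (-σ))

/-- The first derivative of the dispersion relation. -/
def dispDeriv (σ r : ℝ) : ℝ := (1 - σ / 2) * dispFactor σ r + σ / 2 / dispFactor σ r

/-- The second derivative of the dispersion relation. -/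
def dispDeriv₂ (σ r : ℝ) : ℝ :=
  -(σ / 2 / r) * (1 - σ / 2 - σ / 2 / dispFactor σ r ^ 2) * (dispFactor σ r - 1 / dispFactor σ r)

/-- The third derivative of the dispersion relation. -/
def dispDeriv₃ (σ r : ℝ) : ℝ :=
  σ / 2 / r ^ 2 * (dispFactor σ r - 1 / dispFactor σ r) *
    ((1 - σ / 2 - σ / 2 / dispFactor σ r ^ 2) + σ / 2 *
      (2 * (σ / 2) / dispFactor σ r ^ 3 * (dispFactor σ r - 1 / dispFactor σ r) +
        (1 - σ / 2 - σ / 2 / dispFactor σ r ^ 2) * (1 + 1 / dispFactor σ r ^ 2)))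

variable {σ r : ℝ}

lemma one_le_dispFactor (hr : 0 ≤ r) : 1 ≤ dispFactor σ r := by
  rw [dispFactor, Real.one_le_sqrt]
  linarith [Real.rpow_nonneg hr (-σ)]

lemma dispFactor_sq (hr : 0 ≤ r) : dispFactor σ r ^ 2 = 1 + r ^ (-σ) :=
  Real.sq_sqrt (by linarith [Real.rpow_nonneg hr (-σ)])

lemma dispersion_eq_mul_dispFactor (hr : 0 < r) : dispersion σ r = r * dispFactor σ r := by
  have h : r ^ 2 + r ^ (2 - σ) = r ^ 2 * (1 + r ^ (-σ)) := by
    rw [mul_add, mul_one, sub_eq_add_neg, Real.rpow_add hr, Real.rpow_two]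
  rw [dispersion, h, Real.sqrt_mul (sq_nonneg r), Real.sqrt_sq hr.le, dispFactor]

/-- With s = `dispFactor σ r` one has r^{-σ} = s² - 1. The derivative is therefore rational in s and
r, and so are all later ones, which reduces their verification to algebra. -/
lemma hasDerivAt_dispFactor (hr : 0 < r) : HasDerivAt (dispFactor σ)
    (-(σ / 2 / r) * (dispFactor σ r - 1 / dispFactor σ r)) r := by
  have h1 : HasDerivAt (fun x : ℝ => 1 + x ^ (-σ)) (-σ * r ^ (-σ - 1)) r :=
    (Real.hasDerivAt_rpow_const (Or.inl hr.ne')).const_add 1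
  have hs := zero_lt_one.trans_le (one_le_dispFactor (σ := σ) hr.le)
  have hpos : (1 + r ^ (-σ)) ≠ 0 := by
    rw [← dispFactor_sq hr.le]; positivity
  refine (h1.sqrt hpos).congr_deriv ?_
  change _ / (2 * dispFactor σ r) = _
  have h2 : r ^ (-σ - 1) = (dispFactor σ r ^ 2 - 1) / r := by
    rw [dispFactor_sq hr.le, Real.rpow_sub_one hr.ne']; ring
  rw [h2]
  field_simp

lemma hasDerivAt_dispersion (hr : 0 < r) : HasDerivAt (dispersion σ) (dispDeriv σ r) r := by
  have hs := zero_lt_one.trans_le (one_le_dispFactor (σ := σ) hr.le)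
  have h := (hasDerivAt_id r).mul (hasDerivAt_dispFactor (σ := σ) hr)
  have he : dispersion σ =ᶠ[nhds r] id * dispFactor σ := by
    filter_upwards [eventually_gt_nhds hr] with x hx
    exact dispersion_eq_mul_dispFactor hx
  refine (h.congr_of_eventuallyEq he).congr_deriv ?_
  simp only [dispDeriv, id]
  field_simp
  ring

lemma hasDerivAt_dispDeriv (hr : 0 < r) : HasDerivAt (dispDeriv σ) (dispDeriv₂ σ r) r := by
  have hs := zero_lt_one.trans_le (one_le_dispFactor (σ := σ) hr.le)
  have h := hasDerivAt_dispFactor (σ := σ) hr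
  refine ((h.const_mul (1 - σ / 2)).add ((hasDerivAt_const r (σ / 2)).div h hs.ne')).congr_deriv ?_
  simp only [dispDeriv₂]
  field_simp
  ring

lemma hasDerivAt_dispDeriv₂ (hr : 0 < r) : HasDerivAt (dispDeriv₂ σ) (dispDeriv₃ σ r) r := by
  have hs := zero_lt_one.trans_le (one_le_dispFactor (σ := σ) hr.le)
  have h := hasDerivAt_dispFactor (σ := σ) hr
  have e1 := ((hasDerivAt_const r (σ / 2)).div (hasDerivAt_id r) hr.ne').neg
  have e2 := ((hasDerivAt_const r (σ / 2)).div (h.pow 2) (pow_ne_zero 2 hs.ne')).const_sub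
    (1 - σ / 2)
  have e3 := h.sub ((hasDerivAt_const r (1 : ℝ)).div h hs.ne')
  refine ((e1.mul e2).mul e3).congr_deriv ?_
  simp only [dispDeriv₃, id, Pi.neg_apply, Pi.div_apply, Pi.pow_apply, Pi.mul_apply, Pi.sub_apply]
  field_simp
  ring

lemma continuousOn_dispFactor : ContinuousOn (dispFactor σ) (Ioi 0) := fun _ hx =>
  (hasDerivAt_dispFactor hx).continuousAt.continuousWithinAt

lemma continuousOn_dispDeriv₃ : ContinuousOn (dispDeriv₃ σ) (Ioi 0) := by
  have c := continuousOn_dispFactor (σ := σ)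
  have hs : ∀ x ∈ Ioi (0 : ℝ), dispFactor σ x ≠ 0 := fun x hx =>
    (zero_lt_one.trans_le (one_le_dispFactor (σ := σ) (le_of_lt hx))).ne'
  have c2 : ContinuousOn (fun x => 1 - σ / 2 - σ / 2 / dispFactor σ x ^ 2) (Ioi 0) :=
    continuousOn_const.sub (continuousOn_const.div (c.pow 2) fun x hx => pow_ne_zero 2 (hs x hx))
  have c3 : ContinuousOn (fun x => dispFactor σ x - 1 / dispFactor σ x) (Ioi 0) :=
    c.sub (continuousOn_const.div c hs)
  unfold dispDeriv₃
  refine ((continuousOn_const.div (continuousOn_id.pow 2) fun x hx =>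
    pow_ne_zero 2 (ne_of_gt hx)).mul c3).mul (c2.add (continuousOn_const.mul
    (((continuousOn_const.div (c.pow 3) fun x hx => pow_ne_zero 3 (hs x hx)).mul c3).add
    (c2.mul (continuousOn_const.add (continuousOn_const.div (c.pow 2)
      fun x hx => pow_ne_zero 2 (hs x hx)))))))

lemma continuous_dispersion (hσ₂ : σ < 2) : Continuous (dispersion σ) := by
  unfold dispersion
  exact ((continuous_id.pow 2).add (Real.continuous_rpow_const (by linarith))).sqrt

/-- The lower bound on the group velocity. It separates the two regimes of the kernel, and it keeps
the factor `dispFactor σ r`, which is unbounded near r = 0 and reappears in the bounds for the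
higher derivatives. -/
lemma le_dispDeriv (hσ₀ : 0 < σ) (hr : 0 < r) : (1 - σ / 2) * dispFactor σ r ≤ dispDeriv σ r := by
  have hs := zero_lt_one.trans_le (one_le_dispFactor (σ := σ) hr.le)
  have : 0 ≤ σ / 2 / dispFactor σ r := by positivity
  rw [dispDeriv]; linarith

lemma abs_dispDeriv_aux (hσ₀ : 0 < σ) (hσ₂ : σ < 2) {s : ℝ} (hs : 1 ≤ s) :
    |1 - σ / 2 - σ / 2 / s ^ 2| ≤ 1 := by
  have h1 : 0 ≤ σ / 2 / s ^ 2 := by positivity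
  have h2 : σ / 2 / s ^ 2 ≤ σ / 2 := div_le_self (by linarith) (one_le_pow₀ hs)
  rw [abs_le]; constructor <;> linarith

lemma abs_sub_one_div_le {s : ℝ} (hs : 1 ≤ s) : |s - 1 / s| ≤ s := by
  have h1 : 0 ≤ 1 / s := by positivity
  have h2 : 1 / s ≤ 1 := div_le_self zero_le_one hs
  rw [abs_le]; constructor <;> linarith

/-- Here and for the third derivative, each differentiation costs one power of r relative to
`dispFactor σ r`, hence relative to p'. This is the symbol condition required for nonstationary
phase. -/
lemma abs_dispDeriv₂_le (hσ₀ : 0 < σ) (hσ₂ : σ < 2) (hr : 0 < r) :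
    |dispDeriv₂ σ r| ≤ dispFactor σ r / r := by
  have hs := one_le_dispFactor (σ := σ) hr.le
  have h0 : |σ / 2 / r| ≤ 1 / r := by
    rw [abs_of_pos (by positivity)]; gcongr; linarith
  rw [dispDeriv₂, abs_mul, abs_mul, abs_neg]
  calc _ ≤ 1 / r * 1 * dispFactor σ r := by
        gcongr
        exacts [abs_dispDeriv_aux hσ₀ hσ₂ hs, abs_sub_one_div_le hs]
    _ = _ := by ring

lemma abs_dispDeriv₃_le (hσ₀ : 0 < σ) (hσ₂ : σ < 2) (hr : 0 < r) :
    |dispDeriv₃ σ r| ≤ 5 * dispFactor σ r / r ^ 2 := by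
  have hs := one_le_dispFactor (σ := σ) hr.le
  set s := dispFactor σ r with hsdef
  have hs0 : 0 < s := zero_lt_one.trans_le hs
  have h0 : |σ / 2 / r ^ 2| ≤ 1 / r ^ 2 := by
    rw [abs_of_pos (by positivity)]; gcongr; linarith
  have h1 := abs_dispDeriv_aux hσ₀ hσ₂ hs
  have h2 : |2 * (σ / 2) / s ^ 3 * (s - 1 / s)| ≤ 2 := by
    rw [abs_mul, abs_of_pos (by positivity)]
    calc _ ≤ 2 * (σ / 2) / s ^ 3 * s := by gcongr; exact abs_sub_one_div_le hs
      _ = σ / s ^ 2 := by field_simp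
      _ ≤ σ := div_le_self hσ₀.le (one_le_pow₀ hs)
      _ ≤ 2 := hσ₂.le
  have h3 : |1 + 1 / s ^ 2| ≤ 2 := by
    rw [abs_of_pos (by positivity)]
    have := div_le_self zero_le_one (one_le_pow₀ hs : 1 ≤ s ^ 2)
    linarith
  rw [dispDeriv₃, abs_mul, abs_mul]
  calc _ ≤ 1 / r ^ 2 * s * (1 + 1 * (2 + 1 * 2)) := by
        gcongr
        · exact abs_sub_one_div_le hs
        · refine (abs_add_le _ _).trans (add_le_add h1 ?_)
          rw [abs_mul, abs_of_pos (by linarith : 0 < σ / 2)]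
          gcongr
          · linarith
          · refine (abs_add_le _ _).trans (add_le_add h2 ?_)
            rw [abs_mul]
            gcongr
    _ = _ := by ring

/-- The weight `(1 + r²)^(-3/2)`. -/
def jweight (r : ℝ) : ℝ := ((1 + r ^ 2) * √(1 + r ^ 2))⁻¹

lemma jweight_pos (r : ℝ) : 0 < jweight r := by unfold jweight; positivity

lemma continuous_jweight : Continuous jweight := by
  unfold jweight
  exact Continuous.inv₀ (by fun_prop) fun x => by positivity

lemma one_le_sqrt_one_add_sq (r : ℝ) : 1 ≤ √(1 + r ^ 2) := by
  rw [Real.one_le_sqrt]; nlinarith [sq_nonneg r]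

lemma jweight_le_inv (r : ℝ) : jweight r ≤ (1 + r ^ 2)⁻¹ := by
  unfold jweight
  exact inv_anti₀ (by positivity) (le_mul_of_one_le_right (by positivity) (one_le_sqrt_one_add_sq r))

lemma jweight_le_one (r : ℝ) : jweight r ≤ 1 :=
  (jweight_le_inv r).trans (inv_le_one_of_one_le₀ (by nlinarith [sq_nonneg r]))

lemma sq_mul_jweight_le_one (r : ℝ) : r ^ 2 * jweight r ≤ 1 := by
  calc r ^ 2 * jweight r ≤ (1 + r ^ 2) * (1 + r ^ 2)⁻¹ := by
        gcongr
        · exact (jweight_pos r).le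
        · linarith
        · exact jweight_le_inv r
    _ = 1 := mul_inv_cancel₀ (by positivity)

lemma jweight_le_inv_pow {r : ℝ} (hr : 0 < r) : jweight r ≤ (r ^ 3)⁻¹ := by
  unfold jweight
  refine inv_anti₀ (by positivity) ?_
  have h : r ≤ √(1 + r ^ 2) := Real.le_sqrt_of_sq_le (by linarith)
  nlinarith [sq_nonneg r, mul_le_mul_of_nonneg_left h (sq_nonneg r)]

lemma mul_jweight_le_one (r : ℝ) : r * jweight r ≤ 1 := by
  have h1 := sq_mul_jweight_le_one r
  have h2 := jweight_le_one r
  have h3 := jweight_pos r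
  nlinarith [sq_nonneg (r - 1)]

lemma antitoneOn_jweight : AntitoneOn jweight (Ici 0) := by
  intro x hx y hy hxy
  have hx : 0 ≤ x := hx
  unfold jweight
  gcongr

lemma integral_jweight_le {a b : ℝ} (hab : a ≤ b) : ∫ x in a..b, jweight x ≤ 4 := by
  calc ∫ x in a..b, jweight x ≤ ∫ x in a..b, (1 + x ^ 2)⁻¹ := by
        refine intervalIntegral.integral_mono_on hab (continuous_jweight.intervalIntegrable _ _)
          (Continuous.intervalIntegrable (Continuous.inv₀ (by fun_prop) fun x => by positivity) _ _)
          fun x _ => jweight_le_inv x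
    _ = Real.arctan b - Real.arctan a := integral_inv_one_add_sq
    _ ≤ 4 := by
      linarith [Real.arctan_lt_pi_div_two b, Real.neg_pi_div_two_lt_arctan a, Real.pi_le_four]

/-- The function is (1 + r²)^{-3/4}, of decay r^{-3/2}. Its integral bounds the total variation term
in the weighted second derivative test. -/
lemma integrable_sqrt_jweight : Integrable (fun r => √(jweight r)) := by
  have h := integrable_rpow_neg_one_add_norm_sq (E := ℝ) (μ := volume) (r := 3 / 2)
    (by norm_num [Module.finrank_self])
  refine h.congr (Filter.Eventually.of_forall fun x => ?_)
  have h1 : (0 : ℝ) < 1 + x ^ 2 := by positivity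
  simp only [jweight, Real.norm_eq_abs, sq_abs]
  rw [Real.sqrt_eq_rpow, Real.sqrt_eq_rpow, Real.inv_rpow (by positivity), neg_div,
    Real.rpow_neg h1.le]
  nth_rewrite 2 [← Real.rpow_one (1 + x ^ 2)]
  rw [← Real.rpow_add h1, ← Real.rpow_mul h1.le]
  norm_num

end DispersionDerivatives

/-! ### The complex Sobolev amplitude, and the nonstationary regime. -/

noncomputable section Amplitude

open Set

/-- The amplitude `(1 + r²)^(-3z/2)`. -/
def amplitude (z : ℂ) (r : ℝ) : ℂ := Complex.exp (-(3 / 2) * z * (Real.log (1 + r ^ 2) : ℂ))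

lemma norm_amplitude (z : ℂ) (r : ℝ) :
    ‖amplitude z r‖ = Real.exp (-(3 / 2) * z.re * Real.log (1 + r ^ 2)) := by
  rw [amplitude, Complex.norm_exp]
  congr 1
  rw [Complex.re_mul_ofReal]
  congr 1
  have : (-(3 / 2) : ℂ) = ((-(3 / 2) : ℝ) : ℂ) := by push_cast; ring
  rw [this, Complex.re_ofReal_mul]

lemma norm_amplitude_of_re_eq_one {z : ℂ} (hz : z.re = 1) (r : ℝ) :
    ‖amplitude z r‖ = jweight r := by
  have h1 : (0 : ℝ) < 1 + r ^ 2 := by positivity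
  rw [norm_amplitude, hz, jweight, Real.sqrt_eq_rpow, ← Real.rpow_one_add' h1.le (by norm_num),
    ← Real.rpow_neg h1.le, Real.rpow_def_of_pos h1]
  congr 1; ring

lemma norm_amplitude_le_one {z : ℂ} (hz : 0 ≤ z.re) (r : ℝ) : ‖amplitude z r‖ ≤ 1 := by
  rw [norm_amplitude, Real.exp_le_one_iff]
  have := Real.log_nonneg (by nlinarith [sq_nonneg r] : 1 ≤ 1 + r ^ 2)
  nlinarith [mul_nonneg hz this]

lemma hasDerivAt_amplitude (z : ℂ) (r : ℝ) :
    HasDerivAt (amplitude z) (amplitude z r * (-3 * z * (r / (1 + r ^ 2) : ℝ))) r := by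
  have h1 : (1 + r ^ 2 : ℝ) ≠ 0 := by positivity
  have h := (((hasDerivAt_pow 2 r).const_add 1).log h1).ofReal_comp
  refine ((h.const_mul (-(3 / 2) * z)).cexp).congr_deriv ?_
  rw [amplitude]
  push_cast
  ring

lemma continuous_amplitude (z : ℂ) : Continuous (amplitude z) :=
  continuous_iff_continuousAt.2 fun r => (hasDerivAt_amplitude z r).continuousAt

/-- The first derivative of `r * amplitude z r`. -/
def linAmpDeriv (z : ℂ) (r : ℝ) : ℂ := amplitude z r * (1 - 3 * z * (r ^ 2 / (1 + r ^ 2) : ℝ))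

lemma hasDerivAt_linAmp (z : ℂ) (r : ℝ) :
    HasDerivAt (fun r : ℝ => (r : ℂ) * amplitude z r) (linAmpDeriv z r) r := by
  have h := (hasDerivAt_id r).ofReal_comp
  refine (h.mul (hasDerivAt_amplitude z r)).congr_deriv ?_
  simp only [linAmpDeriv, id]
  push_cast
  ring

lemma continuous_linAmpDeriv (z : ℂ) : Continuous (linAmpDeriv z) := by
  unfold linAmpDeriv
  refine (continuous_amplitude z).mul (continuous_const.sub (continuous_const.mul
    (Complex.continuous_ofReal.comp ?_)))
  exact Continuous.div (by fun_prop) (by fun_prop) fun x => by positivity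

lemma norm_sq_div_le (r : ℝ) : ‖((r ^ 2 / (1 + r ^ 2) : ℝ) : ℂ)‖ ≤ 1 := by
  rw [Complex.norm_real, Real.norm_eq_abs, abs_of_nonneg (by positivity)]
  exact div_le_one_of_le₀ (by linarith) (by positivity)

lemma one_le_norm_of_re_eq_one {z : ℂ} (hz : z.re = 1) : 1 ≤ ‖z‖ := by
  have := Complex.abs_re_le_norm z
  rwa [hz, abs_one] at this

/-- Differentiation keeps the weight and costs only a power of |z|. Such polynomial growth on the
line Re z = 1 is harmless in the interpolation. -/
lemma norm_linAmpDeriv_le {z : ℂ} (hz : z.re = 1) (r : ℝ) :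
    ‖linAmpDeriv z r‖ ≤ 4 * ‖z‖ * jweight r := by
  have h1 := one_le_norm_of_re_eq_one hz
  rw [linAmpDeriv, norm_mul, norm_amplitude_of_re_eq_one hz, mul_comm]
  refine mul_le_mul_of_nonneg_right ?_ (jweight_pos r).le
  refine (norm_sub_le _ _).trans ?_
  rw [norm_mul, norm_mul, norm_one]
  have := mul_le_mul_of_nonneg_left (norm_sq_div_le r) (norm_nonneg z)
  norm_num
  norm_num at this
  linarith

/-- The first derivative of `r² * amplitude z r`. -/
def quadAmpDeriv (z : ℂ) (r : ℝ) : ℂ :=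
  r * (amplitude z r * (2 - 3 * z * (r ^ 2 / (1 + r ^ 2) : ℝ)))

/-- The second derivative of `r² * amplitude z r`. -/
def quadAmpDeriv₂ (z : ℂ) (r : ℝ) : ℂ :=
  amplitude z r * ((2 - 3 * z * (r ^ 2 / (1 + r ^ 2) : ℝ)) *
    (1 - 3 * z * (r ^ 2 / (1 + r ^ 2) : ℝ)) -
    6 * z * ((r ^ 2 / (1 + r ^ 2) : ℝ) * (1 / (1 + r ^ 2) : ℝ)))

lemma hasDerivAt_quadAmp (z : ℂ) (r : ℝ) :
    HasDerivAt (fun r : ℝ => (r : ℂ) ^ 2 * amplitude z r) (quadAmpDeriv z r) r := by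
  have h := ((hasDerivAt_id r).ofReal_comp).pow 2
  refine (h.mul (hasDerivAt_amplitude z r)).congr_deriv ?_
  simp only [quadAmpDeriv, id]
  push_cast
  simp
  ring

lemma hasDerivAt_quadAmpDeriv (z : ℂ) (r : ℝ) :
    HasDerivAt (quadAmpDeriv z) (quadAmpDeriv₂ z r) r := by
  have h := (hasDerivAt_id r).ofReal_comp
  have h1 : (1 + r ^ 2 : ℝ) ≠ 0 := by positivity
  have h1' : (1 + (r : ℂ) ^ 2) ≠ 0 := by exact_mod_cast h1
  have hw := (((hasDerivAt_pow 2 r).div ((hasDerivAt_pow 2 r).const_add 1) h1).ofReal_comp.const_mul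
    (3 * z)).const_sub 2
  refine (h.mul ((hasDerivAt_amplitude z r).mul hw)).congr_deriv ?_
  simp only [quadAmpDeriv₂, id, Pi.mul_apply, Pi.div_apply]
  push_cast
  field_simp
  ring

lemma continuous_quadAmpDeriv₂ (z : ℂ) : Continuous (quadAmpDeriv₂ z) := by
  have c1 : Continuous fun r : ℝ => ((r ^ 2 / (1 + r ^ 2) : ℝ) : ℂ) :=
    Complex.continuous_ofReal.comp
      (Continuous.div (by fun_prop) (by fun_prop) fun x => by positivity)
  have c2 : Continuous fun r : ℝ => ((1 / (1 + r ^ 2) : ℝ) : ℂ) :=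
    Complex.continuous_ofReal.comp
      (Continuous.div (by fun_prop) (by fun_prop) fun x => by positivity)
  have c3 := continuous_amplitude z
  unfold quadAmpDeriv₂
  fun_prop

lemma norm_quadAmpDeriv_le {z : ℂ} (hz : z.re = 1) {r : ℝ} (hr : 0 ≤ r) :
    ‖quadAmpDeriv z r‖ ≤ r * (26 * ‖z‖ ^ 2 * jweight r) := by
  have h1 := one_le_norm_of_re_eq_one hz
  rw [quadAmpDeriv, norm_mul, norm_mul, norm_amplitude_of_re_eq_one hz, Complex.norm_real,
    Real.norm_eq_abs, abs_of_nonneg hr, mul_comm (jweight r)]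
  refine mul_le_mul_of_nonneg_left (mul_le_mul_of_nonneg_right ?_ (jweight_pos r).le) hr
  refine (norm_sub_le _ _).trans ?_
  rw [norm_mul, norm_mul]
  have := mul_le_mul_of_nonneg_left (norm_sq_div_le r) (norm_nonneg z)
  norm_num
  norm_num at this
  nlinarith

lemma norm_quadAmpDeriv₂_le {z : ℂ} (hz : z.re = 1) (r : ℝ) :
    ‖quadAmpDeriv₂ z r‖ ≤ 26 * ‖z‖ ^ 2 * jweight r := by
  have h1 := one_le_norm_of_re_eq_one hz
  rw [quadAmpDeriv₂, norm_mul, norm_amplitude_of_re_eq_one hz, mul_comm]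
  refine mul_le_mul_of_nonneg_right ?_ (jweight_pos r).le
  have hw := mul_le_mul_of_nonneg_left (norm_sq_div_le r) (norm_nonneg z)
  have h3 : ‖3 * z * ((r ^ 2 / (1 + r ^ 2) : ℝ) : ℂ)‖ ≤ 3 * ‖z‖ := by
    rw [norm_mul, norm_mul, Complex.norm_ofNat]; nlinarith
  have h4 : ‖((1 / (1 + r ^ 2) : ℝ) : ℂ)‖ ≤ 1 := by
    rw [Complex.norm_real, Real.norm_eq_abs, abs_of_nonneg (by positivity)]
    exact div_le_one_of_le₀ (by nlinarith [sq_nonneg r]) (by positivity)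
  calc _ ≤ (2 + 3 * ‖z‖) * (1 + 3 * ‖z‖) + 6 * ‖z‖ * (1 * 1) := by
        refine (norm_sub_le _ _).trans (add_le_add ?_ ?_)
        · rw [norm_mul]
          refine mul_le_mul ((norm_sub_le _ _).trans (add_le_add ?_ h3))
            ((norm_sub_le _ _).trans (add_le_add ?_ h3)) (norm_nonneg _) (by positivity)
          · rw [Complex.norm_ofNat]
          · rw [norm_one]
        · rw [norm_mul, norm_mul, norm_mul, Complex.norm_ofNat]
          gcongr
          exact norm_sq_div_le r
    _ ≤ _ := by nlinarith

/-- The phase `t p(r) + v r` of the oscillatory integrals of the propagator. -/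
def phase (σ t v r : ℝ) : ℝ := t * dispersion σ r + v * r

variable {σ : ℝ}

lemma hasDerivAt_phase (t v : ℝ) {r : ℝ} (hr : 0 < r) :
    HasDerivAt (phase σ t v) (t * dispDeriv σ r + v) r := by
  refine (((hasDerivAt_dispersion hr).const_mul t).add
    ((hasDerivAt_id r).const_mul v)).congr_deriv (by simp)

lemma continuous_phase (hσ₂ : σ < 2) (t v : ℝ) : Continuous (phase σ t v) := by
  have := continuous_dispersion hσ₂
  unfold phase
  fun_prop

lemma continuous_cexp_phase (hσ₂ : σ < 2) (t v : ℝ) :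
    Continuous fun r => Complex.exp (Complex.I * (phase σ t v r : ℂ)) := by
  have := continuous_phase hσ₂ t v
  fun_prop

/-- The nonstationary regime of the radial oscillatory integral. -/
lemma exists_norm_integral_quadAmp_le (hσ₀ : 0 < σ) (hσ₂ : σ < 2) :
    ∃ C, 0 ≤ C ∧ ∀ t v R : ℝ, ∀ z : ℂ, 1 ≤ t → |v| ≤ (1 - σ / 2) / 2 * t → t ≤ R → z.re = 1 →
      ‖∫ r in (0 : ℝ)..R, Complex.exp (Complex.I * (phase σ t v r : ℂ)) *
        ((r : ℂ) ^ 2 * amplitude z r)‖ ≤ C * ‖z‖ ^ 2 / t ^ 2 := by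
  set α := 1 - σ / 2 with hα
  have hα0 : 0 < α := by rw [hα]; linarith
  -- Chosen so that M · α/2 = 5, the constant in the third derivative bound, as the phase derivative
  -- is at least (α/2) t times `dispFactor`.
  set M := 10 / α with hM
  have hM0 : 0 < M := by positivity
  refine ⟨1 + 26 * (4 / α + 8 * (1 + M) / α ^ 2 + 16 * (1 + 4 * M + 3 * M ^ 2) / α ^ 2),
    by positivity, fun t v R z ht hv hR hz => ?_⟩
  have ht0 : 0 < t := by linarith
  have hz1 := one_le_norm_of_re_eq_one hz
  -- The derivatives are singular at the origin, so [0, 1/t] is estimated trivially; its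
  -- contribution is already O(t^{-2}).
  set ε := 1 / t with hε
  have hε0 : 0 < ε := by positivity
  have hε1 : ε ≤ 1 := div_le_one_of_le₀ ht ht0.le
  have hεR : ε ≤ R := by linarith
  have hpos : ∀ x ∈ Icc ε R, 0 < x := fun x hx => hε0.trans_le hx.1
  have cont : Continuous fun r : ℝ => Complex.exp (Complex.I * (phase σ t v r : ℂ)) *
        ((r : ℂ) ^ 2 * amplitude z r) :=
    (continuous_cexp_phase hσ₂ t v).mul ((by fun_prop : Continuous fun r : ℝ => (r : ℂ) ^ 2).mul
      (continuous_amplitude z))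
  -- Here |v| takes away at most half of the lower bound α t for the derivative of the phase.
  have b1 : ∀ x ∈ Icc ε R, α / 2 * t * dispFactor σ x ≤ t * dispDeriv σ x + v := by
    intro x hx
    have h1 := le_dispDeriv hσ₀ (hpos x hx)
    have h2 := one_le_dispFactor (σ := σ) (hpos x hx).le
    have h3 := mul_le_mul_of_nonneg_left h1 ht0.le
    have h4 := (abs_le.1 hv).1
    have h5 : α / 2 * t * 1 ≤ α / 2 * t * dispFactor σ x := by gcongr
    rw [← hα] at h3
    linarith
  have main := norm_integral_cexp_mul_le_of_nonstationary (φ := phase σ t v)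
    (φ₁ := fun x => t * dispDeriv σ x + v) (φ₂ := fun x => t * dispDeriv₂ σ x)
    (φ₃ := fun x => t * dispDeriv₃ σ x) (k := fun x => 26 * ‖z‖ ^ 2 * jweight x)
    (A := fun r => (r : ℂ) ^ 2 * amplitude z r) (A₁ := quadAmpDeriv z) (A₂ := quadAmpDeriv₂ z)
    (M := M) (μ := α / 2 * t) hε0 hεR hM0.le (by positivity)
    (fun x hx => hasDerivAt_phase t v (hpos x hx))
    (fun x hx => ((hasDerivAt_dispDeriv (hpos x hx)).const_mul t).add_const v)
    (fun x hx => (hasDerivAt_dispDeriv₂ (hpos x hx)).const_mul t)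
    (continuousOn_const.mul (continuousOn_dispDeriv₃.mono fun x hx => hpos x hx))
    (fun x hx => (le_mul_of_one_le_right (by positivity)
      (one_le_dispFactor (hpos x hx).le)).trans (b1 x hx))
    (fun x hx => by
      have hx0 := hpos x hx
      rw [abs_mul, abs_of_pos ht0]
      calc t * |dispDeriv₂ σ x| ≤ t * (dispFactor σ x / x) := by
            gcongr; exact abs_dispDeriv₂_le hσ₀ hσ₂ hx0
        _ ≤ t * (5 * dispFactor σ x / x) := by
            have := one_le_dispFactor (σ := σ) hx0.le
            gcongr; linarith
        _ = M * (α / 2 * t * dispFactor σ x) / x := by rw [hM]; field_simp; ring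
        _ ≤ _ := by gcongr; exact b1 x hx)
    (fun x hx => by
      have hx0 := hpos x hx
      rw [abs_mul, abs_of_pos ht0]
      calc t * |dispDeriv₃ σ x| ≤ t * (5 * dispFactor σ x / x ^ 2) := by
            gcongr; exact abs_dispDeriv₃_le hσ₀ hσ₂ hx0
        _ = M * (α / 2 * t * dispFactor σ x) / x ^ 2 := by rw [hM]; field_simp; ring
        _ ≤ _ := by gcongr; exact b1 x hx)
    (fun x _ => hasDerivAt_quadAmp z x) (fun x _ => hasDerivAt_quadAmpDeriv z x)
    (continuous_quadAmpDeriv₂ z).continuousOn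
    (continuous_const.mul continuous_jweight).continuousOn
    (fun x _ => by
      rw [norm_mul, norm_pow, Complex.norm_real, Real.norm_eq_abs, sq_abs,
        norm_amplitude_of_re_eq_one hz]
      have := jweight_pos x
      gcongr
      refine le_mul_of_one_le_left this.le ?_
      nlinarith)
    (fun x hx => norm_quadAmpDeriv_le hz (hpos x hx).le)
    (fun x _ => norm_quadAmpDeriv₂_le hz x)
  have small : ‖∫ r in (0 : ℝ)..ε, Complex.exp (Complex.I * (phase σ t v r : ℂ)) *
        ((r : ℂ) ^ 2 * amplitude z r)‖ ≤ 1 / t ^ 2 := by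
    have := intervalIntegral.norm_integral_le_of_norm_le_const (a := 0) (b := ε) (C := ε)
      (f := fun r : ℝ => Complex.exp (Complex.I * (phase σ t v r : ℂ)) *
        ((r : ℂ) ^ 2 * amplitude z r)) (fun x hx => by
          rw [uIoc_of_le hε0.le] at hx
          rw [norm_mul, norm_mul, norm_cexp_I_mul_ofReal, norm_pow, Complex.norm_real,
            Real.norm_eq_abs, sq_abs, one_mul]
          have h1 := norm_amplitude_le_one (z := z) (by rw [hz]; norm_num) x
          have h2 : x ^ 2 ≤ ε := by nlinarith [hx.1, hx.2]
          nlinarith [norm_nonneg (amplitude z x), sq_nonneg x])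
    refine this.trans (le_of_eq ?_)
    rw [sub_zero, abs_of_pos hε0, hε]; field_simp
  rw [← intervalIntegral.integral_add_adjacent_intervals (cont.intervalIntegrable 0 ε)
    (cont.intervalIntegrable ε R)]
  refine (norm_add_le _ _).trans ((add_le_add small main).trans ?_)
  rw [intervalIntegral.integral_const_mul]
  have hR0 : 0 < R := by linarith
  -- The boundary term at the cutoff has gained only one factor 1/t from the integration by parts.
  -- The condition t ≤ R provides the second.
  have g1 : R ^ 2 * jweight R ≤ 1 / t := by
    calc R ^ 2 * jweight R ≤ R ^ 2 * (R ^ 3)⁻¹ := by gcongr; exact jweight_le_inv_pow hR0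
      _ = 1 / R := by field_simp
      _ ≤ 1 / t := by gcongr
  have g2 : ε ^ 2 * jweight ε ≤ 1 / t := by
    calc ε ^ 2 * jweight ε ≤ ε ^ 2 * 1 := by gcongr; exact jweight_le_one ε
      _ ≤ ε := by nlinarith
  have g3 := mul_jweight_le_one R
  have g4 := mul_jweight_le_one ε
  have g5 := integral_jweight_le hεR
  set Z := 26 * ‖z‖ ^ 2 with hZ
  have hZ0 : 0 ≤ Z := by positivity
  calc _ ≤ ‖z‖ ^ 2 / t ^ 2 + (Z * (1 / t + 1 / t) / (α / 2 * t) +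
        (1 + M) * (Z * (1 + 1)) / (α / 2 * t) ^ 2 +
        (1 + 4 * M + 3 * M ^ 2) / (α / 2 * t) ^ 2 * (Z * 4)) := by
        have e1 : R ^ 2 * (Z * jweight R) + ε ^ 2 * (Z * jweight ε) =
          Z * (R ^ 2 * jweight R + ε ^ 2 * jweight ε) := by ring
        have e2 : R * (Z * jweight R) + ε * (Z * jweight ε) =
          Z * (R * jweight R + ε * jweight ε) := by ring
        rw [e1, e2]
        gcongr
        nlinarith
    _ = _ := by rw [hZ]; field_simp; ring

end Amplitude

/-! ### Lower bounds for the second derivative, and the stationary regime. -/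

noncomputable section StationaryPhase

open Set

variable {σ : ℝ}

/-- In this form the sign is that of -(1 - σ + (1 - σ/2) r^{-σ}): always negative for σ ≤ 1, with
exactly one change of sign for 1 < σ < 2. -/
lemma dispDeriv₂_eq {r : ℝ} (hr : 0 < r) : dispDeriv₂ σ r =
    -(σ / 2 * (1 - σ + (1 - σ / 2) * r ^ (-σ)) * (r ^ (-σ) / (r * dispFactor σ r ^ 3))) := by
  have hs := zero_lt_one.trans_le (one_le_dispFactor (σ := σ) hr.le)
  have h : r ^ (-σ) = dispFactor σ r ^ 2 - 1 := by rw [dispFactor_sq hr.le]; ring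
  rw [h, dispDeriv₂]
  field_simp
  ring

/-- At σ = 1 the coefficient 1 - σ vanishes, so the bound on p'' rests on the term (1 - σ/2) r^{-σ}
alone, whence the extra factor r^{-σ}. At infinity the right side decays like r^{-2σ-1}, which
dominates r^{-3} because σ ≤ 1. -/
lemma jweight_div_four_le_of_le_one (hσ₀ : 0 < σ) (hσ₁ : σ ≤ 1) {r : ℝ} (hr : 0 < r) :
    jweight r / 4 ≤ r ^ (-σ) * (r ^ (-σ) / (r * dispFactor σ r ^ 3)) := by
  have hs := one_le_dispFactor (σ := σ) hr.le
  have hsq := dispFactor_sq (σ := σ) hr.le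
  set s := dispFactor σ r
  set w := r ^ (-σ) with hw
  have hw0 : 0 < w := Real.rpow_pos_of_pos hr _
  have hs0 : 0 < s := by linarith
  rcases le_total r 1 with h1 | h1
  · have hw1 : 1 ≤ w := Real.one_le_rpow_of_pos_of_le_one_of_nonpos hr h1 (by linarith)
    have h2 : s ≤ 2 * w := by nlinarith
    have h3 : s ^ 3 ≤ 4 * w ^ 2 := by nlinarith
    calc jweight r / 4 ≤ 1 / 4 := by gcongr; exact jweight_le_one r
      _ = w * (w / (1 * (4 * w ^ 2))) := by field_simp
      _ ≤ _ := by gcongr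
  · have hw1 : w ≤ 1 := Real.rpow_le_one_of_one_le_of_nonpos h1 (by linarith)
    have hw2 : r⁻¹ ≤ w := by
      rw [← Real.rpow_neg_one]; exact Real.rpow_le_rpow_of_exponent_le h1 (by linarith)
    have h3 : s ^ 3 ≤ 4 := by nlinarith
    calc jweight r / 4 ≤ (r ^ 3)⁻¹ / 4 := by gcongr; exact jweight_le_inv_pow hr
      _ = r⁻¹ * (r⁻¹ / (r * 4)) := by field_simp
      _ ≤ _ := by gcongr

/-- For σ > 1 the bracket in p'' is bounded below away from its zero, so a single power r^{-σ} is
left, and r^{-σ-1} dominates r^{-3} at infinity for all σ < 2. For r ≤ 1 the denominator is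
controlled by r · `dispFactor σ r` = p(r) ≤ 2. -/
lemma jweight_div_four_le (hσ₀ : 0 < σ) (hσ₂ : σ < 2) {r : ℝ} (hr : 0 < r) :
    jweight r / 4 ≤ r ^ (-σ) / (r * dispFactor σ r ^ 3) := by
  have hs := one_le_dispFactor (σ := σ) hr.le
  have hsq := dispFactor_sq (σ := σ) hr.le
  have hd := dispersion_eq_mul_dispFactor (σ := σ) hr
  set s := dispFactor σ r
  set w := r ^ (-σ) with hw
  have hw0 : 0 < w := Real.rpow_pos_of_pos hr _
  have hs0 : 0 < s := by linarith
  rcases le_total r 1 with h1 | h1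
  · have hw1 : 1 ≤ w := Real.one_le_rpow_of_pos_of_le_one_of_nonpos hr h1 (by linarith)
    have h2 : r * s ≤ 2 := by
      rw [← hd, dispersion, Real.sqrt_le_left (by norm_num)]
      have e1 : r ^ (2 - σ) ≤ 1 := Real.rpow_le_one hr.le h1 (by linarith)
      nlinarith
    calc jweight r / 4 ≤ 1 / 4 := by gcongr; exact jweight_le_one r
      _ = w / (2 * (2 * w)) := by field_simp; norm_num
      _ ≤ w / (r * s * s ^ 2) := by gcongr; linarith
      _ = _ := by ring
  · have hw1 : w ≤ 1 := Real.rpow_le_one_of_one_le_of_nonpos h1 (by linarith)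
    have hw2 : (r ^ 2)⁻¹ ≤ w := by
      rw [← Real.rpow_two, ← Real.rpow_neg hr.le]
      exact Real.rpow_le_rpow_of_exponent_le h1 (by linarith)
    have h3 : s ^ 3 ≤ 4 := by nlinarith
    calc jweight r / 4 ≤ (r ^ 3)⁻¹ / 4 := by gcongr; exact jweight_le_inv_pow hr
      _ = (r ^ 2)⁻¹ / (r * 4) := by field_simp
      _ ≤ _ := by gcongr

lemma exists_mul_jweight_le_neg_dispDeriv₂ (hσ₀ : 0 < σ) (hσ₁ : σ ≤ 1) :
    ∃ c, 0 < c ∧ ∀ r, 0 < r → c * jweight r ≤ -dispDeriv₂ σ r := by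
  have hα : 0 < 1 - σ / 2 := by linarith
  refine ⟨σ / 2 * (1 - σ / 2) / 4, by positivity, fun r hr => ?_⟩
  have hs := one_le_dispFactor (σ := σ) hr.le
  have h := jweight_div_four_le_of_le_one hσ₀ hσ₁ hr
  rw [dispDeriv₂_eq hr, neg_neg]
  have hw0 : 0 < r ^ (-σ) := Real.rpow_pos_of_pos hr _
  have hq : 0 ≤ r ^ (-σ) / (r * dispFactor σ r ^ 3) := by positivity
  calc σ / 2 * (1 - σ / 2) / 4 * jweight r = σ / 2 * (1 - σ / 2) * (jweight r / 4) := by ring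
    _ ≤ σ / 2 * (1 - σ / 2) * (r ^ (-σ) * (r ^ (-σ) / (r * dispFactor σ r ^ 3))) := by gcongr
    _ = σ / 2 * ((1 - σ / 2) * r ^ (-σ)) * (r ^ (-σ) / (r * dispFactor σ r ^ 3)) := by ring
    _ ≤ _ := by gcongr; linarith

/-- For `σ > 1` the second derivative of the dispersion relation changes sign at one point. -/
lemma exists_mul_jweight_le_abs_dispDeriv₂ (hσ₁ : 1 < σ) (hσ₂ : σ < 2) :
    ∃ c ρ, 0 < c ∧ 0 < ρ ∧ ∀ δ, 0 < δ → δ < 1 →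
      (∀ r, 0 < r → r ≤ ρ * (1 - δ) → c * δ * jweight r ≤ -dispDeriv₂ σ r) ∧
      ∀ r, ρ * (1 + δ) ≤ r → c * δ * jweight r ≤ dispDeriv₂ σ r := by
  have hσ₀ : 0 < σ := by linarith
  have hα : 0 < 1 - σ / 2 := by linarith
  -- The value of r^{-σ} at the inflection point of p; `ρ` is the inflection point itself.
  set ws := (σ - 1) / (1 - σ / 2) with hws
  have hws0 : 0 < ws := div_pos (by linarith) hα
  have hαws : (1 - σ / 2) * ws = σ - 1 := mul_div_cancel₀ _ hα.ne'
  set ρ := ws ^ (-σ⁻¹) with hρ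
  have hρ0 : 0 < ρ := Real.rpow_pos_of_pos hws0 _
  have hρw : ρ ^ (-σ) = ws := by
    rw [hρ, ← Real.rpow_mul hws0.le, neg_mul_neg, inv_mul_cancel₀ hσ₀.ne', Real.rpow_one]
  refine ⟨σ / 2 * (1 - σ / 2) * ws / 8, ρ, by positivity, hρ0, fun δ hδ0 hδ1 => ⟨?_, ?_⟩⟩
  · intro r hr hrρ
    have h1 : 0 < 1 - δ := by linarith
    -- As σ > 1, the power -σ may be replaced by -1, and (1 - δ)^{-1} ≥ 1 + δ shows that the bracket
    -- is at least linear in δ. On the other side of `ρ` the corresponding inequality is (1 +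
    -- δ)^{-1} ≤ 1 - δ/2.
    have hw : ws * (1 + δ) ≤ r ^ (-σ) := by
      calc ws * (1 + δ) ≤ ws * (1 - δ)⁻¹ := by
            gcongr
            rw [le_inv_comm₀ (by linarith) h1, ← one_div, le_div_iff₀ (by linarith)]
            nlinarith
        _ ≤ ws * (1 - δ) ^ (-σ) := by
            gcongr
            rw [← Real.rpow_neg_one]
            exact Real.rpow_le_rpow_of_exponent_ge h1 (by linarith) (by linarith)
        _ = (ρ * (1 - δ)) ^ (-σ) := by rw [Real.mul_rpow hρ0.le h1.le, hρw]
        _ ≤ _ := Real.rpow_le_rpow_of_nonpos hr hrρ (by linarith)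
    have h := jweight_div_four_le hσ₀ hσ₂ hr
    have hj := jweight_pos r
    rw [dispDeriv₂_eq hr, neg_neg]
    calc σ / 2 * (1 - σ / 2) * ws / 8 * δ * jweight r
        = σ / 2 * ((1 - σ / 2) * (ws * (δ / 2))) * (jweight r / 4) := by ring
      _ ≤ _ := by
        have := mul_le_mul_of_nonneg_left hw hα.le
        have h2 : (1 - σ / 2) * (ws * (δ / 2)) ≤ 1 - σ + (1 - σ / 2) * r ^ (-σ) := by
          nlinarith [mul_pos hα (mul_pos hws0 hδ0)]
        have h3 : 0 ≤ (1 - σ / 2) * (ws * (δ / 2)) := by positivity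
        exact mul_le_mul (mul_le_mul_of_nonneg_left h2 (by positivity)) h (by positivity)
          (mul_nonneg (by positivity) (h3.trans h2))
  · intro r hrρ
    have h1 : 0 < 1 + δ := by linarith
    have hr : 0 < r := lt_of_lt_of_le (by positivity) hrρ
    have hw : r ^ (-σ) ≤ ws * (1 - δ / 2) := by
      calc r ^ (-σ) ≤ (ρ * (1 + δ)) ^ (-σ) :=
            Real.rpow_le_rpow_of_nonpos (by positivity) hrρ (by linarith)
        _ = ws * (1 + δ) ^ (-σ) := by rw [Real.mul_rpow hρ0.le h1.le, hρw]
        _ ≤ ws * (1 + δ)⁻¹ := by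
            gcongr
            rw [← Real.rpow_neg_one]
            exact Real.rpow_le_rpow_of_exponent_le (by linarith) (by linarith)
        _ ≤ _ := by
            gcongr
            rw [← one_div, div_le_iff₀ h1]
            nlinarith
    have h := jweight_div_four_le hσ₀ hσ₂ hr
    have hj := jweight_pos r
    rw [dispDeriv₂_eq hr, ← neg_mul, ← mul_neg]
    calc σ / 2 * (1 - σ / 2) * ws / 8 * δ * jweight r
        = σ / 2 * ((1 - σ / 2) * (ws * (δ / 2))) * (jweight r / 4) := by ring
      _ ≤ _ := by
        have := mul_le_mul_of_nonneg_left hw hα.le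
        have h2 : (1 - σ / 2) * (ws * (δ / 2)) ≤ -(1 - σ + (1 - σ / 2) * r ^ (-σ)) := by
          nlinarith [mul_pos hα (mul_pos hws0 hδ0)]
        have h3 : 0 ≤ (1 - σ / 2) * (ws * (δ / 2)) := by positivity
        exact mul_le_mul (mul_le_mul_of_nonneg_left h2 (by positivity)) h (by positivity)
          (mul_nonneg (by positivity) (h3.trans h2))

/-- The constant of the second derivative test for the amplitude `r * amplitude z r`. -/
def linConst : ℝ := 8 * (1 + 4 * ∫ r, √(jweight r))

lemma linConst_pos : 0 < linConst := by
  have : 0 ≤ ∫ r, √(jweight r) := integral_nonneg fun _ => Real.sqrt_nonneg _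
  unfold linConst; positivity

/-- The bound is uniform in a and b because the amplitude r · `jweight` divided by √`jweight` is at
most 1, while its derivative divided by √`jweight` is at most 4|z|√`jweight`, which is integrable.
-/
lemma norm_integral_linAmp_le_of_mul_jweight_le {t v a b l : ℝ} {z : ℂ} (hz : z.re = 1)
    (ha : 0 < a) (hab : a ≤ b) (hl : 0 < l)
    (h : (∀ x ∈ Icc a b, l * jweight x ≤ t * dispDeriv₂ σ x) ∨
      ∀ x ∈ Icc a b, l * jweight x ≤ -(t * dispDeriv₂ σ x)) :
    ‖∫ r in a..b, Complex.exp (Complex.I * (phase σ t v r : ℂ)) * ((r : ℂ) * amplitude z r)‖ ≤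
      linConst * ‖z‖ / √l := by
  have hz1 := one_le_norm_of_re_eq_one hz
  have hpos : ∀ x ∈ Icc a b, 0 < x := fun x hx => ha.trans_le hx.1
  have main := norm_integral_cexp_mul_le (φ := phase σ t v) (φ₁ := fun x => t * dispDeriv σ x + v)
    (φ₂ := fun x => t * dispDeriv₂ σ x) (k := jweight) (A := fun r => (r : ℂ) * amplitude z r)
    (A₁ := linAmpDeriv z) hab hl (fun x hx => hasDerivAt_phase t v (hpos x hx))
    (fun x hx => ((hasDerivAt_dispDeriv (hpos x hx)).const_mul t).add_const v)
    (fun x hx => ((hasDerivAt_dispDeriv₂ (hpos x hx)).const_mul t).continuousAt.continuousWithinAt)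
    (antitoneOn_jweight.mono fun x hx => (hpos x hx).le) continuous_jweight.continuousOn
    (fun x _ => jweight_pos x) h (fun x _ => hasDerivAt_linAmp z x)
    (continuous_linAmpDeriv z).continuousOn
  refine main.trans ?_
  have e1 : ‖(b : ℂ) * amplitude z b‖ / √(jweight b) ≤ 1 := by
    have hb : 0 < b := by linarith
    rw [norm_mul, norm_amplitude_of_re_eq_one hz, Complex.norm_real, Real.norm_eq_abs,
      abs_of_pos hb, mul_div_assoc, Real.div_sqrt]
    have := sq_mul_jweight_le_one b
    rw [← Real.sqrt_sq hb.le, ← Real.sqrt_mul (sq_nonneg b), Real.sqrt_sq hb.le]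
    rwa [Real.sqrt_le_one]
  have e2 : ∫ x in a..b, ‖linAmpDeriv z x‖ / √(jweight x) ≤ 4 * ‖z‖ * ∫ r, √(jweight r) := by
    have cq : Continuous fun x => √(jweight x) := continuous_jweight.sqrt
    calc ∫ x in a..b, ‖linAmpDeriv z x‖ / √(jweight x)
        ≤ ∫ x in a..b, 4 * ‖z‖ * √(jweight x) := by
          refine intervalIntegral.integral_mono_on hab (Continuous.intervalIntegrable
            ((continuous_linAmpDeriv z).norm.div cq
              fun x => (Real.sqrt_pos.2 (jweight_pos x)).ne') _ _)
            ((continuous_const.mul cq).intervalIntegrable _ _) fun x _ => ?_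
          have hj := Real.sqrt_pos.2 (jweight_pos x)
          rw [div_le_iff₀ hj, mul_assoc, Real.mul_self_sqrt (jweight_pos x).le]
          exact norm_linAmpDeriv_le hz x
      _ = 4 * ‖z‖ * ∫ x in a..b, √(jweight x) := intervalIntegral.integral_const_mul _ _
      _ ≤ _ := by
          rw [intervalIntegral.integral_of_le hab]
          exact mul_le_mul_of_nonneg_left (setIntegral_le_integral integrable_sqrt_jweight
            (Filter.Eventually.of_forall fun _ => Real.sqrt_nonneg _)) (by positivity)
  have hi : 0 ≤ ∫ r, √(jweight r) := integral_nonneg fun _ => Real.sqrt_nonneg _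
  calc _ ≤ 8 / √l * (‖z‖ + 4 * ‖z‖ * ∫ r, √(jweight r)) := by gcongr; linarith
    _ = _ := by rw [linConst]; ring

lemma norm_integral_linAmp_le_sub {t v a b : ℝ} {z : ℂ} (hz : z.re = 1) (ha : 0 ≤ a)
    (hab : a ≤ b) :
    ‖∫ r in a..b, Complex.exp (Complex.I * (phase σ t v r : ℂ)) * ((r : ℂ) * amplitude z r)‖ ≤
      b - a := by
  have := intervalIntegral.norm_integral_le_of_norm_le_const (a := a) (b := b) (C := 1)
      (f := fun r : ℝ => Complex.exp (Complex.I * (phase σ t v r : ℂ)) *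
        ((r : ℂ) * amplitude z r)) (fun x hx => by
          rw [uIoc_of_le hab] at hx
          rw [norm_mul, norm_mul, norm_cexp_I_mul_ofReal, Complex.norm_real,
            Real.norm_eq_abs, abs_of_nonneg (by linarith [hx.1]), one_mul,
            norm_amplitude_of_re_eq_one hz]
          exact mul_jweight_le_one x)
  rwa [one_mul, abs_of_nonneg (by linarith)] at this

lemma continuous_linIntegrand (hσ₂ : σ < 2) (t v : ℝ) (z : ℂ) :
    Continuous fun r : ℝ => Complex.exp (Complex.I * (phase σ t v r : ℂ)) *
        ((r : ℂ) * amplitude z r) :=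
  (continuous_cexp_phase hσ₂ t v).mul (Complex.continuous_ofReal.mul (continuous_amplitude z))

/-- The stationary regime of the radial oscillatory integral. -/
lemma exists_norm_integral_linAmp_le (hσ₀ : 0 < σ) (hσ₂ : σ < 2) :
    ∃ C R₁, 0 ≤ C ∧ ∀ t v R : ℝ, ∀ z : ℂ, 1 ≤ t → R₁ ≤ R → z.re = 1 →
      ‖∫ r in (0 : ℝ)..R, Complex.exp (Complex.I * (phase σ t v r : ℂ)) *
        ((r : ℂ) * amplitude z r)‖ ≤ C * ‖z‖ * t ^ (-(if σ ≤ 1 then 1 / 2 else 1 / 3 : ℝ)) := by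
  have hL := linConst_pos
  rcases le_or_gt σ 1 with hσ₁ | hσ₁
  · obtain ⟨c, hc0, hc⟩ := exists_mul_jweight_le_neg_dispDeriv₂ hσ₀ hσ₁
    refine ⟨1 + linConst / √c, 1, by positivity, fun t v R z ht hR hz => ?_⟩
    rw [if_pos hσ₁]
    have ht0 : 0 < t := by linarith
    have hz1 := one_le_norm_of_re_eq_one hz
    have ci := continuous_linIntegrand hσ₂ t v z
    -- The piece [0, 1/t] is cut off only to stay away from the origin; it costs 1/t ≤ t^{-1/2}.
    have hε0 : 0 < 1 / t := by positivity
    have hε1 : 1 / t ≤ 1 := div_le_one_of_le₀ ht ht0.le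
    rw [← intervalIntegral.integral_add_adjacent_intervals (ci.intervalIntegrable 0 (1 / t))
      (ci.intervalIntegrable (1 / t) R)]
    refine (norm_add_le _ _).trans ((add_le_add (norm_integral_linAmp_le_sub hz le_rfl hε0.le)
      (norm_integral_linAmp_le_of_mul_jweight_le (l := c * t) hz hε0 (by linarith)
        (by positivity) (Or.inr fun x hx => ?_))).trans ?_)
    · have := hc x (hε0.trans_le hx.1)
      nlinarith
    · have e : t ^ (-(1 / 2) : ℝ) = 1 / √t := by
        rw [Real.rpow_neg ht0.le, ← Real.sqrt_eq_rpow, one_div]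
      rw [e, sub_zero, Real.sqrt_mul hc0.le]
      have hst : 1 / t ≤ ‖z‖ * (1 / √t) := by
        have h1 : √t ≤ t := by rw [Real.sqrt_le_left ht0.le]; nlinarith
        have h2 : 1 / t ≤ 1 / √t := by
          have := Real.sqrt_pos.2 ht0
          gcongr
        have : 0 ≤ 1 / √t := by positivity
        nlinarith
      calc _ ≤ ‖z‖ * (1 / √t) + linConst * ‖z‖ / (√c * √t) := by gcongr
        _ = _ := by field_simp
  · obtain ⟨c, ρ, hc0, hρ0, hc⟩ := exists_mul_jweight_le_abs_dispDeriv₂ hσ₁ hσ₂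
    refine ⟨1 + ρ + 2 * (linConst / √(c / 2)), 2 * ρ, by positivity, fun t v R z ht hR hz => ?_⟩
    rw [if_neg (not_le.2 hσ₁)]
    have ht0 : 0 < t := by linarith
    have hz1 := one_le_norm_of_re_eq_one hz
    have ci := continuous_linIntegrand hσ₂ t v z
    set τ := t ^ (1 / 3 : ℝ) with hτ
    have hτ1 : 1 ≤ τ := Real.one_le_rpow ht (by norm_num)
    have hτt : t = τ ^ 3 := by
      rw [hτ, ← Real.rpow_natCast, ← Real.rpow_mul ht0.le]; norm_num
    have e : t ^ (-(1 / 3) : ℝ) = 1 / τ := by rw [Real.rpow_neg ht0.le, ← hτ, one_div τ]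
    -- The window of half-width ρδ around the inflection point costs 2ρδ, and the test outside it
    -- costs a multiple of (δt)^{-1/2}. The two balance at δ ~ t^{-1/3}.
    set δ := 1 / (2 * τ) with hδ
    have hδ0 : 0 < δ := by positivity
    have hδ1 : δ ≤ 1 / 2 := by rw [hδ]; gcongr; linarith
    obtain ⟨hc1, hc2⟩ := hc δ hδ0 (by linarith)
    -- The minimum with ρ/2 keeps ε to the left of the window, which starts at ρ(1 - δ) ≥ ρ/2.
    set ε := min 1 (ρ / 2) / t with hε
    have hε0 : 0 < ε := by positivity
    have hε1 : ε ≤ 1 / t := by rw [hε]; gcongr; exact min_le_left _ _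
    have hε2 : ε ≤ ρ * (1 - δ) := by
      calc ε ≤ min 1 (ρ / 2) := div_le_self (by positivity) ht
        _ ≤ ρ / 2 := min_le_right _ _
        _ ≤ _ := by nlinarith
    have hm : ρ * (1 - δ) ≤ ρ * (1 + δ) := by gcongr; linarith
    have hR2 : ρ * (1 + δ) ≤ R := by nlinarith
    have hmp : 0 < ρ * (1 - δ) := hε0.trans_le hε2
    have hl : 0 < c * δ * t := by positivity
    rw [← intervalIntegral.integral_add_adjacent_intervals (ci.intervalIntegrable 0 ε)
      (ci.intervalIntegrable ε R), ← intervalIntegral.integral_add_adjacent_intervals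
      (ci.intervalIntegrable ε (ρ * (1 - δ))) (ci.intervalIntegrable (ρ * (1 - δ)) R),
      ← intervalIntegral.integral_add_adjacent_intervals
      (ci.intervalIntegrable (ρ * (1 - δ)) (ρ * (1 + δ)))
      (ci.intervalIntegrable (ρ * (1 + δ)) R)]
    have b1 := norm_integral_linAmp_le_sub (σ := σ) (t := t) (v := v) hz le_rfl hε0.le
    have b2 := norm_integral_linAmp_le_of_mul_jweight_le (σ := σ) (t := t) (v := v) (l := c * δ * t)
      hz hε0 hε2 hl (Or.inr fun x hx => by
        have := hc1 x (hε0.trans_le hx.1) hx.2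
        nlinarith)
    have b3 := norm_integral_linAmp_le_sub (σ := σ) (t := t) (v := v) hz hmp.le hm
    have b4 := norm_integral_linAmp_le_of_mul_jweight_le (σ := σ) (t := t) (v := v) (l := c * δ * t)
      hz (hmp.trans_le hm) hR2 hl (Or.inl fun x hx => by
        have := hc2 x hx.1
        nlinarith)
    refine (norm_add_le _ _).trans ((add_le_add b1 ((norm_add_le _ _).trans (add_le_add b2
      ((norm_add_le _ _).trans (add_le_add b3 b4))))).trans ?_)
    have hsq : √(c * δ * t) = √(c / 2) * τ := by
      have : c * δ * t = c / 2 * τ ^ 2 := by rw [hδ, hτt]; field_simp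
      rw [this, Real.sqrt_mul (by positivity), Real.sqrt_sq (by linarith)]
    have h1 : ε - 0 ≤ ‖z‖ * (1 / τ) := by
      have h2 : 1 / t ≤ 1 / τ := by
        gcongr
        rw [hτt]; nlinarith [mul_nonneg (by linarith : 0 ≤ τ) (sq_nonneg τ)]
      have : 0 ≤ 1 / τ := by positivity
      nlinarith
    have h3 : ρ * (1 + δ) - ρ * (1 - δ) ≤ ρ * ‖z‖ * (1 / τ) := by
      have : ρ * (1 + δ) - ρ * (1 - δ) = ρ * 1 * (1 / τ) := by rw [hδ]; field_simp; ring
      rw [this]; gcongr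
    rw [e, hsq]
    calc _ ≤ ‖z‖ * (1 / τ) + (linConst * ‖z‖ / (√(c / 2) * τ) + (ρ * ‖z‖ * (1 / τ) +
          linConst * ‖z‖ / (√(c / 2) * τ))) := by gcongr
      _ = _ := by field_simp; ring

end StationaryPhase

/-! ### The kernel as a radial Fourier transform, and its decay in time. -/

noncomputable section RadialFourier

open Set

/-- The complex exponential `e^{-2πiρz}`. -/
def planeWave (ρ z : ℝ) : ℂ := Complex.exp (Complex.I * ((-(2 * Real.pi * ρ * z) : ℝ) : ℂ))

lemma continuous_planeWave (ρ : ℝ) : Continuous (planeWave ρ) := by unfold planeWave; fun_prop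

/-- An isometry of `ℝ³` onto the product of a line and a plane that maps `x` into the line. -/
lemma exists_linearIsometryEquiv_prod (x : R3) :
    ∃ L : R3 ≃ₗᵢ[ℝ] WithLp 2 (ℝ × EuclideanSpace ℝ (Fin 2)), L x = WithLp.toLp 2 (‖x‖, 0) := by
  have hf : Module.finrank ℝ R3 = Module.finrank ℝ (WithLp 2 (ℝ × EuclideanSpace ℝ (Fin 2))) := by
    rw [(WithLp.linearEquiv 2 ℝ (ℝ × EuclideanSpace ℝ (Fin 2))).finrank_eq]
    simp
  -- Any isometry will do. A reflection in the bisecting hyperplane then moves the image of x onto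
  -- the required vector of the same norm.
  let Φ := (stdOrthonormalBasis ℝ R3).equiv
    (stdOrthonormalBasis ℝ (WithLp 2 (ℝ × EuclideanSpace ℝ (Fin 2)))) (finCongr hf)
  have hn : ‖Φ x‖ = ‖(WithLp.toLp 2 (‖x‖, 0) : WithLp 2 (ℝ × EuclideanSpace ℝ (Fin 2)))‖ := by
    rw [Φ.norm_map, WithLp.prod_norm_eq_of_L2]
    simp
  exact ⟨Φ.trans ((ℝ ∙ (Φ x - WithLp.toLp 2 (‖x‖, 0)))ᗮ.reflection),
    by simpa using Submodule.reflection_sub hn⟩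

/-- Integration of a radial function over the plane. -/
lemma integral_plane_radial (f : ℝ → ℂ) :
    ∫ w : EuclideanSpace ℝ (Fin 2), f ‖w‖ = (2 * Real.pi : ℝ) • ∫ y in Ioi (0 : ℝ), y • f y := by
  rw [integral_fun_norm_addHaar]
  have h1 : (volume : Measure (EuclideanSpace ℝ (Fin 2))).real (Metric.ball 0 1) = Real.pi := by
    rw [measureReal_def, EuclideanSpace.volume_ball_fin_two]
    simp [Real.pi_pos.le]
  rw [h1, finrank_euclideanSpace_fin, ← Nat.cast_smul_eq_nsmul ℝ, smul_smul]
  norm_num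

/-- The substitution `s² = z² + y²`. -/
lemma integral_Ioi_mul_comp_sqrt (k : ℝ → ℂ) (z : ℝ) :
    ∫ y in Ioi (0 : ℝ), y • k √(z ^ 2 + y ^ 2) = ∫ s in Ioi |z|, s • k s := by
  have h2 : ∀ y : ℝ, (2 : ℝ) * y ^ ((2 : ℝ) - 1) = 2 * y := fun y => by norm_num
  have e1 := integral_comp_rpow_Ioi_of_pos (g := fun u => k √(z ^ 2 + u)) (p := 2) two_pos
  have e2 := integral_comp_rpow_Ioi_of_pos' (g := fun u => k √u) (p := 2) two_pos
    (sq_nonneg z)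
  have e3 : ∫ u in Ioi (z ^ 2), k √u = ∫ u in Ioi (0 : ℝ), k √(z ^ 2 + u) := by
    have := (measurePreserving_add_left volume (z ^ 2)).setIntegral_preimage_emb
      (measurableEmbedding_addLeft (z ^ 2)) (fun u => k √u) (Ioi (z ^ 2))
    rw [← this]
    simp
  have e4 : (z ^ 2) ^ (2 : ℝ)⁻¹ = |z| := by
    rw [← Real.sqrt_sq_eq_abs, Real.sqrt_eq_rpow, one_div]
  simp only [h2, Real.rpow_two] at e1 e2
  rw [e4, e3, ← e1] at e2
  have e5 : ∫ s in Ioi |z|, (2 * s) • k √(s ^ 2) = (2 : ℝ) • ∫ s in Ioi |z|, s • k s := by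
    rw [← integral_smul]
    refine setIntegral_congr_fun measurableSet_Ioi fun s hs => ?_
    have : 0 ≤ s := (abs_nonneg z).trans (le_of_lt hs)
    simp only [Real.sqrt_sq this, smul_smul]
  have e6 : ∫ y in Ioi (0 : ℝ), (2 * y) • k √(z ^ 2 + y ^ 2) =
      (2 : ℝ) • ∫ y in Ioi (0 : ℝ), y • k √(z ^ 2 + y ^ 2) := by
    rw [← integral_smul]
    simp only [smul_smul]
  rw [e5, e6] at e2
  exact (smul_right_injective ℂ (two_ne_zero (α := ℝ)) e2).symm

/-- The Fourier transform of a truncated radial function on `ℝ³`. -/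
lemma fourier_indicator_radial {g : ℝ → ℂ} (hg : Continuous g) {R : ℝ} (hR : 0 ≤ R) (x : R3) :
    𝓕 ((Metric.closedBall (0 : R3) R).indicator fun ξ => g ‖ξ‖) x =
      (2 * Real.pi : ℝ) • ∫ s in (0 : ℝ)..R, (s * g s) * ∫ z in (-s)..s, planeWave ‖x‖ z := by
  obtain ⟨L, hL⟩ := exists_linearIsometryEquiv_prod x
  set k : ℝ → ℂ := (Iic R).indicator g with hk
  set F : ℝ × EuclideanSpace ℝ (Fin 2) → ℂ := fun p =>
    planeWave ‖x‖ p.1 * k √(p.1 ^ 2 + ‖p.2‖ ^ 2) with hF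
  have hmp : MeasurePreserving (fun ξ : R3 => WithLp.ofLp (L ξ)) volume volume :=
    (WithLp.volume_preserving_symm_measurableEquiv_toLp_prod ℝ (EuclideanSpace ℝ (Fin 2))).comp
      L.measurePreserving
  have hme : MeasurableEmbedding (fun ξ : R3 => WithLp.ofLp (L ξ)) :=
    (MeasurableEquiv.toLp 2 (ℝ × EuclideanSpace ℝ (Fin 2))).symm.measurableEmbedding.comp
      L.toHomeomorph.measurableEmbedding
  have hcomp : ∀ ξ : R3, F (WithLp.ofLp (L ξ)) =
      Complex.exp ((-2 * Real.pi * inner ℝ ξ x : ℝ) * Complex.I) •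
        (Metric.closedBall (0 : R3) R).indicator (fun ξ => g ‖ξ‖) ξ := by
    intro ξ
    have hin : inner ℝ ξ x = ‖x‖ * (WithLp.ofLp (L ξ)).1 := by
      rw [← L.inner_map_map, hL, WithLp.prod_inner_apply]
      simp
    have hno : √((WithLp.ofLp (L ξ)).1 ^ 2 + ‖(WithLp.ofLp (L ξ)).2‖ ^ 2) = ‖ξ‖ := by
      rw [← L.norm_map ξ, WithLp.prod_norm_eq_of_L2]
      simp
    simp only [hF, hno, hin, planeWave, smul_eq_mul]
    congr 1
    · congr 1; push_cast; ring
    · by_cases h : ‖ξ‖ ≤ R <;> simp [hk, indicator, h]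
  have hkint : Integrable ((Metric.closedBall (0 : R3) R).indicator fun ξ => g ‖ξ‖) := by
    rw [integrable_indicator_iff measurableSet_closedBall]
    exact (hg.comp continuous_norm).continuousOn.integrableOn_compact (isCompact_closedBall _ _)
  have hFint : Integrable F (volume.prod volume) := by
    have : Integrable (F ∘ fun ξ : R3 => WithLp.ofLp (L ξ)) := by
      refine (hkint.bdd_mul (c := 1) (f := fun ξ : R3 => Complex.exp
        ((-2 * Real.pi * inner ℝ ξ x : ℝ) * Complex.I)) ?_ ?_).congr
        (Filter.Eventually.of_forall fun ξ => (hcomp ξ).symm)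
      · exact Continuous.aestronglyMeasurable (by fun_prop)
      · exact Filter.Eventually.of_forall fun ξ => (Complex.norm_exp_ofReal_mul_I _).le
    exact (hmp.integrable_comp_emb hme).1 this
  rw [Real.fourier_eq']
  simp_rw [← hcomp]
  rw [hmp.integral_comp hme F, Measure.volume_eq_prod, integral_prod F hFint]
  -- For fixed axial coordinate z the planar integral is rewritten in the total radius s = √(z² +
  -- y²) > |z|. The indicators describe the region |z| < s ≤ R in the form that Fubini needs, so
  -- that z ends up in (-s, s).
  have inner_eq : ∀ z : ℝ, ∫ w, F (z, w) = (2 * Real.pi : ℝ) •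
      ∫ s, (Ioc 0 R).indicator (fun s => (Ioo (-s) s).indicator
        (fun z => planeWave ‖x‖ z * (s * g s)) z) s := by
    intro z
    simp only [hF]
    rw [integral_const_mul, integral_plane_radial fun y => k √(z ^ 2 + y ^ 2),
      integral_Ioi_mul_comp_sqrt, mul_smul_comm, ← integral_const_mul,
      ← integral_indicator measurableSet_Ioi]
    congr 2 with s
    by_cases h1 : |z| < s
    · have h0 : 0 < s := (abs_nonneg z).trans_lt h1
      have h2 : -s < z ∧ z < s := abs_lt.1 h1
      by_cases h3 : s ≤ R <;> simp [hk, indicator, h1, h0, h2, h3]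
    · have h2 : ¬(-s < z ∧ z < s) := fun h => h1 (abs_lt.2 h)
      simp only [indicator, mem_Ioi, mem_Ioo, h1, h2, if_false, ite_self]
  simp_rw [inner_eq]
  rw [integral_smul]
  congr 1
  rw [integral_integral_swap, intervalIntegral.integral_of_le hR,
    ← integral_indicator measurableSet_Ioc]
  · congr 1 with s
    by_cases hs : s ∈ Ioc 0 R
    · simp only [indicator_of_mem hs]
      rw [integral_indicator measurableSet_Ioo, integral_mul_const, mul_comm,
        intervalIntegral.integral_of_le (by linarith [hs.1]), integral_Ioc_eq_integral_Ioo]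
    · simp only [indicator_of_notMem hs, integral_zero]
  · have hset : MeasurableSet {p : ℝ × ℝ | p.2 ∈ Ioc 0 R ∧ p.1 ∈ Ioo (-p.2) p.2} := by
      simp only [mem_Ioc, mem_Ioo]
      measurability
    have : IntegrableOn (fun p : ℝ × ℝ => planeWave ‖x‖ p.1 * (p.2 * g p.2))
        {p : ℝ × ℝ | p.2 ∈ Ioc 0 R ∧ p.1 ∈ Ioo (-p.2) p.2} (volume.prod volume) := by
      refine IntegrableOn.mono_set (t := Icc (-R) R ×ˢ Icc 0 R) ?_ ?_
      · refine ContinuousOn.integrableOn_compact (isCompact_Icc.prod isCompact_Icc) ?_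
        have := continuous_planeWave ‖x‖
        fun_prop
      · rintro ⟨z, s⟩ ⟨h1, h2⟩
        exact ⟨⟨by linarith [h1.2, h2.1], by linarith [h1.2, h2.2]⟩, ⟨h1.1.le, h1.2⟩⟩
    refine ((integrable_indicator_iff hset).2 this).congr (Filter.Eventually.of_forall ?_)
    rintro ⟨z, s⟩
    by_cases h1 : s ∈ Ioc 0 R <;> by_cases h2 : z ∈ Ioo (-s) s <;>
      simp [Function.uncurry, indicator, h1, h2, -mem_Ioc, -mem_Ioo]

/-- The symbol `e^{itp(r)} (1 + r²)^(-3z/2)` at `r = 2π‖ξ‖`. -/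
def radialSymbol (σ t : ℝ) (z : ℂ) (ξ : R3) : ℂ :=
  symbol σ t ξ * amplitude z (2 * Real.pi * ‖ξ‖)

variable {σ : ℝ}

lemma intervalIntegral_planeWave_eq (ρ s : ℝ) :
    ∫ z in (-s)..s, planeWave ρ z = s * ∫ u in (-1 : ℝ)..1, planeWave ρ (s * u) := by
  have := intervalIntegral.smul_integral_comp_mul_left (planeWave ρ) s (a := -1) (b := 1)
  rw [mul_neg_one, mul_one] at this
  rw [← this, Complex.real_smul]

lemma hasDerivAt_planeWave (ρ z : ℝ) :
    HasDerivAt (planeWave ρ) (planeWave ρ z * (Complex.I * ((-(2 * Real.pi * ρ) : ℝ) : ℂ))) z := by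
  refine hasDerivAt_cexp_mul_I (φ := fun z => -(2 * Real.pi * ρ * z)) ?_
  exact (((hasDerivAt_id z).const_mul (2 * Real.pi * ρ)).neg).congr_deriv (by simp)

lemma intervalIntegral_planeWave_eq_div {ρ : ℝ} (hρ : 0 < ρ) (s : ℝ) :
    ∫ z in (-s)..s, planeWave ρ z =
      Complex.I / ((2 * Real.pi * ρ : ℝ) : ℂ) * (planeWave ρ s - planeWave ρ (-s)) := by
  have hne : ((2 * Real.pi * ρ : ℝ) : ℂ) ≠ 0 := by
    have := Real.pi_pos
    exact_mod_cast (by positivity : (2 * Real.pi * ρ) ≠ 0)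
  have := intervalIntegral.integral_eq_sub_of_hasDerivAt (a := -s) (b := s)
    (f := fun z => Complex.I / ((2 * Real.pi * ρ : ℝ) : ℂ) * planeWave ρ z) (f' := planeWave ρ)
    (fun z _ => ((hasDerivAt_planeWave ρ z).const_mul _).congr_deriv (by
      rw [Complex.ofReal_neg]
      field_simp
      simp))
    ((continuous_planeWave ρ).intervalIntegrable _ _)
  rw [this]; ring

/-- In the variable r = 2πs the plane wave only adds a linear term, of slope v = -ρu, to the phase.
-/
lemma symbolRadial_mul_planeWave (t ρ s u : ℝ) :
    Complex.exp (Complex.I * ((t * dispersion σ (2 * Real.pi * s) : ℝ) : ℂ)) *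
      planeWave ρ (s * u) =
      Complex.exp (Complex.I * (phase σ t (-(ρ * u)) (2 * Real.pi * s) : ℂ)) := by
  rw [planeWave, ← Complex.exp_add, phase]
  congr 1
  push_cast
  ring

lemma intervalIntegral_swap_of_continuous {f : ℝ → ℝ → ℂ} (hf : Continuous (Function.uncurry f))
    {a b c d : ℝ} (hab : a ≤ b) (hcd : c ≤ d) :
    ∫ x in a..b, ∫ y in c..d, f x y = ∫ y in c..d, ∫ x in a..b, f x y := by
  simp_rw [intervalIntegral.integral_of_le hab, intervalIntegral.integral_of_le hcd]
  refine integral_integral_swap ?_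
  rw [Measure.prod_restrict]
  exact (hf.continuousOn.integrableOn_compact (isCompact_Icc.prod isCompact_Icc)).mono_set
    (prod_mono Ioc_subset_Icc_self Ioc_subset_Icc_self)

/-- The decay exponent of the kernel. -/
def kernelRate (σ : ℝ) : ℝ := if σ ≤ 1 then 3 / 2 else 4 / 3

/-- The dispersive estimate for the kernel of the truncated propagator of order `-3 z`. -/
lemma exists_norm_fourier_radialSymbol_le (hσ₀ : 0 < σ) (hσ₂ : σ < 2) :
    ∃ C R₁, 0 ≤ C ∧ ∀ t R : ℝ, ∀ z : ℂ, 1 ≤ t → t ≤ R → R₁ ≤ R → z.re = 1 → ∀ x : R3,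
      ‖𝓕 ((Metric.closedBall (0 : R3) R).indicator (radialSymbol σ t z)) x‖ ≤
        C * ‖z‖ ^ 2 * t ^ (-kernelRate σ) := by
  obtain ⟨C₁, hC₁, h₁⟩ := exists_norm_integral_quadAmp_le hσ₀ hσ₂
  obtain ⟨C₂, R₂, hC₂, h₂⟩ := exists_norm_integral_linAmp_le hσ₀ hσ₂
  have hpi := Real.pi_pos
  have hpi3 := Real.pi_gt_three
  set α := 1 - σ / 2 with hα
  have hα0 : 0 < α := by rw [hα]; linarith
  refine ⟨C₁ + 2 / α * (2 * C₂), R₂, by positivity, fun t R z ht htR hR hz x => ?_⟩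
  have ht0 : 0 < t := by linarith
  have hR0 : 0 < R := by linarith
  have hz1 := one_le_norm_of_re_eq_one hz
  have hRR : R ≤ 2 * Real.pi * R := by nlinarith
  set e : ℝ → ℂ := fun r => Complex.exp (Complex.I * ((t * dispersion σ r : ℝ) : ℂ)) with he
  have hec : Continuous e := by
    have := continuous_dispersion hσ₂
    fun_prop
  have hac := continuous_amplitude z
  set g : ℝ → ℂ := fun s => e (2 * Real.pi * s) * amplitude z (2 * Real.pi * s) with hg
  have hgc : Continuous g := by fun_prop
  have hsym : radialSymbol σ t z = fun ξ => g ‖ξ‖ := rfl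
  rw [hsym, fourier_indicator_radial hgc hR0.le, norm_smul, Real.norm_eq_abs,
    abs_of_pos (by positivity)]
  set ρ := ‖x‖ with hρ
  have hρ0 : 0 ≤ ρ := norm_nonneg x
  have htpos : 0 < t ^ (-kernelRate σ) := Real.rpow_pos_of_pos ht0 _
  -- For small |x| the average over u ∈ [-1, 1] is kept outside: every slope -ρu lies in the
  -- nonstationary range, and the amplitude is s². For large |x| the average is evaluated in closed
  -- form.
  rcases le_or_gt ρ (α / 2 * t) with hsmall | hlarge
  · have hpw := continuous_planeWave ρ
    have e1 : ∫ s in (0 : ℝ)..R, (s * g s) * ∫ z in (-s)..s, planeWave ρ z =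
        ∫ u in (-1 : ℝ)..1, ∫ s in (0 : ℝ)..R, (s : ℂ) ^ 2 * (g s * planeWave ρ (s * u)) := by
      rw [← intervalIntegral_swap_of_continuous
        (f := fun s u => (s : ℂ) ^ 2 * (g s * planeWave ρ (s * u))) (by fun_prop) hR0.le
        (by norm_num)]
      · refine intervalIntegral.integral_congr fun s _ => ?_
        rw [intervalIntegral_planeWave_eq, ← intervalIntegral.integral_const_mul,
          ← intervalIntegral.integral_const_mul]
        refine intervalIntegral.integral_congr fun u _ => ?_
        ring
    have e2 : ∀ u ∈ Icc (-1 : ℝ) 1, ‖∫ s in (0 : ℝ)..R, (s : ℂ) ^ 2 * (g s * planeWave ρ (s * u))‖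
        ≤ C₁ * ‖z‖ ^ 2 / t ^ 2 / (2 * Real.pi) ^ 3 := by
      intro u hu
      have hv : |-(ρ * u)| ≤ α / 2 * t := by
        rw [abs_neg, abs_mul, abs_of_nonneg hρ0]
        have : |u| ≤ 1 := abs_le.2 hu
        nlinarith
      have hb := h₁ t (-(ρ * u)) (2 * Real.pi * R) z ht hv (by linarith) hz
      have hs := intervalIntegral.smul_integral_comp_mul_left (a := 0) (b := R) (fun r : ℝ =>
        Complex.exp (Complex.I * (phase σ t (-(ρ * u)) r : ℂ)) * ((r : ℂ) ^ 2 * amplitude z r))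
        (2 * Real.pi)
      rw [mul_zero] at hs
      rw [← hs] at hb
      have e3 : ∫ s in (0 : ℝ)..R, (s : ℂ) ^ 2 * (g s * planeWave ρ (s * u)) =
          ((2 * Real.pi : ℝ) ^ 2 : ℝ)⁻¹ • ∫ s in (0 : ℝ)..R,
            Complex.exp (Complex.I * (phase σ t (-(ρ * u)) (2 * Real.pi * s) : ℂ)) *
            ((((2 * Real.pi * s : ℝ)) : ℂ) ^ 2 * amplitude z (2 * Real.pi * s)) := by
        rw [← intervalIntegral.integral_smul]
        refine intervalIntegral.integral_congr fun s _ => ?_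
        simp only [hg, he]
        rw [← symbolRadial_mul_planeWave, Complex.real_smul]
        have : (Real.pi : ℂ) ≠ 0 := by exact_mod_cast hpi.ne'
        push_cast
        field_simp
      rw [e3, norm_smul, norm_inv, Real.norm_eq_abs, abs_of_pos (by positivity)]
      rw [norm_smul, Real.norm_eq_abs, abs_of_pos (by positivity)] at hb
      rw [inv_mul_le_iff₀ (by positivity)]
      refine (le_of_mul_le_mul_left (hb.trans (le_of_eq ?_)) (by positivity : 0 < 2 * Real.pi))
      field_simp
    have e4 := intervalIntegral.norm_integral_le_of_norm_le_const (a := -1) (b := 1)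
      (C := C₁ * ‖z‖ ^ 2 / t ^ 2 / (2 * Real.pi) ^ 3) (f := fun u : ℝ =>
        ∫ s in (0 : ℝ)..R, (s : ℂ) ^ 2 * (g s * planeWave ρ (s * u))) (fun u hu => e2 u (by
        rw [uIoc_of_le (by norm_num)] at hu; exact Ioc_subset_Icc_self hu))
    rw [e1]
    have e5 : 1 / t ^ 2 ≤ t ^ (-kernelRate σ) := by
      rw [one_div, ← Real.rpow_two, ← Real.rpow_neg ht0.le]
      refine Real.rpow_le_rpow_of_exponent_le ht ?_
      unfold kernelRate; split_ifs <;> norm_num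
    calc _ ≤ 2 * Real.pi * (C₁ * ‖z‖ ^ 2 / t ^ 2 / (2 * Real.pi) ^ 3 * |1 - (-1)|) := by gcongr
      _ = C₁ * ‖z‖ ^ 2 * (1 / t ^ 2) * (2 / (2 * Real.pi) ^ 2) := by
        norm_num; field_simp
      _ ≤ C₁ * ‖z‖ ^ 2 * t ^ (-kernelRate σ) * 1 := by
        gcongr
        rw [div_le_one (by positivity)]
        nlinarith
      _ ≤ _ := by rw [mul_one]; gcongr; linarith [(by positivity : 0 ≤ 2 / α * (2 * C₂))]
  · have hρpos : 0 < ρ := lt_trans (by positivity) hlarge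
    have hpw := continuous_planeWave ρ
    have e0 : ∀ v : ℝ, v = 1 ∨ v = -1 →
        ‖∫ s in (0 : ℝ)..R, (s : ℂ) * (g s * planeWave ρ (s * v))‖ ≤
        C₂ * ‖z‖ * t ^ (-(if σ ≤ 1 then 1 / 2 else 1 / 3 : ℝ)) / (2 * Real.pi) ^ 2 := by
      intro u _
      have hb := h₂ t (-(ρ * u)) (2 * Real.pi * R) z ht (by linarith) hz
      have hs := intervalIntegral.smul_integral_comp_mul_left (a := 0) (b := R) (fun r : ℝ =>
        Complex.exp (Complex.I * (phase σ t (-(ρ * u)) r : ℂ)) * ((r : ℂ) * amplitude z r))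
        (2 * Real.pi)
      rw [mul_zero] at hs
      rw [← hs] at hb
      have e3 : ∫ s in (0 : ℝ)..R, (s : ℂ) * (g s * planeWave ρ (s * u)) =
          (2 * Real.pi : ℝ)⁻¹ • ∫ s in (0 : ℝ)..R,
            Complex.exp (Complex.I * (phase σ t (-(ρ * u)) (2 * Real.pi * s) : ℂ)) *
            ((((2 * Real.pi * s : ℝ)) : ℂ) * amplitude z (2 * Real.pi * s)) := by
        rw [← intervalIntegral.integral_smul]
        refine intervalIntegral.integral_congr fun s _ => ?_
        simp only [hg, he]
        rw [← symbolRadial_mul_planeWave, Complex.real_smul]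
        have : (Real.pi : ℂ) ≠ 0 := by exact_mod_cast hpi.ne'
        push_cast
        field_simp
      rw [e3, norm_smul, norm_inv, Real.norm_eq_abs, abs_of_pos (by positivity)]
      rw [norm_smul, Real.norm_eq_abs, abs_of_pos (by positivity)] at hb
      rw [inv_mul_le_iff₀ (by positivity)]
      refine (le_of_mul_le_mul_left (hb.trans (le_of_eq ?_)) (by positivity : 0 < 2 * Real.pi))
      field_simp
    have i0 : ∀ v : ℝ, IntervalIntegrable (fun s : ℝ => (s : ℂ) * (g s * planeWave ρ (s * v)))
        volume 0 R := fun v => Continuous.intervalIntegrable (by fun_prop) _ _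
    -- The closed form gains 1/ρ ≤ 2/(αt) and leaves the two extreme slopes ∓ρ with amplitude s, to
    -- which the stationary estimate applies.
    have e1 : ∫ s in (0 : ℝ)..R, (s * g s) * ∫ z in (-s)..s, planeWave ρ z =
        Complex.I / ((2 * Real.pi * ρ : ℝ) : ℂ) *
        ((∫ s in (0 : ℝ)..R, (s : ℂ) * (g s * planeWave ρ (s * 1))) -
          ∫ s in (0 : ℝ)..R, (s : ℂ) * (g s * planeWave ρ (s * (-1)))) := by
      rw [← intervalIntegral.integral_sub (i0 1) (i0 (-1)), ← intervalIntegral.integral_const_mul]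
      refine intervalIntegral.integral_congr fun s _ => ?_
      rw [intervalIntegral_planeWave_eq_div hρpos, mul_one, mul_neg_one]
      ring
    have e5 : t ^ (-(if σ ≤ 1 then 1 / 2 else 1 / 3 : ℝ)) / t = t ^ (-kernelRate σ) := by
      rw [← Real.rpow_sub_one ht0.ne']
      congr 1
      unfold kernelRate; split_ifs <;> norm_num
    set T := t ^ (-(if σ ≤ 1 then 1 / 2 else 1 / 3 : ℝ)) with hT
    have hT0 : 0 < T := Real.rpow_pos_of_pos ht0 _
    rw [e1, norm_mul, norm_div, Complex.norm_I, Complex.norm_real, Real.norm_eq_abs,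
      abs_of_pos (by positivity)]
    calc _ ≤ 2 * Real.pi * (1 / (2 * Real.pi * ρ) * (C₂ * ‖z‖ * T / (2 * Real.pi) ^ 2 +
          C₂ * ‖z‖ * T / (2 * Real.pi) ^ 2)) := by
          gcongr
          exact (norm_sub_le _ _).trans (add_le_add (e0 1 (Or.inl rfl)) (e0 (-1) (Or.inr rfl)))
      _ = 1 / ρ * (2 * C₂ * ‖z‖ * T * (1 / (2 * Real.pi) ^ 2)) := by field_simp; ring
      _ ≤ 1 / (α / 2 * t) * (2 * C₂ * ‖z‖ ^ 2 * T * 1) := by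
          gcongr
          · nlinarith
          · rw [div_le_one (by positivity)]; nlinarith
      _ = 2 / α * (2 * C₂) * ‖z‖ ^ 2 * (T / t) := by field_simp
      _ ≤ _ := by rw [e5]; gcongr; linarith

end RadialFourier

/-! ### Fourier multipliers on L², and the L¹ bound from a bounded kernel. -/

noncomputable section FourierMultiplierL2

open Set

/-- The complex Hilbert space `L²(ℝ³)`. -/
abbrev SqInt : Type := Lp (α := R3) ℂ 2

/-- Two functions in Lebesgue spaces that agree as tempered distributions agree almost
everywhere. -/
lemma ae_eq_of_toTemperedDistribution_eq {p q : ℝ≥0∞} [hp : Fact (1 ≤ p)] [hq : Fact (1 ≤ q)]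
    (f : Lp (α := R3) ℂ p) (g : Lp (α := R3) ℂ q) (h : (f : 𝓢'(R3, ℂ)) = (g : 𝓢'(R3, ℂ))) :
    (f : R3 → ℂ) =ᵐ[volume] g := by
  refine ae_eq_of_integral_contDiff_smul_eq ((Lp.memLp f).locallyIntegrable hp.elim)
    ((Lp.memLp g).locallyIntegrable hq.elim) fun φ φ_smooth φ_cpt => ?_
  have hg₁ : HasCompactSupport (Complex.ofRealCLM ∘ φ) := φ_cpt.comp_left rfl
  have hg₂ : ContDiff ℝ (⊤ : ℕ∞) (Complex.ofRealCLM ∘ φ) := by fun_prop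
  have := congrArg (fun T : 𝓢'(R3, ℂ) => T (hg₁.toSchwartzMap hg₂)) h
  simpa using this

lemma integral_fourier_mul_eq {f g : R3 → ℂ} (hf : Integrable f) (hg : Integrable g) :
    ∫ ξ, 𝓕 f ξ * g ξ = ∫ x, f x * 𝓕 g x := by
  have := VectorFourier.integral_fourierIntegral_smul_eq_flip (μ := (volume : Measure R3))
    (ν := (volume : Measure R3)) (L := innerₗ R3) Real.continuous_fourierChar
    (by exact continuous_inner) hf hg
  simpa using! this

lemma norm_fourier_le_integral (f : R3 → ℂ) (ξ : R3) : ‖𝓕 f ξ‖ ≤ ∫ x, ‖f x‖ :=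
  VectorFourier.norm_fourierIntegral_le_integral_norm _ _ _ _ _

lemma continuous_fourier {f : R3 → ℂ} (hf : Integrable f) : Continuous (𝓕 f) :=
  VectorFourier.fourierIntegral_continuous Real.continuous_fourierChar
    (by exact continuous_inner) hf

/-- On `L¹ ∩ L²` the Fourier transform of `L²` is given by the Fourier integral. -/
lemma coeFn_fourier_toLp {f : R3 → ℂ} (h1 : Integrable f volume) (h2 : MemLp f 2 volume) :
    (𝓕 (h2.toLp f) : SqInt) =ᵐ[volume] 𝓕 f := by
  have hm : MemLp (𝓕 f) ∞ (volume : Measure R3) :=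
    memLp_top_of_bound (continuous_fourier h1).aestronglyMeasurable _
      (Filter.Eventually.of_forall (norm_fourier_le_integral f))
  refine (ae_eq_of_toTemperedDistribution_eq (𝓕 (h2.toLp f)) (hm.toLp _) ?_).trans hm.coeFn_toLp
  rw [← Lp.fourier_toTemperedDistribution_eq]
  ext φ
  rw [TemperedDistribution.fourier_apply, Lp.toTemperedDistribution_apply,
    Lp.toTemperedDistribution_apply]
  have e1 : ∫ x, (𝓕 φ) x • (h2.toLp f : R3 → ℂ) x = ∫ x, 𝓕 (φ : R3 → ℂ) x * f x := by
    refine integral_congr_ae ?_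
    filter_upwards [h2.coeFn_toLp] with x hx
    rw [hx, SchwartzMap.fourier_coe, smul_eq_mul]
  have e2 : ∫ x, φ x • (hm.toLp _ : R3 → ℂ) x = ∫ x, φ x * 𝓕 f x := by
    refine integral_congr_ae ?_
    filter_upwards [hm.coeFn_toLp] with x hx
    rw [hx, smul_eq_mul]
  rw [e1, e2, integral_fourier_mul_eq φ.integrable h1]

/-- On `L¹ ∩ L²` the inverse Fourier transform of `L²` is bounded by the `L¹` norm. -/
lemma ae_norm_fourierInv_toLp_le {f : R3 → ℂ} (h1 : Integrable f volume) (h2 : MemLp f 2 volume) :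
    ∀ᵐ x, ‖(𝓕⁻ (h2.toLp f) : SqInt) x‖ ≤ ∫ ξ, ‖f ξ‖ := by
  have hb : ∀ x, ‖𝓕⁻ f x‖ ≤ ∫ ξ, ‖f ξ‖ := fun x => by
    rw [Real.fourierInv_eq_fourier_neg]; exact norm_fourier_le_integral f _
  have hi : (𝓕⁻ f : R3 → ℂ) = fun x => 𝓕 f (-x) := funext (Real.fourierInv_eq_fourier_neg f)
  have hc : Continuous (𝓕⁻ f : R3 → ℂ) := by
    rw [hi]; exact (continuous_fourier h1).comp continuous_neg
  have hm : MemLp (𝓕⁻ f) ∞ (volume : Measure R3) :=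
    memLp_top_of_bound hc.aestronglyMeasurable _ (Filter.Eventually.of_forall hb)
  have key : (𝓕⁻ (h2.toLp f) : SqInt) =ᵐ[volume] 𝓕⁻ f := by
    refine (ae_eq_of_toTemperedDistribution_eq (𝓕⁻ (h2.toLp f)) (hm.toLp _) ?_).trans hm.coeFn_toLp
    rw [← Lp.fourierInv_toTemperedDistribution_eq]
    ext φ
    rw [TemperedDistribution.fourierInv_apply, Lp.toTemperedDistribution_apply,
      Lp.toTemperedDistribution_apply]
    have e1 : ∫ x, (𝓕⁻ φ) x • (h2.toLp f : R3 → ℂ) x = ∫ x, 𝓕 (φ : R3 → ℂ) x * f (-x) := by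
      rw [← integral_neg_eq_self]
      refine integral_congr_ae ?_
      filter_upwards [(Measure.measurePreserving_neg volume).quasiMeasurePreserving.ae h2.coeFn_toLp]
        with x hx
      rw [hx, SchwartzMap.fourierInv_coe, Real.fourierInv_eq_fourier_neg, neg_neg, smul_eq_mul]
    have e2 : ∫ x, φ x • (hm.toLp _ : R3 → ℂ) x = ∫ x, φ x * 𝓕 (fun x => f (-x)) x := by
      refine integral_congr_ae ?_
      filter_upwards [hm.coeFn_toLp] with x hx
      rw [hx, smul_eq_mul, Real.fourierInv_eq_fourier_comp_neg]
    rw [e1, e2, integral_fourier_mul_eq φ.integrable h1.comp_neg]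
  filter_upwards [key] with x hx
  rw [hx]; exact hb x

/-- A bounded kernel gives a bilinear form that is bounded on `L¹`. -/
lemma norm_integral_mul_fourier_mul_conj_le {m u v : R3 → ℂ} {D : ℝ} (hm : Integrable m)
    (hu : Integrable u) (hv : Integrable v) (hD : ∀ x, ‖𝓕 m x‖ ≤ D) :
    ‖∫ ξ, m ξ * 𝓕 u ξ * (starRingEnd ℂ) (𝓕 v ξ)‖ ≤ D * (∫ x, ‖u x‖) * ∫ x, ‖v x‖ := by
  -- Conjugating and reflecting v turns the conjugate of its transform into a Fourier transform. The
  -- multiplication formula can then be applied twice, once to remove each transform.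
  set w : R3 → ℂ := fun y => (starRingEnd ℂ) (v (-y)) with hw
  have hwi : Integrable w := Complex.conjLIE.integrable_comp_iff.2 hv.comp_neg
  have hconj : ∀ ξ, (starRingEnd ℂ) (𝓕 v ξ) = 𝓕 w ξ := by
    intro ξ
    rw [Real.fourier_eq', Real.fourier_eq', ← integral_conj, ← integral_neg_eq_self]
    refine integral_congr_ae (Filter.Eventually.of_forall fun y => ?_)
    simp only [hw, smul_eq_mul, map_mul, ← Complex.exp_conj, inner_neg_left, Complex.conj_ofReal,
      Complex.conj_I]
    congr 2
    push_cast
    ring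
  have hcw := continuous_fourier hwi
  have hbd : Integrable fun ξ => m ξ * 𝓕 w ξ :=
    hm.mul_bdd hcw.aestronglyMeasurable (Filter.Eventually.of_forall (norm_fourier_le_integral w))
  have hmod : ∀ x, ‖𝓕 (fun ξ => m ξ * 𝓕 w ξ) x‖ ≤ D * ∫ y, ‖v y‖ := by
    intro x
    -- Modulating the symbol translates its Fourier transform, so the sup bound D is unaffected.
    set mx : R3 → ℂ := fun ξ => Complex.exp ((-2 * Real.pi * inner ℝ ξ x : ℝ) * Complex.I) * m ξ
      with hmx
    have hmxi : Integrable mx := by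
      refine hm.bdd_mul (c := 1) (Continuous.aestronglyMeasurable (by fun_prop))
        (Filter.Eventually.of_forall fun ξ => (Complex.norm_exp_ofReal_mul_I _).le)
    have e1 : 𝓕 (fun ξ => m ξ * 𝓕 w ξ) x = ∫ ξ, 𝓕 w ξ * mx ξ := by
      rw [Real.fourier_eq']
      refine integral_congr_ae (Filter.Eventually.of_forall fun ξ => ?_)
      simp only [hmx, smul_eq_mul]
      ring
    have e2 : ∀ y, 𝓕 mx y = 𝓕 m (x + y) := by
      intro y
      rw [Real.fourier_eq', Real.fourier_eq']
      refine integral_congr_ae (Filter.Eventually.of_forall fun ξ => ?_)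
      simp only [hmx, smul_eq_mul, inner_add_right]
      rw [← mul_assoc, ← Complex.exp_add]
      congr 2
      push_cast
      ring
    rw [e1, integral_fourier_mul_eq hwi hmxi]
    calc ‖∫ y, w y * 𝓕 mx y‖ ≤ ∫ y, ‖w y‖ * D := by
          refine norm_integral_le_of_norm_le (hwi.norm.mul_const D)
            (Filter.Eventually.of_forall fun y => ?_)
          rw [norm_mul, e2]
          gcongr
          exact hD _
      _ = D * ∫ y, ‖w y‖ := by rw [integral_mul_const, mul_comm]
      _ = D * ∫ y, ‖v y‖ := by
          congr 1
          rw [← integral_neg_eq_self]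
          simp [hw]
  have e3 : ∫ ξ, m ξ * 𝓕 u ξ * (starRingEnd ℂ) (𝓕 v ξ) = ∫ ξ, 𝓕 u ξ * (m ξ * 𝓕 w ξ) := by
    refine integral_congr_ae (Filter.Eventually.of_forall fun ξ => ?_)
    simp only [hconj]
    ring
  rw [e3, integral_fourier_mul_eq hu hbd]
  calc _ ≤ ∫ x, ‖u x‖ * (D * ∫ y, ‖v y‖) := by
        refine norm_integral_le_of_norm_le (hu.norm.mul_const _)
          (Filter.Eventually.of_forall fun x => ?_)
        rw [norm_mul]
        gcongr
        exact hmod x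
    _ = _ := by rw [integral_mul_const]; ring

/-- The Fourier multiplier operator on `L²` with bounded symbol `m`. -/
def fourierMul {m : R3 → ℂ} (hm : MemLp m ∞ volume) (u : SqInt) : Lp (α := R3) ℂ 2 :=
  𝓕⁻ ((hm.toLp m • 𝓕 u : SqInt))

lemma propagator_eq_fourierMul (σ t : ℝ) (u : SqInt) :
    propagator σ t u = fourierMul (symbol_memLp σ t) u := rfl

section

variable {m m₁ m₂ : R3 → ℂ} (hm : MemLp m ∞ (volume : Measure R3))

lemma fourier_fourierMul (u : SqInt) :
    𝓕 (fourierMul hm u) = (hm.toLp m • 𝓕 u : SqInt) := fourier_fourierInv_eq _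

lemma coeFn_fourier_fourierMul (u : SqInt) :
    (𝓕 (fourierMul hm u) : SqInt) =ᵐ[volume] fun ξ => m ξ * (𝓕 u : SqInt) ξ := by
  rw [fourier_fourierMul]
  filter_upwards [Lp.coeFn_lpSMul (r := 2) (hm.toLp m) (𝓕 u), hm.coeFn_toLp] with ξ h1 h2
  rw [h1, Pi.smul_apply', h2, smul_eq_mul]

lemma fourierMul_sub (u v : SqInt) :
    fourierMul hm (u - v) = fourierMul hm u - fourierMul hm v := by
  have h1 : (𝓕 (u - v) : SqInt) = 𝓕 u - 𝓕 v := (Lp.fourierTransformₗᵢ R3 ℂ).map_sub u v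
  have h2 : ∀ a b : SqInt, (𝓕⁻ (a - b) : SqInt) = 𝓕⁻ a - 𝓕⁻ b :=
    (Lp.fourierTransformₗᵢ R3 ℂ).symm.map_sub
  unfold fourierMul
  rw [h1, sub_eq_add_neg, Lp.add_smul, Lp.smul_neg, ← sub_eq_add_neg, h2]

lemma norm_fourierMul_le (h : ∀ ξ, ‖m ξ‖ ≤ 1) (u : SqInt) :
    ‖fourierMul hm u‖ ≤ ‖u‖ := by
  rw [← Lp.norm_fourier_eq (fourierMul hm u), ← Lp.norm_fourier_eq u]
  refine Lp.norm_le_norm_of_ae_le ?_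
  filter_upwards [coeFn_fourier_fourierMul hm u] with ξ hξ
  rw [hξ, norm_mul]
  exact mul_le_of_le_one_left (norm_nonneg _) (h ξ)

lemma continuous_fourierMul (h : ∀ ξ, ‖m ξ‖ ≤ 1) : Continuous (fourierMul hm) := by
  refine (LipschitzWith.of_dist_le_mul (K := 1) fun u v => ?_).continuous
  rw [dist_eq_norm, dist_eq_norm, ← fourierMul_sub, NNReal.coe_one, one_mul]
  exact norm_fourierMul_le hm h _

lemma fourierMul_fourierMul (hm₁ : MemLp m₁ ∞ (volume : Measure R3))
    (hm₂ : MemLp m₂ ∞ (volume : Measure R3)) (h : ∀ ξ, m ξ = m₁ ξ * m₂ ξ)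
    (u : SqInt) : fourierMul hm₁ (fourierMul hm₂ u) = fourierMul hm u := by
  have inj : Function.Injective fun u : Lp (α := R3) ℂ 2 => (𝓕 u : SqInt) :=
    (Lp.fourierTransformₗᵢ R3 ℂ).injective
  refine inj (Lp.ext ?_)
  filter_upwards [coeFn_fourier_fourierMul hm₁ (fourierMul hm₂ u), coeFn_fourier_fourierMul hm₂ u,
    coeFn_fourier_fourierMul hm u] with ξ h1 h2 h3
  rw [h1, h2, h3, h, mul_assoc]

lemma inner_fourierMul (u v : SqInt) :
    inner ℂ v (fourierMul hm u) =
      ∫ ξ, m ξ * (𝓕 u : SqInt) ξ * (starRingEnd ℂ) ((𝓕 v : SqInt) ξ) := by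
  rw [← Lp.inner_fourier_eq, L2.inner_def]
  refine integral_congr_ae ?_
  filter_upwards [coeFn_fourier_fourierMul hm u] with ξ hξ
  rw [hξ, RCLike.inner_apply]

lemma integrable_fourierMul (hm : MemLp m ∞ (volume : Measure R3)) (u v : SqInt) :
    Integrable fun ξ => m ξ * (𝓕 u : SqInt) ξ * (starRingEnd ℂ) ((𝓕 v : SqInt) ξ) := by
  refine (L2.integrable_inner (𝕜 := ℂ) (𝓕 v : SqInt) (𝓕 (fourierMul hm u))).congr ?_
  filter_upwards [coeFn_fourier_fourierMul hm u] with ξ hξ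
  rw [hξ, RCLike.inner_apply]

lemma toTemperedDistribution_fourierMul (hg : m.HasTemperateGrowth) (u : SqInt) :
    ((fourierMul hm u) : 𝓢'(R3, ℂ)) =
      fourierMultiplierCLM ℂ m (u : 𝓢'(R3, ℂ)) := by
  rw [fourierMul, ← Lp.fourierInv_toTemperedDistribution_eq, Lp.toTemperedDistribution_smul_eq hg,
    ← Lp.fourier_toTemperedDistribution_eq, TemperedDistribution.fourierMultiplierCLM_apply]

end

end FourierMultiplierL2

/-! ### Stein interpolation. -/

noncomputable section ComplexInterpolation

open Set

lemma continuous_symbol {σ : ℝ} (hσ₂ : σ < 2) (t : ℝ) : Continuous (symbol σ t) := by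
  have := continuous_dispersion hσ₂
  unfold symbol
  fun_prop

lemma norm_symbol (σ t : ℝ) (ξ : R3) : ‖symbol σ t ξ‖ = 1 := norm_cexp_I_mul_ofReal _

lemma continuous_radialSymbol {σ : ℝ} (hσ₂ : σ < 2) (t : ℝ) (z : ℂ) :
    Continuous (radialSymbol σ t z) :=
  (continuous_symbol hσ₂ t).mul ((continuous_amplitude z).comp (by fun_prop))

lemma norm_radialSymbol_le_one (σ t : ℝ) {z : ℂ} (hz : 0 ≤ z.re) (ξ : R3) :
    ‖radialSymbol σ t z ξ‖ ≤ 1 := by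
  rw [radialSymbol, norm_mul, norm_symbol, one_mul]
  exact norm_amplitude_le_one hz _

/-- The weight in the exponent of the amplitude. -/
def logWeight (ξ : R3) : ℝ := 3 / 2 * Real.log (1 + (2 * Real.pi * ‖ξ‖) ^ 2)

lemma logWeight_nonneg (ξ : R3) : 0 ≤ logWeight ξ :=
  mul_nonneg (by norm_num) (Real.log_nonneg (by nlinarith [sq_nonneg (2 * Real.pi * ‖ξ‖)]))

lemma continuous_logWeight : Continuous logWeight := by
  unfold logWeight
  exact continuous_const.mul (Continuous.log (by fun_prop) fun ξ => by positivity)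

lemma radialSymbol_eq (σ t : ℝ) (z : ℂ) (ξ : R3) :
    radialSymbol σ t z ξ = symbol σ t ξ * Complex.exp (-(z * (logWeight ξ : ℂ))) := by
  rw [radialSymbol, amplitude, logWeight]
  congr 2
  push_cast
  ring

/-- On the ball the weight is bounded, so |e^{-zL}| ≤ e^{(|z₀|+1)L} dominates near z₀ and
differentiation under the integral is legitimate. -/
lemma differentiable_integral_radialSymbol_mul {σ : ℝ} (hσ₂ : σ < 2) (t R : ℝ) {h : R3 → ℂ}
    (hh : Continuous h) : Differentiable ℂ fun z =>
      ∫ ξ in Metric.closedBall (0 : R3) R, radialSymbol σ t z ξ * h ξ := by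
  intro z₀
  have cL := continuous_logWeight
  have cs := continuous_symbol hσ₂ t
  have cF : ∀ z, Continuous fun ξ => radialSymbol σ t z ξ * h ξ := fun z =>
    (continuous_radialSymbol hσ₂ t z).mul hh
  have key := hasDerivAt_integral_of_dominated_loc_of_deriv_le
    (μ := volume.restrict (Metric.closedBall (0 : R3) R)) (x₀ := z₀) (s := Metric.ball z₀ 1)
    (F := fun z ξ => radialSymbol σ t z ξ * h ξ)
    (F' := fun z ξ => -(logWeight ξ : ℂ) * radialSymbol σ t z ξ * h ξ)
    (bound := fun ξ => logWeight ξ * Real.exp ((‖z₀‖ + 1) * logWeight ξ) * ‖h ξ‖)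
    (Metric.ball_mem_nhds _ one_pos)
    (Filter.Eventually.of_forall fun z => (cF z).aestronglyMeasurable)
    ((cF z₀).continuousOn.integrableOn_compact (isCompact_closedBall _ _))
    (by
      have := continuous_radialSymbol hσ₂ t z₀
      exact Continuous.aestronglyMeasurable (by fun_prop))
    (Filter.Eventually.of_forall fun ξ z hz => by
      have hL := logWeight_nonneg ξ
      rw [norm_mul, norm_mul, norm_neg, Complex.norm_real, Real.norm_eq_abs, abs_of_nonneg hL,
        radialSymbol_eq, norm_mul, norm_symbol, one_mul, Complex.norm_exp]
      gcongr
      rw [Complex.neg_re, Complex.re_mul_ofReal, ← neg_mul]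
      gcongr
      have h1 : ‖z‖ ≤ ‖z₀‖ + 1 := by
        have h2 := norm_add_le (z - z₀) z₀
        rw [Metric.mem_ball, dist_eq_norm] at hz
        rw [sub_add_cancel] at h2
        linarith
      linarith [neg_le_abs z.re, Complex.abs_re_le_norm z])
    ((Continuous.continuousOn (by fun_prop)).integrableOn_compact (isCompact_closedBall _ _))
    (Filter.Eventually.of_forall fun ξ z _ => by
      simp only [radialSymbol_eq]
      refine ((((hasDerivAt_id z).mul_const (logWeight ξ : ℂ)).neg.cexp.const_mul
        (symbol σ t ξ)).mul_const (h ξ)).congr_deriv ?_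
      simp only [id, Pi.neg_apply]
      ring)
  exact key.2.differentiableAt

/-- The map `c ↦ c ‖c‖^w`, for complex `w`. -/
def stretch (w c : ℂ) : ℂ := c * Complex.exp (w * (Real.log ‖c‖ : ℂ))

lemma stretch_zero_right (w : ℂ) : stretch w 0 = 0 := by simp [stretch]

lemma stretch_zero_left (c : ℂ) : stretch 0 c = c := by simp [stretch]

lemma norm_stretch (w c : ℂ) (hw : 0 < 1 + w.re) : ‖stretch w c‖ = ‖c‖ ^ (1 + w.re) := by
  rcases eq_or_ne c 0 with rfl | hc
  · rw [stretch_zero_right, norm_zero, Real.zero_rpow hw.ne']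
  · have : 0 < ‖c‖ := norm_pos_iff.2 hc
    rw [stretch, norm_mul, Complex.norm_exp, Complex.re_mul_ofReal, Real.rpow_add this,
      Real.rpow_one, Real.rpow_def_of_pos this]
    ring_nf

/-- Conjugating both the parameter and the value gives an expression that is holomorphic in w; this
is how the second argument of a sesquilinear form enters an analytic family. -/
lemma conj_stretch (w c : ℂ) :
    (starRingEnd ℂ) (stretch ((starRingEnd ℂ) w) c) =
      (starRingEnd ℂ) c * Complex.exp (w * (Real.log ‖c‖ : ℂ)) := by
  rw [stretch, map_mul, ← Complex.exp_conj, map_mul, Complex.conj_conj, Complex.conj_ofReal]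

/-- The Fourier transform of the indicator of a level set. -/
def levelFourier (u : SimpleFunc R3 ℂ) (c : ℂ) : R3 → ℂ :=
  𝓕 ((u ⁻¹' {c}).indicator fun _ => (1 : ℂ))

lemma integrable_level {u : SimpleFunc R3 ℂ} (hu : Integrable u volume) {c : ℂ} (hc : c ≠ 0) :
    Integrable ((u ⁻¹' {c}).indicator fun _ => (1 : ℂ)) volume := by
  rw [integrable_indicator_iff (u.measurableSet_fiber c)]
  exact integrableOn_const ((SimpleFunc.integrable_iff.1 hu c hc).ne)

lemma integrable_map_stretch {u : SimpleFunc R3 ℂ} (hu : Integrable u volume) (w : ℂ) :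
    Integrable (u.map (stretch w)) volume := by
  rw [SimpleFunc.integrable_iff_finMeasSupp] at hu ⊢
  exact hu.map (stretch_zero_right w)

/-- For a simple function the dependence on w sits in finitely many scalar coefficients, each entire
in w, in front of fixed continuous functions of ξ. -/
lemma fourier_map_stretch {u : SimpleFunc R3 ℂ} (hu : Integrable u volume) (w : ℂ) (ξ : R3) :
    𝓕 (⇑(u.map (stretch w))) ξ =
      ∑ c ∈ u.range.filter (· ≠ 0), stretch w c * levelFourier u c ξ := by
  have hsum : ∀ x, (u.map (stretch w)) x = ∑ c ∈ u.range.filter (· ≠ 0),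
      stretch w c * (u ⁻¹' {c}).indicator (fun _ => (1 : ℂ)) x := by
    intro x
    rw [SimpleFunc.map_apply]
    rcases eq_or_ne (u x) 0 with h | h
    · rw [h, stretch_zero_right, Finset.sum_eq_zero]
      intro c hc
      rw [Finset.mem_filter] at hc
      rw [indicator_of_notMem, mul_zero]
      simp [h, hc.2.symm]
    · rw [Finset.sum_eq_single (u x)]
      · simp
      · intro c _ hne
        rw [indicator_of_notMem, mul_zero]
        simp [hne.symm]
      · intro hn
        exact absurd (Finset.mem_filter.2 ⟨u.mem_range_self x, h⟩) hn
  simp only [levelFourier, Real.fourier_eq', smul_eq_mul, hsum, Finset.mul_sum]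
  rw [integral_finsetSum]
  · refine Finset.sum_congr rfl fun c _ => ?_
    rw [← integral_const_mul]
    refine integral_congr_ae (Filter.Eventually.of_forall fun x => ?_)
    simp only
    ring
  · intro c hc
    refine Integrable.bdd_mul (c := 1) ((integrable_level hu (Finset.mem_filter.1 hc).2).const_mul _)
      (Continuous.aestronglyMeasurable (by fun_prop))
      (Filter.Eventually.of_forall fun ξ => (Complex.norm_exp_ofReal_mul_I _).le)

lemma norm_toLp_eq_rpow {f : R3 → ℂ} (hf : MemLp f 2 volume) :
    ‖hf.toLp f‖ = (∫ x, ‖f x‖ ^ (2 : ℝ)) ^ (1 / 2 : ℝ) := by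
  rw [Lp.norm_toLp, hf.eLpNorm_eq_integral_rpow_norm (by norm_num) (by norm_num),
    ENNReal.toReal_ofReal (by positivity)]
  norm_num

/-- The L² endpoint of the interpolation: Plancherel with a symbol of modulus at most 1, restricted
to B. -/
lemma norm_setIntegral_mul_fourier_le {m u v : R3 → ℂ} (hm : Continuous m) (hm1 : ∀ ξ, ‖m ξ‖ ≤ 1)
    (hu1 : Integrable u volume) (hu2 : MemLp u 2 volume) (hv1 : Integrable v volume)
    (hv2 : MemLp v 2 volume) {B : Set R3} (hB : MeasurableSet B) :
    ‖∫ ξ in B, m ξ * 𝓕 u ξ * (starRingEnd ℂ) (𝓕 v ξ)‖ ≤ ‖hu2.toLp u‖ * ‖hv2.toLp v‖ := by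
  have hmB : MemLp (B.indicator m) ∞ volume :=
    (memLp_top_of_bound hm.aestronglyMeasurable 1 (Filter.Eventually.of_forall hm1)).indicator hB
  have e : ∫ ξ in B, m ξ * 𝓕 u ξ * (starRingEnd ℂ) (𝓕 v ξ) =
      inner ℂ (hv2.toLp v) (fourierMul hmB (hu2.toLp u)) := by
    rw [inner_fourierMul, ← integral_indicator hB]
    refine integral_congr_ae ?_
    filter_upwards [coeFn_fourier_toLp hu1 hu2, coeFn_fourier_toLp hv1 hv2] with ξ h1 h2
    rw [h1, h2]
    by_cases h : ξ ∈ B <;> simp [h]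
  rw [e, mul_comm]
  refine (norm_inner_le_norm _ _).trans (mul_le_mul_of_nonneg_left
    (norm_fourierMul_le hmB (fun ξ => ?_) _) (norm_nonneg _))
  by_cases h : ξ ∈ B <;> simp [h, hm1]

lemma norm_cexp_sq (z : ℂ) : ‖Complex.exp (z ^ 2)‖ = Real.exp (z.re ^ 2 - z.im ^ 2) := by
  rw [Complex.norm_exp]
  congr 1
  simp [sq]

/-- Stein interpolation for the analytic family of multipliers `radialSymbol σ t z`, between the
Plancherel bound for `Re z = 0` and a bound of the kernels for `Re z = 1`. -/
lemma norm_setIntegral_radialSymbol_le {σ : ℝ} (hσ₂ : σ < 2) {t R D θ : ℝ} (hθ₀ : 0 ≤ θ)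
    (hθ₁ : θ ≤ 1) (hD0 : 0 ≤ D) (hD : ∀ z : ℂ, z.re = 1 → ∀ x : R3,
      ‖𝓕 ((Metric.closedBall (0 : R3) R).indicator (radialSymbol σ t z)) x‖ ≤ D * ‖z‖ ^ 2)
    {u v : SimpleFunc R3 ℂ} (hu : Integrable u volume) (hv : Integrable v volume) :
    ‖∫ ξ in Metric.closedBall (0 : R3) R,
        radialSymbol σ t θ ξ * 𝓕 (⇑u) ξ * (starRingEnd ℂ) (𝓕 (⇑v) ξ)‖ ≤
      (3 * D) ^ θ * ((∫ x, ‖u x‖ ^ (2 / (1 + θ))) * ∫ x, ‖v x‖ ^ (2 / (1 + θ))) ^ ((1 + θ) / 2) := by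
  set q := 2 / (1 + θ) with hq
  have hq0 : 0 < q := by positivity
  have hq2 : q ≤ 2 := div_le_self (by norm_num) (by linarith)
  set B := Metric.closedBall (0 : R3) R with hB
  have hBm : MeasurableSet B := measurableSet_closedBall
  -- `stretch (W z)` has modulus |c|^{q(1 + Re z)/2}, which is |c|^{q/2} on Re z = 0, to be measured
  -- in L², and |c|^q on Re z = 1, to be measured in L¹. At z = θ the exponent `W` vanishes, since
  -- q(1 + θ) = 2, and u itself comes back.
  set W : ℂ → ℂ := fun z => q * (1 + z) / 2 - 1 with hW
  have hWre : ∀ z, 1 + (W z).re = q * (1 + z.re) / 2 := by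
    intro z
    have : W z = ((q / 2 : ℝ) : ℂ) * (1 + z) - 1 := by simp only [hW]; push_cast; ring
    rw [this, Complex.sub_re, Complex.re_ofReal_mul]
    simp; ring
  have hWc : ∀ z, (starRingEnd ℂ) (W z) = W ((starRingEnd ℂ) z) := by
    intro z
    have : ∀ z, W z = ((q / 2 : ℝ) : ℂ) * (1 + z) - 1 := by
      intro z; simp only [hW]; push_cast; ring
    rw [this, this, map_sub, map_mul, map_add, Complex.conj_ofReal, map_one]
  set Φ : ℂ → ℂ := fun z => ∫ ξ in B, radialSymbol σ t z ξ * 𝓕 (⇑(u.map (stretch (W z)))) ξ *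
    (starRingEnd ℂ) (𝓕 (⇑(v.map (stretch (W ((starRingEnd ℂ) z))))) ξ) with hΦ
  set Su := u.range.filter (· ≠ 0) with hSu
  set Sv := v.range.filter (· ≠ 0) with hSv
  set G : ℂ → ℂ → ℂ → ℂ := fun c d z => ∫ ξ in B, radialSymbol σ t z ξ *
    (levelFourier u c ξ * (starRingEnd ℂ) (levelFourier v d ξ)) with hG
  have hcu : ∀ c ∈ Su, Continuous (levelFourier u c) := fun c hc =>
    continuous_fourier (integrable_level hu (Finset.mem_filter.1 hc).2)
  have hcv : ∀ c ∈ Sv, Continuous (levelFourier v c) := fun c hc =>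
    continuous_fourier (integrable_level hv (Finset.mem_filter.1 hc).2)
  have hch : ∀ c ∈ Su, ∀ d ∈ Sv, Continuous fun ξ =>
      levelFourier u c ξ * (starRingEnd ℂ) (levelFourier v d ξ) := fun c hc d hd =>
    (hcu c hc).mul (Complex.continuous_conj.comp (hcv d hd))
  have hGd : ∀ c ∈ Su, ∀ d ∈ Sv, Differentiable ℂ (G c d) := fun c hc d hd =>
    differentiable_integral_radialSymbol_mul hσ₂ t R (hch c hc d hd)
  have hΦsum : ∀ z, Φ z = ∑ c ∈ Su, ∑ d ∈ Sv, stretch (W z) c *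
      ((starRingEnd ℂ) d * Complex.exp (W z * (Real.log ‖d‖ : ℂ))) * G c d z := by
    intro z
    simp only [hΦ, hG, ← integral_const_mul]
    have hint : ∀ c ∈ Su, ∀ d ∈ Sv, IntegrableOn (fun ξ => stretch (W z) c *
        ((starRingEnd ℂ) d * Complex.exp (W z * (Real.log ‖d‖ : ℂ))) * (radialSymbol σ t z ξ *
        (levelFourier u c ξ * (starRingEnd ℂ) (levelFourier v d ξ)))) B := fun c hc d hd =>
      ContinuousOn.integrableOn_compact (isCompact_closedBall _ _) (Continuous.continuousOn
        (continuous_const.mul ((continuous_radialSymbol hσ₂ t z).mul (hch c hc d hd))))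
    rw [show (∑ c ∈ Su, ∑ d ∈ Sv, ∫ ξ in B, stretch (W z) c *
        ((starRingEnd ℂ) d * Complex.exp (W z * (Real.log ‖d‖ : ℂ))) * (radialSymbol σ t z ξ *
        (levelFourier u c ξ * (starRingEnd ℂ) (levelFourier v d ξ)))) = ∑ c ∈ Su, ∫ ξ in B,
        ∑ d ∈ Sv, stretch (W z) c *
        ((starRingEnd ℂ) d * Complex.exp (W z * (Real.log ‖d‖ : ℂ))) * (radialSymbol σ t z ξ *
        (levelFourier u c ξ * (starRingEnd ℂ) (levelFourier v d ξ))) from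
      Finset.sum_congr rfl fun c hc => (integral_finsetSum _ (hint c hc)).symm,
      ← integral_finsetSum _ fun c hc => integrable_finsetSum _ (hint c hc)]
    refine integral_congr_ae (Filter.Eventually.of_forall fun ξ => ?_)
    simp only [fourier_map_stretch hu, fourier_map_stretch hv, map_sum, map_mul, ← hWc,
      conj_stretch]
    rw [mul_assoc, Finset.sum_mul_sum, Finset.mul_sum]
    refine Finset.sum_congr rfl fun c _ => ?_
    rw [Finset.mul_sum]
    refine Finset.sum_congr rfl fun d _ => ?_
    ring
  -- The Gaussian factor absorbs the growth |z|² on Re z = 1. It has modulus at most 1 on Re z = 0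
  -- and at least 1 at the real point θ.
  set F : ℂ → ℂ := fun z => Complex.exp (z ^ 2) * Φ z with hF
  have hWd : Differentiable ℂ W := by simp only [hW]; fun_prop
  have hFd : Differentiable ℂ F := by
    simp only [hF, hΦsum, stretch]
    refine Differentiable.mul (by fun_prop) ?_
    refine Differentiable.fun_sum fun c hc => Differentiable.fun_sum fun d hd => ?_
    exact (((differentiable_const _).mul (hWd.mul_const _).cexp).mul
      ((differentiable_const _).mul (hWd.mul_const _).cexp)).mul (hGd c hc d hd)
  have hFb : BddAbove ((norm ∘ F) '' Complex.HadamardThreeLines.verticalClosedStrip 0 1) := by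
    refine ⟨Real.exp 1 * ∑ c ∈ Su, ∑ d ∈ Sv, (‖c‖ * Real.exp (2 * |Real.log ‖c‖|)) *
      (‖d‖ * Real.exp (2 * |Real.log ‖d‖|)) *
      ∫ ξ in B, ‖levelFourier u c ξ * (starRingEnd ℂ) (levelFourier v d ξ)‖, ?_⟩
    rintro _ ⟨z, hz, rfl⟩
    have hz : 0 ≤ z.re ∧ z.re ≤ 1 := hz
    have hWb : |(W z).re| ≤ 2 := by
      have := hWre z
      rw [abs_le]
      constructor <;> nlinarith
    have hexp : ∀ c : ℂ, ‖Complex.exp (W z * (Real.log ‖c‖ : ℂ))‖ ≤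
        Real.exp (2 * |Real.log ‖c‖|) := by
      intro c
      rw [Complex.norm_exp, Complex.re_mul_ofReal]
      refine Real.exp_le_exp.2 ((le_abs_self _).trans ?_)
      rw [abs_mul]
      exact mul_le_mul_of_nonneg_right hWb (abs_nonneg _)
    simp only [Function.comp, hF, norm_mul, norm_cexp_sq]
    refine mul_le_mul (Real.exp_le_exp.2 (by nlinarith [sq_nonneg z.im])) ?_ (norm_nonneg _)
      (Real.exp_pos _).le
    rw [hΦsum]
    refine (norm_sum_le _ _).trans (Finset.sum_le_sum fun c hc => (norm_sum_le _ _).trans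
      (Finset.sum_le_sum fun d hd => ?_))
    rw [norm_mul, norm_mul, norm_mul, stretch, norm_mul, RCLike.norm_conj]
    have hGb : ‖G c d z‖ ≤
        ∫ ξ in B, ‖levelFourier u c ξ * (starRingEnd ℂ) (levelFourier v d ξ)‖ := by
      refine norm_integral_le_of_norm_le
        ((hch c hc d hd).norm.continuousOn.integrableOn_compact (isCompact_closedBall _ _))
        (Filter.Eventually.of_forall fun ξ => ?_)
      rw [norm_mul]
      exact mul_le_of_le_one_left (norm_nonneg _) (norm_radialSymbol_le_one σ t hz.1 ξ)
    gcongr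
    · exact hexp c
    · exact hexp d
    · simpa only [norm_mul] using hGb
  set U := ∫ x, ‖u x‖ ^ q with hU
  set V := ∫ x, ‖v x‖ ^ q with hV
  have hU0 : 0 ≤ U := integral_nonneg fun x => by positivity
  have hV0 : 0 ≤ V := integral_nonneg fun x => by positivity
  have hre0 : ∀ z : ℂ, z.re = 0 → ∀ c, ‖stretch (W z) c‖ ^ (2 : ℝ) = ‖c‖ ^ q := by
    intro z hz c
    have h1 : 1 + (W z).re = q / 2 := by rw [hWre, hz]; ring
    rw [norm_stretch _ _ (by rw [h1]; positivity), h1, ← Real.rpow_mul (norm_nonneg _)]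
    congr 1; ring
  have hre1 : ∀ z : ℂ, z.re = 1 → ∀ c, ‖stretch (W z) c‖ = ‖c‖ ^ q := by
    intro z hz c
    have h1 : 1 + (W z).re = q := by rw [hWre, hz]; ring
    rw [norm_stretch _ _ (by rw [h1]; positivity), h1]
  have memL2 : ∀ {s : SimpleFunc R3 ℂ}, Integrable s volume → ∀ w,
      MemLp (s.map (stretch w)) 2 volume := fun hs w =>
    (SimpleFunc.memLp_iff_integrable two_ne_zero (by norm_num)).2 (integrable_map_stretch hs w)
  have h0 : ∀ z ∈ Complex.re ⁻¹' {(0 : ℝ)}, ‖F z‖ ≤ (U * V) ^ (1 / 2 : ℝ) := by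
    intro z hz
    have hz : z.re = 0 := hz
    have hz' : ((starRingEnd ℂ) z).re = 0 := by rw [Complex.conj_re, hz]
    have key := norm_setIntegral_mul_fourier_le (continuous_radialSymbol hσ₂ t z)
      (norm_radialSymbol_le_one σ t hz.ge) (integrable_map_stretch hu (W z)) (memL2 hu (W z))
      (integrable_map_stretch hv (W ((starRingEnd ℂ) z))) (memL2 hv (W ((starRingEnd ℂ) z))) hBm
    rw [norm_toLp_eq_rpow, norm_toLp_eq_rpow] at key
    simp only [SimpleFunc.map_apply, hre0 z hz, hre0 _ hz'] at key
    rw [← Real.mul_rpow hU0 hV0] at key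
    simp only [hF, norm_mul, norm_cexp_sq, hz]
    refine (mul_le_of_le_one_left (norm_nonneg _) ?_).trans key
    rw [Real.exp_le_one_iff]
    nlinarith [sq_nonneg z.im]
  have h1 : ∀ z ∈ Complex.re ⁻¹' {(1 : ℝ)}, ‖F z‖ ≤ 3 * D * (U * V) := by
    intro z hz
    have hz : z.re = 1 := hz
    have hz' : ((starRingEnd ℂ) z).re = 1 := by rw [Complex.conj_re, hz]
    have hmi : Integrable (B.indicator (radialSymbol σ t z)) := by
      rw [integrable_indicator_iff hBm]
      exact (continuous_radialSymbol hσ₂ t z).continuousOn.integrableOn_compact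
        (isCompact_closedBall _ _)
    have key := norm_integral_mul_fourier_mul_conj_le hmi (integrable_map_stretch hu (W z))
      (integrable_map_stretch hv (W ((starRingEnd ℂ) z))) (hD z hz)
    simp only [SimpleFunc.map_apply, hre1 z hz, hre1 _ hz'] at key
    have e : ∫ ξ, B.indicator (radialSymbol σ t z) ξ * 𝓕 (⇑(u.map (stretch (W z)))) ξ *
        (starRingEnd ℂ) (𝓕 (⇑(v.map (stretch (W ((starRingEnd ℂ) z))))) ξ) = Φ z := by
      simp only [hΦ]
      rw [← integral_indicator hBm]
      refine integral_congr_ae (Filter.Eventually.of_forall fun ξ => ?_)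
      by_cases h : ξ ∈ B <;> simp [h]
    rw [e] at key
    simp only [hF, norm_mul, norm_cexp_sq, hz]
    have hn : ‖z‖ ^ 2 = 1 + z.im ^ 2 := by
      rw [← Complex.normSq_eq_norm_sq, Complex.normSq_apply, hz]; ring
    -- With y = Im z this is e^{1 - y²}(1 + y²) ≤ e ≤ 3, the origin of the factor 3 in front of D.
    have hexp : Real.exp (1 ^ 2 - z.im ^ 2) * ‖z‖ ^ 2 ≤ 3 := by
      have h2 : 1 + z.im ^ 2 ≤ Real.exp (z.im ^ 2) := by
        linarith [Real.add_one_le_exp (z.im ^ 2)]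
      rw [hn]
      calc Real.exp (1 ^ 2 - z.im ^ 2) * (1 + z.im ^ 2)
          ≤ Real.exp (1 ^ 2 - z.im ^ 2) * Real.exp (z.im ^ 2) := by gcongr
        _ = Real.exp 1 := by rw [← Real.exp_add]; congr 1; ring
        _ ≤ 3 := Real.exp_one_lt_three.le
    calc Real.exp (1 ^ 2 - z.im ^ 2) * ‖Φ z‖
        ≤ Real.exp (1 ^ 2 - z.im ^ 2) * (D * ‖z‖ ^ 2 * U * V) := by gcongr
      _ = (Real.exp (1 ^ 2 - z.im ^ 2) * ‖z‖ ^ 2) * (D * (U * V)) := by ring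
      _ ≤ 3 * (D * (U * V)) := by gcongr
      _ = _ := by ring
  have three := Complex.HadamardThreeLines.norm_le_interp_of_mem_verticalClosedStrip₀₁' F
    (z := (θ : ℂ)) (show ((θ : ℂ)).re ∈ Icc (0 : ℝ) 1 by simpa using ⟨hθ₀, hθ₁⟩)
    hFd.diffContOnCl hFb h0 h1
  rw [Complex.ofReal_re] at three
  have hWθ : W θ = 0 := by
    simp only [hW, hq]
    have : (1 + θ : ℂ) ≠ 0 := by exact_mod_cast (by linarith : (1 + θ) ≠ 0)
    push_cast
    field_simp
    ring
  have hmap : ∀ s : SimpleFunc R3 ℂ, s.map (stretch 0) = s := fun s => by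
    ext x
    rw [SimpleFunc.map_apply, stretch_zero_left]
  have hΦθ : Φ θ = ∫ ξ in B, radialSymbol σ t θ ξ * 𝓕 (⇑u) ξ * (starRingEnd ℂ) (𝓕 (⇑v) ξ) := by
    simp only [hΦ, Complex.conj_ofReal, hWθ, hmap]
  rw [← hΦθ]
  have hge : ‖Φ θ‖ ≤ ‖F θ‖ := by
    simp only [hF, norm_mul, norm_cexp_sq]
    refine le_mul_of_one_le_left (norm_nonneg _) (Real.one_le_exp ?_)
    simp [sq_nonneg]
  refine hge.trans (three.trans (le_of_eq ?_))
  have hUV : 0 ≤ U * V := mul_nonneg hU0 hV0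
  -- The powers of UV combine as (1 - θ)/2 + θ = (1 + θ)/2.
  rw [Real.mul_rpow (by positivity) hUV, ← Real.rpow_mul hUV, mul_left_comm,
    ← Real.rpow_add_of_nonneg hUV (by linarith) hθ₀]
  congr 2
  ring

end ComplexInterpolation

/-! ### Duality, removal of the cutoff, and the estimate for t ≥ 1. -/

section LpDuality

open Filter Topology

/-- The standard simple approximations of g converge in L² and in L^q at the same time, so the bound
passes to the limit. -/
lemma norm_inner_toLp_le_of_simple {q : ℝ≥0∞} [Fact (1 ≤ q)] (hq : q ≠ ∞) {h : SqInt} {M : ℝ}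
    (H : ∀ (u : SimpleFunc R3 ℂ) (hu : MemLp u 2 volume),
      ‖inner ℂ (hu.toLp u) h‖ ≤ M * (eLpNorm u q volume).toReal)
    {g : R3 → ℂ} (hgm : Measurable g) (hg : MemLp g 2 volume) (hgq : MemLp g q volume) :
    ‖inner ℂ (hg.toLp g) h‖ ≤ M * (eLpNorm g q volume).toReal := by
  have t1 := SimpleFunc.tendsto_approxOn_range_Lp (by norm_num) hgm hg
  have t2 := (SimpleFunc.tendsto_approxOn_range_Lp hq hgm hgq).norm
  simp only [Lp.norm_toLp] at t2
  exact le_of_tendsto_of_tendsto' (t1.inner tendsto_const_nhds).norm (t2.const_mul M)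
    fun n => H _ _

/-- The converse of Hölder's inequality, for square integrable functions tested against simple
functions. -/
lemma eLpNorm_le_of_norm_inner_simple_le {p q : ℝ} (hpq : p.HolderConjugate q) (hp : 2 ≤ p)
    {h : SqInt} {M : ℝ} (hM : 0 ≤ M) (H : ∀ (u : SimpleFunc R3 ℂ) (hu : MemLp u 2 volume),
      ‖inner ℂ (hu.toLp u) h‖ ≤ M * (eLpNorm u (ENNReal.ofReal q) volume).toReal) :
    eLpNorm h (ENNReal.ofReal p) volume ≤ ENNReal.ofReal M := by
  have hq1 : 1 ≤ q := hpq.symm.lt.le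
  have hp0 : 0 < p := by linarith
  have hq0 : 0 < q := by linarith
  have : Fact (1 ≤ ENNReal.ofReal q) := ⟨by simpa using ENNReal.ofReal_le_ofReal hq1⟩
  have hh : MemLp h 2 volume := Lp.memLp h
  have hhm : Measurable h := (Lp.stronglyMeasurable h).measurable
  -- Where |h| ≤ n, the power |h|^p is at most n^{p-2}|h|² and hence integrable. This makes the
  -- extremal function |h|^{p-2}h, restricted to this set, an admissible test function.
  set A : ℕ → Set R3 := fun n => {x | ‖h x‖ ≤ n} with hA
  have hAm : ∀ n, MeasurableSet (A n) := fun n => measurableSet_le hhm.norm measurable_const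
  set g : ℕ → R3 → ℂ := fun n => (A n).indicator fun x => ((‖h x‖ ^ (p - 2) : ℝ) : ℂ) * h x with hg
  have hgm : ∀ n, Measurable (g n) := fun n => by
    refine Measurable.indicator ?_ (hAm n)
    fun_prop
  have hgn : ∀ n x, ‖g n x‖ = (A n).indicator (fun x => ‖h x‖ ^ (p - 1)) x := by
    intro n x
    by_cases hx : x ∈ A n
    · simp only [hg, Set.indicator_of_mem hx, norm_mul, Complex.norm_real]
      rw [Real.norm_of_nonneg (by positivity), show p - 1 = p - 2 + 1 by ring,
        Real.rpow_add_one' (norm_nonneg _) (by linarith)]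
    · simp [hg, hx]
  set J : ℕ → R3 → ℝ := fun n => (A n).indicator fun x => ‖h x‖ ^ p with hJ
  have hJ0 : ∀ n x, 0 ≤ J n x := fun n x => Set.indicator_nonneg (fun _ _ => by positivity) _
  have hgJ : ∀ n x, ‖g n x‖ ^ q = J n x := by
    intro n x
    rw [hgn]
    by_cases hx : x ∈ A n
    · simp only [hJ, Set.indicator_of_mem hx]
      rw [← Real.rpow_mul (norm_nonneg _), hpq.sub_one_mul_conj]
    · simp [hJ, hx, hq0.ne']
  have hhJ : ∀ n x, ‖(A n).indicator h x‖ ^ p = J n x := by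
    intro n x
    by_cases hx : x ∈ A n <;> simp [hJ, hx, hp0.ne']
  have hJi : ∀ n, Integrable (J n) volume := by
    intro n
    refine (((memLp_two_iff_integrable_sq_norm hh.1).1 hh).const_mul ((n : ℝ) ^ (p - 2))).mono'
      ((Measurable.indicator (by fun_prop) (hAm n)).aestronglyMeasurable)
      (Eventually.of_forall fun x => ?_)
    rw [Real.norm_of_nonneg (hJ0 n x)]
    by_cases hx : x ∈ A n
    · simp only [hJ, Set.indicator_of_mem hx]
      rw [show p = p - 2 + 2 by ring, Real.rpow_add_of_nonneg (norm_nonneg _) (by linarith)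
        (by norm_num), Real.rpow_two, add_sub_cancel_right]
      gcongr
      exact hx
    · simp only [hJ, Set.indicator_of_notMem hx]
      positivity
  have hg2 : ∀ n, MemLp (g n) 2 volume := by
    intro n
    refine hh.of_le_mul (c := (n : ℝ) ^ (p - 2)) (hgm n).aestronglyMeasurable
      (Eventually.of_forall fun x => ?_)
    by_cases hx : x ∈ A n
    · simp only [hg, Set.indicator_of_mem hx, norm_mul, Complex.norm_real]
      rw [Real.norm_of_nonneg (by positivity)]
      gcongr
      exact hx
    · simp only [hg, Set.indicator_of_notMem hx, norm_zero]
      positivity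
  have hgq : ∀ n, MemLp (g n) (ENNReal.ofReal q) volume := by
    intro n
    rw [← integrable_norm_rpow_iff (hgm n).aestronglyMeasurable (by simpa using hq0) (by simp),
      ENNReal.toReal_ofReal hq0.le]
    simpa only [hgJ] using hJi n
  have hhp : ∀ n, MemLp ((A n).indicator h) (ENNReal.ofReal p) volume := by
    intro n
    rw [← integrable_norm_rpow_iff (hhm.indicator (hAm n)).aestronglyMeasurable
      (by simpa using hp0) (by simp), ENNReal.toReal_ofReal hp0.le]
    simpa only [hhJ] using hJi n
  have bound : ∀ n, eLpNorm ((A n).indicator h) (ENNReal.ofReal p) volume ≤ ENNReal.ofReal M := by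
    intro n
    have key := norm_inner_toLp_le_of_simple (by simp) H (hgm n) (hg2 n) (hgq n)
    have e : inner ℂ ((hg2 n).toLp (g n)) h = ((∫ x, J n x : ℝ) : ℂ) := by
      rw [L2.inner_def, ← integral_complex_ofReal]
      refine integral_congr_ae ?_
      filter_upwards [(hg2 n).coeFn_toLp] with x hx
      rw [hx, RCLike.inner_apply]
      by_cases hxA : x ∈ A n
      · simp only [hg, hJ, Set.indicator_of_mem hxA, map_mul, Complex.conj_ofReal]
        rw [mul_left_comm, mul_comm (h x), ← Complex.normSq_eq_conj_mul_self,
          Complex.normSq_eq_norm_sq, ← Complex.ofReal_mul, ← Real.rpow_two,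
          ← Real.rpow_add_of_nonneg (norm_nonneg _) (by linarith) (by norm_num), sub_add_cancel]
      · simp [hg, hJ, hxA]
    have hI : 0 ≤ ∫ x, J n x := integral_nonneg (hJ0 n)
    rw [e, Complex.norm_real, Real.norm_of_nonneg hI,
      (hgq n).eLpNorm_eq_integral_rpow_norm (by simpa using hq0) (by simp),
      ENNReal.toReal_ofReal hq0.le] at key
    simp only [hgJ] at key
    rw [ENNReal.toReal_ofReal (by positivity)] at key
    rw [(hhp n).eLpNorm_eq_integral_rpow_norm (by simpa using hp0) (by simp),
      ENNReal.toReal_ofReal hp0.le]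
    simp only [hhJ]
    refine ENNReal.ofReal_le_ofReal ?_
    -- The test gives J ≤ M J^{1/q} for J = ∫|h|^p over the set; dividing by J^{1/q} requires J > 0.
    rcases hI.eq_or_lt with h0 | hpos
    · rw [← h0, Real.zero_rpow (by positivity)]
      exact hM
    · have h1 : (∫ x, J n x) = (∫ x, J n x) ^ p⁻¹ * (∫ x, J n x) ^ q⁻¹ := by
        rw [← Real.rpow_add hpos, hpq.inv_add_inv_eq_one, Real.rpow_one]
      nth_rw 1 [h1] at key
      exact le_of_mul_le_mul_right key (by positivity)
  -- Fatou's lemma removes the truncation.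
  refine (Lp.eLpNorm_lim_le_liminf_eLpNorm (f := fun n => (A n).indicator h)
    (fun n => (hhm.indicator (hAm n)).aestronglyMeasurable) h (Eventually.of_forall fun x => ?_)).trans
    (liminf_le_of_le (by isBoundedDefault) fun b hb => ?_)
  · obtain ⟨N, hN⟩ := exists_nat_ge ‖h x‖
    refine tendsto_const_nhds.congr' ?_
    filter_upwards [eventually_ge_atTop N] with n hn
    rw [Set.indicator_of_mem]
    exact hN.trans (by exact_mod_cast hn)
  · obtain ⟨n, hn⟩ := hb.exists
    exact hn.trans (bound n)

lemma memLp_radialSymbol {σ : ℝ} (hσ₂ : σ < 2) (t : ℝ) {z : ℂ} (hz : 0 ≤ z.re) :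
    MemLp (radialSymbol σ t z) ∞ (volume : Measure R3) :=
  memLp_top_of_bound (continuous_radialSymbol hσ₂ t z).aestronglyMeasurable 1
    (Eventually.of_forall (norm_radialSymbol_le_one σ t hz))

/-- The interpolated bound does not depend on R, so the balls may exhaust the space. The kernel
bound is needed only for large R. -/
lemma norm_inner_fourierMul_radialSymbol_le {σ : ℝ} (hσ₂ : σ < 2) {t D R₀ θ q : ℝ}
    (hq : q = 2 / (1 + θ)) (hθ₀ : 0 ≤ θ)
    (hθ₁ : θ ≤ 1) (hD0 : 0 ≤ D) (hD : ∀ R, R₀ ≤ R → ∀ z : ℂ, z.re = 1 → ∀ x : R3,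
      ‖𝓕 ((Metric.closedBall (0 : R3) R).indicator (radialSymbol σ t z)) x‖ ≤ D * ‖z‖ ^ 2)
    (hm : MemLp (radialSymbol σ t θ) ∞ (volume : Measure R3))
    {u v : SimpleFunc R3 ℂ} (hu : MemLp u 2 volume) (hv : MemLp v 2 volume) :
    ‖inner ℂ (hv.toLp v) (fourierMul hm (hu.toLp u))‖ ≤
      (3 * D) ^ θ * (eLpNorm u (ENNReal.ofReal q) volume).toReal *
        (eLpNorm v (ENNReal.ofReal q) volume).toReal := by
  have hq0 : 0 < q := by rw [hq]; positivity
  have hu1 := (SimpleFunc.memLp_iff_integrable two_ne_zero (by norm_num)).1 hu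
  have hv1 := (SimpleFunc.memLp_iff_integrable two_ne_zero (by norm_num)).1 hv
  have huq : MemLp u (ENNReal.ofReal q) volume :=
    (SimpleFunc.memLp_iff_integrable (by simpa using hq0) (by simp)).2 hu1
  have hvq : MemLp v (ENNReal.ofReal q) volume :=
    (SimpleFunc.memLp_iff_integrable (by simpa using hq0) (by simp)).2 hv1
  have hae : (fun ξ => radialSymbol σ t θ ξ * (𝓕 (hu.toLp u) : SqInt) ξ *
      (starRingEnd ℂ) ((𝓕 (hv.toLp v) : SqInt) ξ)) =ᵐ[volume] fun ξ =>
      radialSymbol σ t θ ξ * 𝓕 (⇑u) ξ * (starRingEnd ℂ) (𝓕 (⇑v) ξ) := by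
    filter_upwards [coeFn_fourier_toLp hu1 hu, coeFn_fourier_toLp hv1 hv] with ξ h1 h2
    rw [h1, h2]
  have hint := (integrable_fourierMul hm (hu.toLp u) (hv.toLp v)).congr hae
  have hlim := (aecover_closedBall (x := (0 : R3)) tendsto_id (μ := volume)
    ).integral_tendsto_of_countably_generated hint
  rw [inner_fourierMul, integral_congr_ae hae]
  refine le_of_tendsto hlim.norm ?_
  filter_upwards [eventually_ge_atTop R₀] with R hR
  refine (norm_setIntegral_radialSymbol_le hσ₂ hθ₀ hθ₁ hD0 (hD R hR) hu1 hv1).trans (le_of_eq ?_)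
  rw [← hq, show (1 + θ) / 2 = q⁻¹ by rw [hq, inv_div], Real.mul_rpow
    (integral_nonneg fun x => by positivity) (integral_nonneg fun x => by positivity), ← mul_assoc,
    huq.eLpNorm_eq_integral_rpow_norm (by simpa using hq0) (by simp),
    hvq.eLpNorm_eq_integral_rpow_norm (by simpa using hq0) (by simp),
    ENNReal.toReal_ofReal hq0.le, ENNReal.toReal_ofReal (by positivity),
    ENNReal.toReal_ofReal (by positivity)]

/-- Interpolation at θ = 1 - 2/p raises the kernel bound to the power θ. -/
lemma kernelRate_mul (σ p : ℝ) : kernelRate σ * (1 - 2 / p) = decayRate σ p := by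
  unfold kernelRate decayRate
  split_ifs <;> ring

/-- The dispersive estimate for large times, for simple functions. -/
lemma exists_eLpNorm_fourierMul_radialSymbol_le {σ : ℝ} (hσ₀ : 0 < σ) (hσ₂ : σ < 2) {p q : ℝ}
    (hpq : p.HolderConjugate q) (hp : 2 ≤ p) : ∃ K : ℝ, 0 ≤ K ∧ ∀ t : ℝ, 1 ≤ t →
      ∀ (hm : MemLp (radialSymbol σ t (1 - 2 / p : ℝ)) ∞ (volume : Measure R3))
        (u : SimpleFunc R3 ℂ) (hu : MemLp u 2 volume),
      eLpNorm (fourierMul hm (hu.toLp u)) (ENNReal.ofReal p) volume ≤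
        ENNReal.ofReal (K * t ^ (-decayRate σ p)) * eLpNorm u (ENNReal.ofReal q) volume := by
  obtain ⟨C, R₁, hC, hker⟩ := exists_norm_fourier_radialSymbol_le hσ₀ hσ₂
  have hp0 : 0 < p := by linarith
  have hq0 : 0 < q := hpq.symm.pos
  have hθ₀ : 0 ≤ 1 - 2 / p := by rw [sub_nonneg, div_le_one hp0]; exact hp
  have hθ₁ : 1 - 2 / p ≤ 1 := by linarith [show 0 ≤ 2 / p by positivity]
  have hq : q = 2 / (1 + (1 - 2 / p)) := by
    have := hpq.inv_add_inv_eq_one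
    rw [show 1 + (1 - 2 / p) = 2 * (1 - p⁻¹) by ring, ← this, add_sub_cancel_left]
    field_simp
  refine ⟨(3 * C) ^ (1 - 2 / p), by positivity, fun t ht hm u hu => ?_⟩
  have ht0 : 0 < t := by linarith
  have huq : MemLp u (ENNReal.ofReal q) volume :=
    (SimpleFunc.memLp_iff_integrable (by simpa using hq0) (by simp)).2
      ((SimpleFunc.memLp_iff_integrable two_ne_zero (by norm_num)).1 hu)
  rw [← ENNReal.ofReal_toReal huq.eLpNorm_ne_top, ← ENNReal.ofReal_mul (by positivity)]
  refine eLpNorm_le_of_norm_inner_simple_le hpq hp (by positivity) fun v hv => ?_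
  refine (norm_inner_fourierMul_radialSymbol_le hσ₂ hq hθ₀ hθ₁ (D := C * t ^ (-kernelRate σ))
    (R₀ := max t R₁) (by positivity) (fun R hR z hz x => ?_) hm hu hv).trans (le_of_eq ?_)
  · refine (hker t R z ht ((le_max_left _ _).trans hR) ((le_max_right _ _).trans hR) hz x).trans_eq ?_
    ring
  · rw [← mul_assoc 3 C, Real.mul_rpow (by positivity) (by positivity), ← Real.rpow_mul ht0.le,
      neg_mul, kernelRate_mul]

end LpDuality

/-! ### Sobolev embedding by a frequency splitting that depends on the level. -/

section SobolevEmbedding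

open Filter Topology Set

lemma integrableOn_ball_norm_rpow {b : ℝ} (hb : b < 3) (A : ℝ) :
    IntegrableOn (fun ξ : R3 => ‖ξ‖ ^ (-b)) (Metric.ball 0 A) := by
  rw [integrableOn_fun_norm_addHaar volume (f := fun y : ℝ => y ^ (-b))]
  refine (((intervalIntegral.intervalIntegrable_rpow' (a := 0) (b := A)
    (show -1 < 2 - b by linarith)).1).mono_set Ioo_subset_Ioc_self).congr_fun (fun y hy => ?_)
    measurableSet_Ioo
  simp only [finrank_euclideanSpace, Fintype.card_fin, smul_eq_mul]
  rw [← Real.rpow_natCast, ← Real.rpow_add hy.1]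
  norm_num [sub_eq_add_neg]

lemma setIntegral_ball_norm_rpow {b : ℝ} (hb : b < 3) {A : ℝ} (hA : 0 ≤ A) :
    ∫ ξ in Metric.ball (0 : R3) A, ‖ξ‖ ^ (-b) =
      3 * volume.real (Metric.ball (0 : R3) 1) / (3 - b) * A ^ (3 - b) := by
  have e : ∀ ξ : R3, (Metric.ball (0 : R3) A).indicator (fun ξ : R3 => ‖ξ‖ ^ (-b)) ξ =
      (Iio A).indicator (fun y => y ^ (-b)) ‖ξ‖ := by
    intro ξ
    simp [indicator]
  rw [← integral_indicator measurableSet_ball, integral_congr_ae (Eventually.of_forall e),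
    integral_fun_norm_addHaar volume ((Iio A).indicator fun y : ℝ => y ^ (-b))]
  have e2 : ∫ y in Ioi (0 : ℝ), y ^ (Module.finrank ℝ R3 - 1) •
      (Iio A).indicator (fun y => y ^ (-b)) y = A ^ (3 - b) / (3 - b) := by
    calc _ = ∫ y in Ioi (0 : ℝ), (Iio A).indicator (fun y => y ^ (2 - b)) y := by
          refine setIntegral_congr_fun measurableSet_Ioi fun y hy => ?_
          have hy : 0 < y := hy
          by_cases h : y ∈ Iio A
          · simp only [indicator_of_mem h, finrank_euclideanSpace, Fintype.card_fin, smul_eq_mul]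
            rw [← Real.rpow_natCast, ← Real.rpow_add hy]
            norm_num [sub_eq_add_neg]
          · simp [indicator_of_notMem h]
      _ = ∫ y in (0 : ℝ)..A, y ^ (2 - b) := by
          rw [setIntegral_indicator measurableSet_Iio, Ioi_inter_Iio,
            intervalIntegral.integral_of_le hA, integral_Ioc_eq_integral_Ioo]
      _ = _ := by
          rw [integral_rpow (Or.inl (by linarith)), show 2 - b + 1 = 3 - b by ring,
            Real.zero_rpow (by linarith), sub_zero]
  rw [e2]
  simp only [finrank_euclideanSpace, Fintype.card_fin, nsmul_eq_mul, smul_eq_mul]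
  push_cast
  ring

lemma norm_eq_rpow_integral (v : SqInt) : ‖v‖ = (∫ x, ‖v x‖ ^ (2 : ℝ)) ^ (1 / 2 : ℝ) := by
  rw [← norm_toLp_eq_rpow (Lp.memLp v), Lp.toLp_coeFn]

lemma ae_ne_zero : ∀ᵐ ξ : R3, ξ ≠ 0 := by
  rw [ae_iff]
  simp

/-- Cauchy–Schwarz for the low frequencies. -/
lemma integral_indicator_ball_mul_le {a : ℝ} (ha : a < 3 / 2) {m : R3 → ℂ}
    (hm : MemLp m ∞ (volume : Measure R3)) (hma : ∀ ξ, ‖m ξ‖ * ‖ξ‖ ^ a ≤ 1) (v : SqInt) {A : ℝ}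
    (hA : 0 ≤ A) :
    Integrable ((Metric.ball (0 : R3) A).indicator fun ξ => m ξ * v ξ) ∧
    ∫ ξ, ‖(Metric.ball (0 : R3) A).indicator (fun ξ => m ξ * v ξ) ξ‖ ≤
      (3 * volume.real (Metric.ball (0 : R3) 1) / (3 - 2 * a) * A ^ (3 - 2 * a)) ^ (1 / 2 : ℝ) *
        ‖v‖ := by
  have hb : 2 * a < 3 := by linarith
  set B := Metric.ball (0 : R3) A with hB
  have hBm : MeasurableSet B := measurableSet_ball
  have hm2 : MemLp (B.indicator m) 2 volume := by
    rw [memLp_indicator_iff_restrict hBm]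
    have : IsFiniteMeasure (volume.restrict B) :=
      ⟨by rw [Measure.restrict_apply_univ]; exact measure_ball_lt_top⟩
    exact (hm.restrict B).mono_exponent le_top
  have hm2' : MemLp (B.indicator m) (ENNReal.ofReal 2) volume := by simpa using hm2
  have hv2 : MemLp v (ENNReal.ofReal 2) volume := by simpa using Lp.memLp v
  have e : ∀ ξ, B.indicator (fun ξ => m ξ * v ξ) ξ = B.indicator m ξ * v ξ := by
    intro ξ
    by_cases h : ξ ∈ B <;> simp [h]
  refine ⟨?_, ?_⟩
  · rw [show B.indicator (fun ξ => m ξ * v ξ) = B.indicator m * v from funext e]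
    exact hm2.integrable_mul (Lp.memLp v)
  · simp only [e, norm_mul]
    have hmi : ∫ ξ, ‖B.indicator m ξ‖ ^ (2 : ℝ) ≤ ∫ ξ in B, ‖ξ‖ ^ (-(2 * a)) := by
      rw [← integral_indicator hBm]
      refine integral_mono_ae ?_ ((integrable_indicator_iff hBm).2
        (integrableOn_ball_norm_rpow hb A)) ?_
      · have := (memLp_two_iff_integrable_sq_norm hm2.1).1 hm2
        simpa only [Real.rpow_two] using this
      · filter_upwards [ae_ne_zero] with ξ hξ
        by_cases h : ξ ∈ B
        · simp only [indicator_of_mem h, Real.rpow_two]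
          have hξ : 0 < ‖ξ‖ := norm_pos_iff.2 hξ
          rw [Real.rpow_neg hξ.le, mul_comm 2 a, Real.rpow_mul hξ.le, Real.rpow_two, ← inv_pow]
          gcongr
          rw [← one_div, le_div_iff₀ (by positivity)]
          exact hma ξ
        · simp [indicator_of_notMem h]
    refine (integral_mul_norm_le_Lp_mul_Lq Real.HolderConjugate.two_two hm2' hv2).trans ?_
    rw [norm_eq_rpow_integral v, ← setIntegral_ball_norm_rpow hb hA]
    gcongr

/-- The distribution function of `fourierMul hm u`, in terms of the high frequencies. -/
lemma mul_measure_lt_norm_fourierMul_le {a : ℝ} (ha : a < 3 / 2) {m : R3 → ℂ}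
    (hm : MemLp m ∞ (volume : Measure R3)) (hma : ∀ ξ, ‖m ξ‖ * ‖ξ‖ ^ a ≤ 1) (u : SqInt) {A l : ℝ}
    (hA : 0 ≤ A) (hl : 0 < l)
    (hAl : (3 * volume.real (Metric.ball (0 : R3) 1) / (3 - 2 * a) * A ^ (3 - 2 * a)) ^ (1 / 2 : ℝ)
      * ‖u‖ ≤ l / 2) :
    ENNReal.ofReal ((l / 2) ^ 2) * volume {x | l < ‖fourierMul hm u x‖} ≤
      ∫⁻ ξ in (Metric.ball (0 : R3) A)ᶜ, ‖m ξ * (𝓕 u : SqInt) ξ‖ₑ ^ (2 : ℝ) := by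
  set v : SqInt := 𝓕 u with hv
  set B := Metric.ball (0 : R3) A with hB
  have hBm : MeasurableSet B := measurableSet_ball
  have hnv : ‖v‖ = ‖u‖ := Lp.norm_fourier_eq u
  have hmv : MemLp (fun ξ => m ξ * v ξ) 2 volume := (Lp.memLp v).mul' hm
  have hlo := hmv.indicator hBm
  have hhi := hmv.indicator hBm.compl
  obtain ⟨hi, hn⟩ := integral_indicator_ball_mul_le ha hm hma v hA
  have hsum : (fourierMul hm u : SqInt) = (𝓕⁻ (hlo.toLp _) : SqInt) + (𝓕⁻ (hhi.toLp _) : SqInt) := by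
    have e1 : (𝓕⁻ (hlo.toLp _ + hhi.toLp _) : SqInt) =
        (𝓕⁻ (hlo.toLp _) : SqInt) + (𝓕⁻ (hhi.toLp _) : SqInt) :=
      (Lp.fourierTransformₗᵢ R3 ℂ).symm.map_add _ _
    rw [← e1, fourierMul]
    congr 1
    refine Lp.ext ?_
    filter_upwards [Lp.coeFn_lpSMul (r := 2) (hm.toLp m) v, hm.coeFn_toLp,
      Lp.coeFn_add (hlo.toLp _) (hhi.toLp _), hlo.coeFn_toLp, hhi.coeFn_toLp] with ξ h1 h2 h3 h4 h5
    rw [h1, Pi.smul_apply', h2, smul_eq_mul, h3, Pi.add_apply, h4, h5]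
    by_cases h : ξ ∈ B <;> simp [h]
  have hsub : volume {x | l < ‖fourierMul hm u x‖} ≤
      volume {x | ENNReal.ofReal (l / 2) ≤ ‖(𝓕⁻ (hhi.toLp _) : SqInt) x‖₊} := by
    -- The low frequencies contribute at most l/2 pointwise, so |·| > l forces the high frequencies
    -- above l/2. Chebyshev's inequality in L² then applies to them.
    refine measure_mono_ae ?_
    filter_upwards [ae_norm_fourierInv_toLp_le hi hlo,
      Lp.coeFn_add (𝓕⁻ (hlo.toLp _) : SqInt) (𝓕⁻ (hhi.toLp _) : SqInt)] with x h1 h2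
    intro hx
    have hx : l < ‖fourierMul hm u x‖ := hx
    rw [hsum, h2, Pi.add_apply] at hx
    change ENNReal.ofReal (l / 2) ≤ _
    rw [← enorm_eq_nnnorm, ← ofReal_norm]
    refine ENNReal.ofReal_le_ofReal ?_
    have := norm_add_le ((𝓕⁻ (hlo.toLp _) : SqInt) x) ((𝓕⁻ (hhi.toLp _) : SqInt) x)
    rw [hnv] at hn
    linarith
  have hcheb := Lp.mul_meas_ge_le_pow_enorm' (𝓕⁻ (hhi.toLp _) : SqInt) (by norm_num) (by norm_num)
    (ENNReal.ofReal (l / 2))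
  have hnorm : ‖(𝓕⁻ (hhi.toLp _) : SqInt)‖ = ‖hhi.toLp _‖ :=
    (Lp.fourierTransformₗᵢ R3 ℂ).symm.norm_map _
  rw [hnorm, Lp.norm_toLp, ENNReal.ofReal_toReal hhi.eLpNorm_ne_top,
    eLpNorm_eq_lintegral_rpow_enorm_toReal (by norm_num) (by norm_num)] at hcheb
  simp only [ENNReal.toReal_ofNat] at hcheb
  rw [← ENNReal.rpow_mul, one_div_mul_cancel (by norm_num), ENNReal.rpow_one] at hcheb
  have hind : ∀ ξ, ‖Bᶜ.indicator (fun ξ => m ξ * v ξ) ξ‖ₑ ^ (2 : ℝ) =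
      Bᶜ.indicator (fun ξ => ‖m ξ * v ξ‖ₑ ^ (2 : ℝ)) ξ := by
    intro ξ
    by_cases h : ξ ∈ B <;> simp [h]
  simp only [hind] at hcheb
  rw [lintegral_indicator hBm.compl] at hcheb
  refine le_trans (mul_le_mul' (le_of_eq ?_) hsub) hcheb
  rw [ENNReal.rpow_two, ENNReal.ofReal_pow (by positivity)]

lemma lintegral_Ioi_indicator_rpow_le {r : ℝ} (hr : 0 < r) {b : ℝ} (hb : 0 ≤ b) :
    ∫⁻ l in Ioi (0 : ℝ), ENNReal.ofReal (4 * l ^ (r - 1)) * (Iic b).indicator 1 l ≤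
      ENNReal.ofReal (4 / r * b ^ r) := by
  have e : ∀ l, ENNReal.ofReal (4 * l ^ (r - 1)) * (Iic b).indicator 1 l =
      (Iic b).indicator (fun l => ENNReal.ofReal (4 * l ^ (r - 1))) l := by
    intro l
    by_cases h : l ∈ Iic b <;> simp [h]
  have hii : IntegrableOn (fun l : ℝ => 4 * l ^ (r - 1)) (Ioc 0 b) :=
    ((intervalIntegral.intervalIntegrable_rpow' (show -1 < r - 1 by linarith)).1).const_mul 4
  simp only [e]
  rw [setLIntegral_indicator measurableSet_Iic, inter_comm, Ioi_inter_Iic,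
    ← ofReal_integral_eq_lintegral_ofReal hii ((ae_restrict_iff' measurableSet_Ioc).2
      (Eventually.of_forall fun l hl => by have := hl.1; positivity)), integral_const_mul,
    ← intervalIntegral.integral_of_le hb, integral_rpow (Or.inl (by linarith)), sub_add_cancel,
    Real.zero_rpow hr.ne']
  refine ENNReal.ofReal_le_ofReal (le_of_eq ?_)
  ring

/-- The Sobolev embedding of the homogeneous `Ḣ^a` into `L^p`, `a = 3 (1/2 - 1/p)`. -/
lemma exists_eLpNorm_fourierMul_le {p a : ℝ} (hp : 2 < p) (ha : a = 3 * (1 / 2 - 1 / p)) :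
    ∃ C : ℝ, 0 ≤ C ∧ ∀ (m : R3 → ℂ) (hm : MemLp m ∞ (volume : Measure R3)), Measurable m →
      (∀ ξ, ‖m ξ‖ * ‖ξ‖ ^ a ≤ 1) → ∀ u : SqInt,
      eLpNorm (fourierMul hm u) (ENNReal.ofReal p) volume ≤ ENNReal.ofReal (C * ‖u‖) := by
  have hp0 : 0 < p := by linarith
  have ha' : a < 3 / 2 := by rw [ha]; linarith [show 0 < 1 / p by positivity]
  have h6 : 3 - 2 * a = 6 / p := by rw [ha]; ring
  set K := 3 * volume.real (Metric.ball (0 : R3) 1) / (3 - 2 * a) with hK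
  have hK0 : 0 < K := by
    have h1 : 0 < volume.real (Metric.ball (0 : R3) 1) :=
      ENNReal.toReal_pos (Metric.measure_ball_pos volume 0 one_pos).ne' measure_ball_lt_top.ne
    have h2 : 0 < 3 - 2 * a := by linarith
    positivity
  set c := K ^ (1 / 2 : ℝ) with hc
  have hc0 : 0 < c := by positivity
  have hp2 : 0 < p - 2 := by linarith
  -- The factor p comes from the layer cake formula, 4 from the level l/2 squared, 1/(p - 2) from
  -- integrating l^{p-3}, and 2c from the choice of `κ`.
  refine ⟨(p * (4 / (p - 2) * (2 * c) ^ (p - 2))) ^ (1 / p), by positivity,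
    fun m hm hmm hma u => ?_⟩
  rcases (norm_nonneg u).eq_or_lt with hN | hN
  · have h0 : u = 0 := norm_eq_zero.1 hN.symm
    have h1 : fourierMul hm u = 0 := by
      rw [h0]
      simpa using fourierMul_sub hm u u
    rw [h1, eLpNorm_congr_ae (Lp.coeFn_zero _ _ _)]
    simp
  set N := ‖u‖ with hNdef
  set v : SqInt := 𝓕 u with hv
  set h : SqInt := fourierMul hm u with hh
  have hvm : Measurable v := (Lp.stronglyMeasurable v).measurable
  have hhm : Measurable h := (Lp.stronglyMeasurable h).measurable
  set κ := 2 * c * N with hκ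
  have hκ0 : 0 < κ := by positivity
  set V : R3 → ℝ≥0∞ := fun ξ => ‖m ξ * v ξ‖ₑ ^ (2 : ℝ) with hV
  have hVm : Measurable V := by fun_prop
  -- The condition that ξ is a high frequency at level l, solved for l so that the l-integral can be
  -- taken first.
  set I : ℝ → R3 → ℝ≥0∞ := fun l ξ => (Iic (κ * ‖ξ‖ ^ (3 / p))).indicator 1 l with hI
  have hIm : Measurable (Function.uncurry I) := by
    have e : Function.uncurry I =
        {x : ℝ × R3 | x.1 ≤ κ * ‖x.2‖ ^ (3 / p)}.indicator 1 := by
      ext x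
      simp only [hI, Function.uncurry, indicator, mem_Iic, mem_ofPred_eq, Pi.one_apply]
    rw [e]
    refine measurable_one.indicator (measurableSet_le measurable_fst ?_)
    fun_prop
  have hdist : ∀ l ∈ Ioi (0 : ℝ), volume {x | l < ‖h x‖} * ENNReal.ofReal (l ^ (p - 1)) ≤
      ∫⁻ ξ, ENNReal.ofReal (4 * l ^ (p - 2 - 1)) * I l ξ * V ξ := by
    intro l hl
    have hl : 0 < l := hl
    -- The radius at which the low-frequency bound c A^{3/p}‖u‖ equals l/2 exactly.
    set A := (l / κ) ^ (p / 3) with hA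
    have hA0 : 0 ≤ A := by positivity
    have hA3 : A ^ (3 / p) = l / κ := by
      rw [hA, ← Real.rpow_mul (by positivity), show p / 3 * (3 / p) = 1 by field_simp, Real.rpow_one]
    have key := mul_measure_lt_norm_fourierMul_le ha' hm hma u hA0 hl (by
      rw [← hK, Real.mul_rpow hK0.le (by positivity), ← hc, ← Real.rpow_mul hA0, h6,
        show 6 / p * (1 / 2) = 3 / p by ring, hA3, hκ, ← hNdef]
      refine le_of_eq ?_
      field_simp)
    have e1 : volume {x | l < ‖h x‖} * ENNReal.ofReal (l ^ (p - 1)) =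
        ENNReal.ofReal (4 * l ^ (p - 2 - 1)) *
          (ENNReal.ofReal ((l / 2) ^ 2) * volume {x | l < ‖h x‖}) := by
      rw [← mul_assoc, ← ENNReal.ofReal_mul (by positivity), mul_comm]
      congr 2
      rw [show p - 1 = p - 2 - 1 + 2 by ring, Real.rpow_add hl, Real.rpow_two]
      ring
    rw [e1]
    simp only [mul_assoc]
    rw [lintegral_const_mul' _ _ ENNReal.ofReal_ne_top]
    refine mul_le_mul_right (key.trans ?_) _
    rw [← lintegral_indicator measurableSet_ball.compl]
    refine lintegral_mono fun ξ => ?_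
    by_cases hξ : ξ ∈ (Metric.ball (0 : R3) A)ᶜ
    · rw [indicator_of_mem hξ]
      have hξ' : A ≤ ‖ξ‖ := by simpa using hξ
      have : l ∈ Iic (κ * ‖ξ‖ ^ (3 / p)) := by
        have h1 : A ^ (3 / p) ≤ ‖ξ‖ ^ (3 / p) := by gcongr
        rw [hA3, div_le_iff₀ hκ0] at h1
        rw [mem_Iic]
        linarith
      simp only [hI, indicator_of_mem this, Pi.one_apply, one_mul]
      exact le_rfl
    · rw [indicator_of_notMem hξ]
      exact zero_le
  -- The l-integral produces |ξ|^{(3/p)(p-2)} = |ξ|^{2a}, exactly what |m|² compensates, and ‖u‖² is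
  -- left by Plancherel.
  have hinner : ∀ ξ, ∫⁻ l in Ioi (0 : ℝ), ENNReal.ofReal (4 * l ^ (p - 2 - 1)) * I l ξ * V ξ ≤
      ENNReal.ofReal (4 / (p - 2) * κ ^ (p - 2)) * ‖v ξ‖ₑ ^ (2 : ℝ) := by
    intro ξ
    have hVξ : V ξ ≠ ∞ := ENNReal.rpow_ne_top_of_nonneg (by norm_num) enorm_ne_top
    rw [lintegral_mul_const' _ _ hVξ]
    refine (mul_le_mul_left (lintegral_Ioi_indicator_rpow_le hp2 (by positivity)) _).trans ?_
    have hVe : V ξ = ENNReal.ofReal (‖m ξ‖ ^ 2) * ‖v ξ‖ₑ ^ (2 : ℝ) := by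
      simp only [hV, enorm_mul]
      rw [ENNReal.mul_rpow_of_nonneg _ _ (by norm_num), ← ofReal_norm (m ξ), ENNReal.rpow_two,
        ← ENNReal.ofReal_pow (norm_nonneg _)]
    rw [hVe, ← mul_assoc, ← ENNReal.ofReal_mul (by positivity)]
    refine mul_le_mul_left (ENNReal.ofReal_le_ofReal ?_) _
    rw [Real.mul_rpow hκ0.le (by positivity), ← Real.rpow_mul (norm_nonneg _),
      show 3 / p * (p - 2) = a * 2 by rw [ha]; field_simp, Real.rpow_mul (norm_nonneg _),
      Real.rpow_two]
    have h1 := hma ξ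
    have h2 : (‖m ξ‖ * ‖ξ‖ ^ a) ^ 2 ≤ 1 := pow_le_one₀ (by positivity) h1
    calc 4 / (p - 2) * (κ ^ (p - 2) * (‖ξ‖ ^ a) ^ 2) * ‖m ξ‖ ^ 2
        = 4 / (p - 2) * κ ^ (p - 2) * (‖m ξ‖ * ‖ξ‖ ^ a) ^ 2 := by ring
      _ ≤ 4 / (p - 2) * κ ^ (p - 2) * 1 := by gcongr
      _ = _ := mul_one _
  have hv2 : ∫⁻ ξ, ‖v ξ‖ₑ ^ (2 : ℝ) = ENNReal.ofReal (N ^ 2) := by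
    have h1 : ‖v‖ = N := Lp.norm_fourier_eq u
    rw [ENNReal.ofReal_pow hN.le, ← h1, Lp.norm_def, ENNReal.ofReal_toReal (Lp.eLpNorm_ne_top v),
      eLpNorm_eq_lintegral_rpow_enorm_toReal (by norm_num) (by norm_num), ← ENNReal.rpow_two,
      ← ENNReal.rpow_mul]
    norm_num
  have main : ∫⁻ x, ENNReal.ofReal (‖h x‖ ^ p) ≤
      ENNReal.ofReal (p * (4 / (p - 2) * (2 * c) ^ (p - 2)) * N ^ p) := by
    rw [lintegral_rpow_eq_lintegral_meas_lt_mul volume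
      (Eventually.of_forall fun x => norm_nonneg _) hhm.norm.aemeasurable hp0]
    calc _ ≤ ENNReal.ofReal p * ∫⁻ l in Ioi (0 : ℝ),
          ∫⁻ ξ, ENNReal.ofReal (4 * l ^ (p - 2 - 1)) * I l ξ * V ξ :=
          mul_le_mul_right (setLIntegral_mono' measurableSet_Ioi hdist) _
      _ = ENNReal.ofReal p * ∫⁻ ξ, ∫⁻ l in Ioi (0 : ℝ),
          ENNReal.ofReal (4 * l ^ (p - 2 - 1)) * I l ξ * V ξ := by
          rw [lintegral_lintegral_swap]
          refine Measurable.aemeasurable ?_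
          exact (Measurable.mul (by fun_prop) hIm).mul (hVm.comp measurable_snd)
      _ ≤ ENNReal.ofReal p * ∫⁻ ξ, ENNReal.ofReal (4 / (p - 2) * κ ^ (p - 2)) *
          ‖v ξ‖ₑ ^ (2 : ℝ) := mul_le_mul_right (lintegral_mono hinner) _
      _ = _ := by
          rw [lintegral_const_mul' _ _ ENNReal.ofReal_ne_top, hv2,
            ← ENNReal.ofReal_mul (by positivity), ← ENNReal.ofReal_mul hp0.le]
          congr 1
          rw [hκ, Real.mul_rpow (by positivity) hN.le]
          have hNp : N ^ p = N ^ (p - 2) * N ^ 2 := by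
            rw [← Real.rpow_two, ← Real.rpow_add hN, sub_add_cancel]
          rw [hNp]
          ring
  rw [eLpNorm_eq_lintegral_rpow_enorm_toReal (by simpa using hp0) (by simp),
    ENNReal.toReal_ofReal hp0.le]
  have e : ∀ x, ‖h x‖ₑ ^ p = ENNReal.ofReal (‖h x‖ ^ p) := fun x => by
    rw [← ofReal_norm, ENNReal.ofReal_rpow_of_nonneg (norm_nonneg _) hp0.le]
  simp only [e]
  calc _ ≤ ENNReal.ofReal (p * (4 / (p - 2) * (2 * c) ^ (p - 2)) * N ^ p) ^ (1 / p) :=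
        ENNReal.rpow_le_rpow main (by positivity)
    _ = _ := by
        rw [ENNReal.ofReal_rpow_of_nonneg (by positivity) (by positivity),
          Real.mul_rpow (by positivity) (by positivity), ← Real.rpow_mul hN.le,
          mul_one_div_cancel hp0.ne', Real.rpow_one]

end SobolevEmbedding

/-! ### Bessel potentials, the dual Sobolev embedding, and the estimate for simple functions. -/

section BesselPotential

open Filter Topology Set

/-- The symbol of `⟨∇⟩^s`. -/
noncomputable def bracketSymbol (s : ℝ) (ξ : R3) : ℂ :=
  (((1 + (2 * Real.pi * ‖ξ‖) ^ 2) ^ (s / 2) : ℝ) : ℂ)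

lemma japaneseBracket_eq (s : ℝ) :
    japaneseBracket s = fourierMultiplierCLM ℂ (bracketSymbol s) := rfl

lemma one_le_one_add_sq (ξ : R3) : 1 ≤ 1 + (2 * Real.pi * ‖ξ‖) ^ 2 := by
  linarith [sq_nonneg (2 * Real.pi * ‖ξ‖)]

lemma bracketSymbol_mul (s r : ℝ) (ξ : R3) :
    bracketSymbol s ξ * bracketSymbol r ξ = bracketSymbol (s + r) ξ := by
  have := one_le_one_add_sq ξ
  rw [bracketSymbol, bracketSymbol, bracketSymbol, ← Complex.ofReal_mul,
    ← Real.rpow_add (by linarith), ← add_div]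

lemma bracketSymbol_zero (ξ : R3) : bracketSymbol 0 ξ = 1 := by simp [bracketSymbol]

lemma conj_bracketSymbol (s : ℝ) (ξ : R3) :
    (starRingEnd ℂ) (bracketSymbol s ξ) = bracketSymbol s ξ := Complex.conj_ofReal _

lemma hasTemperateGrowth_bracketSymbol (s : ℝ) : (bracketSymbol s).HasTemperateGrowth := by
  have h1 := Function.hasTemperateGrowth_one_add_norm_sq_rpow R3 (s / 2)
  have h2 : (fun ξ : R3 => (2 * Real.pi) • ξ).HasTemperateGrowth := by fun_prop
  have h3 := Function.Complex.hasTemperateGrowth_ofReal.comp (h1.comp h2)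
  refine (show bracketSymbol s = _ from ?_) ▸ h3
  ext ξ
  simp only [bracketSymbol, Function.comp, norm_smul]
  rw [Real.norm_of_nonneg (by positivity)]

lemma continuous_bracketSymbol (s : ℝ) : Continuous (bracketSymbol s) :=
  (hasTemperateGrowth_bracketSymbol s).1.continuous

lemma norm_bracketSymbol (s : ℝ) (ξ : R3) :
    ‖bracketSymbol s ξ‖ = (1 + (2 * Real.pi * ‖ξ‖) ^ 2) ^ (s / 2) := by
  rw [bracketSymbol, Complex.norm_real, Real.norm_of_nonneg (by positivity)]

lemma norm_bracketSymbol_neg_le_one {s : ℝ} (hs : 0 ≤ s) (ξ : R3) : ‖bracketSymbol (-s) ξ‖ ≤ 1 := by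
  rw [norm_bracketSymbol]
  exact Real.rpow_le_one_of_one_le_of_nonpos (one_le_one_add_sq ξ) (by linarith)

lemma norm_bracketSymbol_neg_mul_le_one {s : ℝ} (hs : 0 ≤ s) (ξ : R3) :
    ‖bracketSymbol (-s) ξ‖ * ‖ξ‖ ^ s ≤ 1 := by
  have h1 := one_le_one_add_sq ξ
  have h2 : ‖ξ‖ ^ s ≤ (1 + (2 * Real.pi * ‖ξ‖) ^ 2) ^ (s / 2) := by
    rw [show s = 2 * (s / 2) by ring, Real.rpow_mul (norm_nonneg _), Real.rpow_two,
      mul_div_cancel_left₀ _ two_ne_zero]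
    gcongr
    have h3 : ‖ξ‖ ≤ 2 * Real.pi * ‖ξ‖ :=
      le_mul_of_one_le_left (norm_nonneg _) (by linarith [Real.pi_gt_three])
    linarith [pow_le_pow_left₀ (norm_nonneg ξ) h3 2]
  rw [norm_bracketSymbol, neg_div, Real.rpow_neg (by linarith)]
  exact inv_mul_le_one_of_le₀ h2 (by positivity)

lemma memLp_bracketSymbol_neg {s : ℝ} (hs : 0 ≤ s) :
    MemLp (bracketSymbol (-s)) ∞ (volume : Measure R3) :=
  memLp_top_of_bound (continuous_bracketSymbol _).aestronglyMeasurable 1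
    (Eventually.of_forall (norm_bracketSymbol_neg_le_one hs))

lemma radialSymbol_eq_symbol_mul (σ t θ : ℝ) (ξ : R3) :
    radialSymbol σ t θ ξ = symbol σ t ξ * bracketSymbol (-(3 * θ)) ξ := by
  have h1 := one_le_one_add_sq ξ
  rw [radialSymbol, amplitude, bracketSymbol, Real.rpow_def_of_pos (by linarith)]
  push_cast
  congr 2
  ring

/-- The Bessel potential `⟨∇⟩^(-s)` on `L²`. -/
noncomputable def besselL2 {s : ℝ} (hs : 0 ≤ s) (u : SqInt) : SqInt :=
  fourierMul (memLp_bracketSymbol_neg hs) u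

lemma norm_besselL2_le {s : ℝ} (hs : 0 ≤ s) (u : SqInt) : ‖besselL2 hs u‖ ≤ ‖u‖ :=
  norm_fourierMul_le _ (norm_bracketSymbol_neg_le_one hs) u

lemma besselL2_besselL2 {a s : ℝ} (ha : 0 ≤ a) (hs : 0 ≤ s) (h : s = 2 * a)
    (u : SqInt) : besselL2 ha (besselL2 ha u) = besselL2 hs u :=
  fourierMul_fourierMul _ _ _ (fun ξ => by rw [bracketSymbol_mul, h]; congr 1; ring) u

/-- Self-adjointness of the Bessel potential, in the form used by the TT* argument for the dual
embedding. -/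
lemma norm_besselL2_sq {s : ℝ} (hs : 0 ≤ s) (u : SqInt) :
    ((‖besselL2 hs u‖ ^ 2 : ℝ) : ℂ) =
      inner ℂ u (besselL2 hs (besselL2 hs u)) := by
  have h := inner_self_eq_norm_sq_to_K (𝕜 := ℂ) (besselL2 hs u)
  push_cast
  refine Eq.trans h.symm ?_
  unfold besselL2
  rw [inner_fourierMul, inner_fourierMul]
  refine integral_congr_ae ?_
  filter_upwards [coeFn_fourier_fourierMul (memLp_bracketSymbol_neg hs) u] with ξ hξ
  rw [hξ, map_mul, conj_bracketSymbol]
  ring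

lemma ofReal_norm_inner_le {p q : ℝ} (hpq : p.HolderConjugate q) {u : R3 → ℂ}
    (hu : MemLp u 2 volume) (h : SqInt) : ENNReal.ofReal ‖inner ℂ (hu.toLp u) h‖ ≤
      eLpNorm u (ENNReal.ofReal q) volume * eLpNorm h (ENNReal.ofReal p) volume := by
  have := hpq.symm.ennrealOfReal
  have h1 : eLpNorm ((fun x => (starRingEnd ℂ) (u x)) • (h : R3 → ℂ)) 1 volume ≤
      eLpNorm (fun x => (starRingEnd ℂ) (u x)) (ENNReal.ofReal q) volume *
        eLpNorm h (ENNReal.ofReal p) volume :=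
    eLpNorm_smul_le_mul_eLpNorm (Lp.aestronglyMeasurable h)
      (Complex.continuous_conj.comp_aestronglyMeasurable hu.1)
  have h2 : eLpNorm (fun x => (starRingEnd ℂ) (u x)) (ENNReal.ofReal q) volume =
      eLpNorm u (ENNReal.ofReal q) volume :=
    eLpNorm_congr_norm_ae (Eventually.of_forall fun x => RCLike.norm_conj _)
  rw [h2] at h1
  refine le_trans ?_ h1
  rw [ofReal_norm, L2.inner_def, eLpNorm_one_eq_lintegral_enorm]
  refine (enorm_integral_le_lintegral_enorm _).trans (le_of_eq (lintegral_congr_ae ?_))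
  filter_upwards [hu.coeFn_toLp] with x hx
  rw [hx, RCLike.inner_apply, Pi.smul_apply', smul_eq_mul, mul_comm]

/-- The dual of the Sobolev embedding. -/
lemma exists_norm_besselL2_le {p q a : ℝ} (hpq : p.HolderConjugate q) (hp : 2 ≤ p)
    (ha : a = 3 * (1 / 2 - 1 / p)) (ha0 : 0 ≤ a) : ∃ C : ℝ, 0 ≤ C ∧
      (∀ (u : R3 → ℂ) (hu : MemLp u 2 volume), MemLp u (ENNReal.ofReal q) volume →
        ‖besselL2 ha0 (hu.toLp u)‖ ≤ C * (eLpNorm u (ENNReal.ofReal q) volume).toReal) ∧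
      ∀ (σ t : ℝ) (u : SqInt), eLpNorm (propagator σ t (besselL2 ha0 u))
        (ENNReal.ofReal p) volume ≤ ENNReal.ofReal (C * ‖u‖) := by
  obtain ⟨C, hC, hS⟩ : ∃ C : ℝ, 0 ≤ C ∧ ∀ (m : R3 → ℂ) (hm : MemLp m ∞ (volume : Measure R3)),
      Measurable m → (∀ ξ, ‖m ξ‖ * ‖ξ‖ ^ a ≤ 1) → ∀ u : SqInt,
      eLpNorm (fourierMul hm u) (ENNReal.ofReal p) volume ≤ ENNReal.ofReal (C * ‖u‖) := by
    rcases hp.eq_or_lt with rfl | hp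
    · refine ⟨1, zero_le_one, fun m hm _ hma u => ?_⟩
      have ha0 : a = 0 := by rw [ha]; norm_num
      have h1 := norm_fourierMul_le hm (fun ξ => by simpa [ha0] using hma ξ) u
      rw [one_mul, ENNReal.ofReal_ofNat, ← ENNReal.ofReal_toReal (Lp.eLpNorm_ne_top _),
        ← Lp.norm_def]
      exact ENNReal.ofReal_le_ofReal h1
    · exact exists_eLpNorm_fourierMul_le hp ha
  have hbm := (continuous_bracketSymbol (-a)).measurable
  refine ⟨C, hC, fun u hu huq => ?_, fun σ t u => ?_⟩
  -- ‖w‖² = ⟨u, ⟨∇⟩^{-a}w⟩ ≤ ‖u‖_q ‖⟨∇⟩^{-a}w‖_p ≤ C ‖u‖_q ‖w‖, and one factor ‖w‖ is divided out.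
  · set w := besselL2 ha0 (hu.toLp u) with hw
    have h1 := ofReal_norm_inner_le hpq hu (besselL2 ha0 w)
    rw [hw, ← norm_besselL2_sq, Complex.norm_real, Real.norm_of_nonneg (sq_nonneg _),
      ← hw] at h1
    have h2 := h1.trans (mul_le_mul_right
      (hS _ (memLp_bracketSymbol_neg ha0) hbm (norm_bracketSymbol_neg_mul_le_one ha0) w) _)
    rw [← ENNReal.ofReal_toReal huq.eLpNorm_ne_top, ← ENNReal.ofReal_mul ENNReal.toReal_nonneg,
      ENNReal.ofReal_le_ofReal_iff (by positivity)] at h2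
    rcases (norm_nonneg w).eq_or_lt with h0 | h0
    · rw [← h0]
      positivity
    · refine le_of_mul_le_mul_right ?_ h0
      calc ‖w‖ * ‖w‖ = ‖w‖ ^ 2 := (sq _).symm
        _ ≤ _ := h2
        _ = _ := by ring
  -- The Sobolev embedding uses only the modulus of the symbol, so the unimodular propagator may be
  -- included in it, uniformly in t.
  · have hm : MemLp (fun ξ => symbol σ t ξ * bracketSymbol (-a) ξ) ∞ (volume : Measure R3) :=
      (memLp_bracketSymbol_neg ha0).mul' (symbol_memLp σ t)
    rw [propagator_eq_fourierMul, besselL2,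
      fourierMul_fourierMul hm (symbol_memLp σ t) (memLp_bracketSymbol_neg ha0) (fun _ => rfl)]
    have hsm : Measurable (symbol σ t) := by
      unfold symbol dispersion
      fun_prop
    refine hS _ hm (hsm.mul hbm) (fun ξ => ?_) u
    rw [norm_mul, norm_symbol, one_mul]
    exact norm_bracketSymbol_neg_mul_le_one ha0 ξ

/-- The dispersive estimate for simple functions, and the bound that makes `⟨∇⟩^(-s)` map `L^q`
to `L²`. -/
lemma exists_eLpNorm_propagator_besselL2_le {σ : ℝ} (hσ₀ : 0 < σ) (hσ₂ : σ < 2) {p q s : ℝ}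
    (hpq : p.HolderConjugate q) (hp : 2 ≤ p) (hs : s = 6 * (1 / 2 - 1 / p)) (hs0 : 0 ≤ s) :
    ∃ C : ℝ, 0 < C ∧ ∀ (u : SimpleFunc R3 ℂ) (hu : MemLp u 2 volume),
      ‖besselL2 hs0 (hu.toLp u)‖ ≤ C * (eLpNorm u (ENNReal.ofReal q) volume).toReal ∧
      ∀ t, 0 ≤ t → eLpNorm (propagator σ t (besselL2 hs0 (hu.toLp u)))
        (ENNReal.ofReal p) volume ≤
          ENNReal.ofReal (C * (1 + t) ^ (-decayRate σ p)) *
            eLpNorm u (ENNReal.ofReal q) volume := by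
  have hp0 : 0 < p := by linarith
  have hq0 : 0 < q := hpq.symm.pos
  have hinv : 1 / p ≤ 1 / 2 := one_div_le_one_div_of_le two_pos hp
  have ha0 : 0 ≤ 3 * (1 / 2 - 1 / p) := by linarith
  have hsa : s = 2 * (3 * (1 / 2 - 1 / p)) := by rw [hs]; ring
  have hβ : 0 ≤ decayRate σ p := by
    unfold decayRate
    split_ifs <;> linarith
  obtain ⟨C, hC, hdual, hsob⟩ := exists_norm_besselL2_le hpq hp rfl ha0
  obtain ⟨K, hK, hdisp⟩ := exists_eLpNorm_fourierMul_radialSymbol_le hσ₀ hσ₂ hpq hp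
  -- The summands serve, in order, the bound into L², the times t ≤ 1 (with C²) and t ≥ 1 (with K),
  -- and positivity. The power of 2 comes from replacing 1 or t by (1 + t)/2.
  refine ⟨C + (C ^ 2 + K) * 2 ^ decayRate σ p + 1, by positivity, fun u hu => ?_⟩
  have huq : MemLp u (ENNReal.ofReal q) volume :=
    (SimpleFunc.memLp_iff_integrable (by simpa using hq0) (by simp)).2
      ((SimpleFunc.memLp_iff_integrable two_ne_zero (by norm_num)).1 hu)
  have h1 := hdual u hu huq
  rw [← besselL2_besselL2 ha0 hs0 hsa]
  set E := eLpNorm u (ENNReal.ofReal q) volume with hE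
  have hE0 : 0 ≤ E.toReal := ENNReal.toReal_nonneg
  refine ⟨((norm_besselL2_le ha0 _).trans h1).trans ?_, fun t ht => ?_⟩
  · gcongr
    have : 0 ≤ (C ^ 2 + K) * 2 ^ decayRate σ p := by positivity
    linarith
  have h2β : 0 < (2 : ℝ) ^ decayRate σ p := by positivity
  have hdecay : ∀ r : ℝ, 0 < r → 1 + t ≤ 2 * r → r ^ (-decayRate σ p) ≤
      2 ^ decayRate σ p * (1 + t) ^ (-decayRate σ p) := by
    intro r hr hrt
    calc r ^ (-decayRate σ p) ≤ ((1 + t) / 2) ^ (-decayRate σ p) :=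
          Real.rpow_le_rpow_of_nonpos (by linarith) (by linarith) (by linarith)
      _ = _ := by
          rw [Real.div_rpow (by linarith) (by norm_num), Real.rpow_neg (by norm_num : (0:ℝ) ≤ 2)]
          field_simp
  have hX : 0 < (1 + t) ^ (-decayRate σ p) := by positivity
  set X := (1 + t) ^ (-decayRate σ p) with hXdef
  set T := (2 : ℝ) ^ decayRate σ p with hT
  -- For short times s = 2a is split into two halves: L^q to L² by the dual embedding, then L² to
  -- L^p by the embedding.
  rcases le_total t 1 with ht1 | ht1
  · refine (hsob σ t _).trans ?_
    rw [← ENNReal.ofReal_toReal (show E ≠ ∞ from huq.eLpNorm_ne_top),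
      ← ENNReal.ofReal_mul (by positivity)]
    refine ENNReal.ofReal_le_ofReal ?_
    have h3 : 1 ≤ T * X := by simpa using hdecay 1 one_pos (by linarith)
    calc C * ‖besselL2 ha0 (hu.toLp u)‖ ≤ C * (C * E.toReal) := by gcongr
      _ = C ^ 2 * 1 * E.toReal := by ring
      _ ≤ C ^ 2 * (T * X) * E.toReal := by gcongr
      _ = C ^ 2 * T * X * E.toReal := by ring
      _ ≤ (C + (C ^ 2 + K) * T + 1) * X * E.toReal := by
          gcongr
          nlinarith [mul_nonneg hK h2β.le]
  · have hm := memLp_radialSymbol hσ₂ t (z := ((1 - 2 / p : ℝ) : ℂ)) (by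
      rw [Complex.ofReal_re]
      linarith [show 2 / p = 2 * (1 / p) by ring])
    rw [besselL2_besselL2 ha0 hs0 hsa, propagator_eq_fourierMul, besselL2,
      fourierMul_fourierMul hm (symbol_memLp σ t) (memLp_bracketSymbol_neg hs0) (fun ξ => by
        rw [radialSymbol_eq_symbol_mul, hs]
        congr 2
        ring)]
    refine (hdisp t ht1 hm u hu).trans (mul_le_mul_left (ENNReal.ofReal_le_ofReal ?_) _)
    calc K * t ^ (-decayRate σ p) ≤ K * (T * X) := by
          gcongr
          exact hdecay t (by linarith) (by linarith)
      _ = K * T * X := by ring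
      _ ≤ _ := by
          gcongr
          nlinarith [mul_nonneg (sq_nonneg C) h2β.le]

end BesselPotential

/-! ### Passage from simple functions to Sobolev functions. -/

section DispersiveEstimate

open Filter Topology Set

lemma ofReal_conjExponent {p q : ℝ} (hpq : p.HolderConjugate q) :
    (ENNReal.ofReal p).conjExponent = ENNReal.ofReal q := by
  have := hpq.ennrealOfReal
  exact ENNReal.HolderConjugate.conjExponent_eq

lemma toTemperedDistribution_congr {p q : ℝ≥0∞} [Fact (1 ≤ p)] [Fact (1 ≤ q)]
    {f : Lp (α := R3) ℂ p} {g : Lp (α := R3) ℂ q} (h : (f : R3 → ℂ) =ᵐ[volume] g) :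
    (f : 𝓢'(R3, ℂ)) = (g : 𝓢'(R3, ℂ)) := by
  ext φ
  rw [Lp.toTemperedDistribution_apply, Lp.toTemperedDistribution_apply]
  refine integral_congr_ae ?_
  filter_upwards [h] with x hx
  rw [hx]

lemma japaneseBracket_neg_japaneseBracket (s : ℝ) (T : 𝓢'(R3, ℂ)) :
    japaneseBracket (-s) (japaneseBracket s T) = T := by
  have h : bracketSymbol (-s) * bracketSymbol s = fun _ => 1 := by
    ext ξ
    rw [Pi.mul_apply, bracketSymbol_mul, neg_add_cancel, bracketSymbol_zero]
  rw [japaneseBracket_eq, japaneseBracket_eq,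
    fourierMultiplierCLM_fourierMultiplierCLM_apply (hasTemperateGrowth_bracketSymbol _)
      (hasTemperateGrowth_bracketSymbol _)]
  rw [mul_comm] at h
  simp only [h, fourierMultiplierCLM_const, one_smul, ContinuousLinearMap.id_apply]

/-- Every `f = ⟨∇⟩^(-s) g` with `g ∈ L^q` is a limit in `L²` of functions `⟨∇⟩^(-s) u` with simple
`u` converging to `g` in `L^q`. -/
lemma exists_seq_besselL2_tendsto {q : ℝ≥0∞} [Fact (1 ≤ q)] (hq : q ≠ ∞) {s C : ℝ} (hs : 0 ≤ s)
    (hC : ∀ (u : SimpleFunc R3 ℂ) (hu : MemLp u 2 volume),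
      ‖besselL2 hs (hu.toLp u)‖ ≤ C * (eLpNorm u q volume).toReal)
    {f g : Lp (α := R3) ℂ q} (hfg : japaneseBracket s (f : 𝓢'(R3, ℂ)) = (g : 𝓢'(R3, ℂ))) :
    ∃ (u : ℕ → SimpleFunc R3 ℂ) (hu : ∀ n, MemLp (u n) 2 volume) (F : SqInt),
      Tendsto (fun n => besselL2 hs ((hu n).toLp (u n))) atTop (𝓝 F) ∧
      Tendsto (fun n => eLpNorm (u n) q volume) atTop (𝓝 (eLpNorm g q volume)) ∧
      (f : R3 → ℂ) =ᵐ[volume] F := by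
  have hq0 : q ≠ 0 := (zero_lt_one.trans_le Fact.out).ne'
  have hgm : Measurable g := (Lp.stronglyMeasurable g).measurable
  have hg := Lp.memLp g
  set u : ℕ → SimpleFunc R3 ℂ := fun n => SimpleFunc.approxOn g hgm (range g ∪ {0}) 0 (by simp) n
    with hu
  have huq : ∀ n, MemLp (u n) q volume := SimpleFunc.memLp_approxOn_range hgm hg
  have hu2 : ∀ n, MemLp (u n) 2 volume := fun n =>
    (SimpleFunc.memLp_iff_integrable two_ne_zero (by norm_num)).2
      ((SimpleFunc.memLp_iff_integrable hq0 hq).1 (huq n))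
  have hlim : Tendsto (fun n => (huq n).toLp (u n)) atTop (𝓝 g) := by
    have := SimpleFunc.tendsto_approxOn_range_Lp hq hgm hg
    rwa [Lp.toLp_coeFn] at this
  -- Linearity and the bound for simple functions make the potentials a Cauchy sequence in L².
  have hdiff : ∀ n m, dist (besselL2 hs ((hu2 n).toLp (u n))) (besselL2 hs ((hu2 m).toLp (u m))) ≤
      C * dist ((huq n).toLp (u n)) ((huq m).toLp (u m)) := by
    intro n m
    have h2 : MemLp (u n - u m) 2 volume := by
      rw [SimpleFunc.coe_sub]
      exact (hu2 n).sub (hu2 m)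
    have h3 := hC (u n - u m) h2
    rw [dist_eq_norm, dist_eq_norm, besselL2, besselL2, ← fourierMul_sub, ← MemLp.toLp_sub,
      ← MemLp.toLp_sub, Lp.norm_toLp]
    exact h3
  have hcauchy : CauchySeq fun n => besselL2 hs ((hu2 n).toLp (u n)) := by
    rw [cauchySeq_iff_tendsto_dist_atTop_0]
    have h1 := (cauchySeq_iff_tendsto_dist_atTop_0.1 hlim.cauchySeq).const_mul C
    rw [mul_zero] at h1
    exact squeeze_zero (fun _ => dist_nonneg) (fun n => hdiff n.1 n.2) h1
  obtain ⟨F, hF⟩ := cauchySeq_tendsto_of_complete hcauchy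
  refine ⟨u, hu2, F, hF, ?_, ?_⟩
  · have h1 := ENNReal.tendsto_ofReal hlim.norm
    simp only [Lp.norm_def] at h1
    rw [ENNReal.ofReal_toReal (Lp.eLpNorm_ne_top g)] at h1
    refine h1.congr fun n => ?_
    rw [← Lp.norm_def, Lp.norm_toLp, ENNReal.ofReal_toReal (huq n).eLpNorm_ne_top]
  -- The L² limit and f = ⟨∇⟩^{-s}g agree as limits of the same tempered distributions, hence almost
  -- everywhere.
  · refine ae_eq_of_toTemperedDistribution_eq f F ?_
    have hdist : ∀ n, ((besselL2 hs ((hu2 n).toLp (u n)) : SqInt) : 𝓢'(R3, ℂ)) =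
        japaneseBracket (-s) (((huq n).toLp (u n) : Lp (α := R3) ℂ q) : 𝓢'(R3, ℂ)) := by
      intro n
      rw [besselL2, toTemperedDistribution_fourierMul _ (hasTemperateGrowth_bracketSymbol _),
        japaneseBracket_eq, toTemperedDistribution_congr
          ((hu2 n).coeFn_toLp.trans (huq n).coeFn_toLp.symm)]
    have c2 := (Lp.toTemperedDistributionCLM ℂ (volume : Measure R3) 2).continuous
    have cq := (Lp.toTemperedDistributionCLM ℂ (volume : Measure R3) q).continuous
    have t1 : Tendsto (fun n => ((besselL2 hs ((hu2 n).toLp (u n)) : SqInt) : 𝓢'(R3, ℂ))) atTop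
        (𝓝 (F : 𝓢'(R3, ℂ))) := (c2.tendsto F).comp hF
    have t2 : Tendsto (fun n => japaneseBracket (-s)
        (((huq n).toLp (u n) : Lp (α := R3) ℂ q) : 𝓢'(R3, ℂ))) atTop
        (𝓝 (japaneseBracket (-s) (g : 𝓢'(R3, ℂ)))) :=
      ((japaneseBracket (-s)).continuous.tendsto _).comp ((cq.tendsto g).comp hlim)
    rw [← hfg, japaneseBracket_neg_japaneseBracket] at t2
    exact tendsto_nhds_unique (t2.congr fun n => (hdist n).symm) t1

end DispersiveEstimate

theorem proposition3p1 (σ : ℝ) (hσ₀ : 0 < σ) (hσ₂ : σ < 2) (p : ℝ) (hp : 2 ≤ p) :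
    ∃ C : ℝ, 0 < C ∧
      ∀ f : Lp (α := R3) ℂ (ENNReal.ofReal p).conjExponent,
        sobolevENorm (6 * (1 / 2 - 1 / p)) f < ∞ →
        -- `f` is in `L²`, where the propagator is defined
        ∃ hf : MemLp f 2 volume,
          ∀ t : ℝ, 0 ≤ t →
            eLpNorm (propagator σ t (hf.toLp f)) (ENNReal.ofReal p) volume ≤
              ENNReal.ofReal (C * (1 + t) ^ (-decayRate σ p)) *
                sobolevENorm (6 * (1 / 2 - 1 / p)) f := by
  have hpq : p.HolderConjugate (p / (p - 1)) := .conjExponent (by linarith)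
  have hinv : 1 / p ≤ 1 / 2 := one_div_le_one_div_of_le two_pos hp
  have hs0 : 0 ≤ 6 * (1 / 2 - 1 / p) := by linarith
  obtain ⟨C, hC, hsimple⟩ :=
    exists_eLpNorm_propagator_besselL2_le hσ₀ hσ₂ hpq hp rfl hs0
  simp only [← ofReal_conjExponent hpq] at hsimple
  have hq : (ENNReal.ofReal p).conjExponent ≠ ∞ := by
    rw [ofReal_conjExponent hpq]
    exact ENNReal.ofReal_ne_top
  refine ⟨C, hC, fun f hf => ?_⟩
  have approx := fun g hg => exists_seq_besselL2_tendsto hq hs0 (fun u hu => (hsimple u hu).1)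
    (f := f) (g := g) hg
  -- A finite infimum is not over the empty family, so some representative g₀ exists; it is used
  -- only to place f in L².
  obtain ⟨g₀, hg₀⟩ : ∃ g : Lp (α := R3) ℂ (ENNReal.ofReal p).conjExponent,
      japaneseBracket (6 * (1 / 2 - 1 / p)) (f : 𝓢'(R3, ℂ)) = (g : 𝓢'(R3, ℂ)) := by
    by_contra! h
    simp only [sobolevENorm, h, iInf_false, iInf_top, lt_self_iff_false] at hf
  have hf2 : MemLp f 2 volume := by
    obtain ⟨-, -, F, -, -, hF⟩ := approx g₀ hg₀
    exact (memLp_congr_ae hF).2 (Lp.memLp F)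
  refine ⟨hf2, fun t ht => ?_⟩
  rw [sobolevENorm, ENNReal.mul_iInf_of_ne (by
    simp only [ne_eq, ENNReal.ofReal_eq_zero, not_le]; positivity) ENNReal.ofReal_ne_top]
  refine le_iInf fun g => ?_
  rw [ENNReal.mul_iInf_of_ne (by
    simp only [ne_eq, ENNReal.ofReal_eq_zero, not_le]; positivity) ENNReal.ofReal_ne_top]
  refine le_iInf fun hg => ?_
  obtain ⟨u, hu, F, hF, hn, hfF⟩ := approx g hg
  have hfF' : hf2.toLp f = F := Lp.ext (hf2.coeFn_toLp.trans hfF)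
  have hlim := ((continuous_fourierMul (symbol_memLp σ t) (fun ξ => (norm_symbol σ t ξ).le)).tendsto
    F).comp hF
  rw [hfF', propagator_eq_fourierMul]
  -- The approximating norms converge, so any b above the right side eventually dominates them. The
  -- propagated approximations converge in L², hence in measure, and the L^p norm is lower
  -- semicontinuous under that convergence.
  refine le_of_forall_gt_imp_ge_of_dense fun b hb => ?_
  have hbound := (ENNReal.Tendsto.const_mul hn (Or.inr ENNReal.ofReal_ne_top)).eventually_lt_const hb
  exact eLpNorm_le_of_tendstoInMeasure
    (hbound.mono fun n h => ((hsimple (u n) (hu n)).2 t ht).trans h.le)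
    (tendstoInMeasure_of_tendsto_Lp hlim) fun n => Lp.aestronglyMeasurable _
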